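/- Let $d\ge 1$, let $\mathcal H=[-\tfrac12,\tfrac12)^d$, and write $|S|$ for the Lebesgue measure of $S$. For $n,m\ge 1$ let $\mathbf x_1,\dots,\mathbf x_m$ be i.i.d. random vectors in $\mathcal H$ with probability density $f_x$, and let $\mathbf V$ be the $d$-fold $n^d\times m$ Vandermonde matrix with entries $$\mathbf V_{\boldsymbol\ell,q}=m^{-1/2}\exp\!\left(-2\pi i\,\boldsymbol\ell^{T}\mathbf x_q\right),\qquad \boldsymbol\ell\in\{0,\dots,n-1\}^d,\quad q=1,\dots,m .$$ Let $F^{(n,m)}(z)=n^{-d}\sum_{i}\mathbb P(\lambda_i\le z)$ be the average empirical distribution function of the $n^d$ eigenvalues $\lambda_i$ of $\mathbf V\mathbf V^{H}$. For $\beta>0$, a probability measure $\mu$ on $\mathbb R$ is the limiting spectral distribution (LSD) of $\mathbf V\mathbf V^{H}$ with ratio $\beta$ if, whenever $n,m\to\infty$ with $n^d/m\to\beta$, $F^{(n,m)}(z)\to\mu((-\infty,z])$ at every continuity point $z$ of the limit. Distributions are written as (generalized) densities. For every $\beta>0$ the LSD $f_{\lambda,u}(d,\beta,\cdot)$ for uniformly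 distributed phases ($f_x\equiv 1$ on $\mathcal H$) exists, and it depends measurably on $\beta$. Moreover, let $f_x$ be any probability density on $\mathcal H$, let $\mathcal A=\{\mathbf z\in\mathcal H: f_x(\mathbf z)>0\}$, and let $g_x$ be the (generalized) density of the distribution function $$G_x(y)=\frac{1}{|\mathcal A|}\left|\{\mathbf z\in\mathcal A: f_x(\mathbf z)\le y\}\right|,\qquad y>0 .$$ Then for every $\beta>0$ the LSD of $\mathbf V\mathbf V^{H}$ for phases with density $f_x$ exists and is $$f_{\lambda,x}(d,\beta,z)=(1-|\mathcal A|)\,\delta(z)+|\mathcal A|\int_0^\infty\frac{g_x(y)}{y}\,f_{\lambda,u}\!\left(d,\frac{\beta}{y},\frac{z}{y}\right)dy ,$$ that is, the measure assigning to each Borel set $S\subseteq\mathbb R$ the mass $$(1-|\mathcal A|)\,\mathbf 1\{0\in S\}+|\mathcal A|\int_{(0,\infty)}\mathbb P\!\left(y\,\lambda^{(\beta/y)}\in S\right)dG_x(y),$$ where $\lambda^{(b)}$ has distribution $f_{\lambda,u}(d,b,\cdot)$. -/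

import Mathlib

open MeasureTheory ProbabilityTheory Filter Topology Matrix

noncomputable section

/-- The half-open hypercube `[-1/2, 1/2)^d`. -/
def hypercube (d : ℕ) : Set (Fin d → ℝ) :=
  Set.univ.pi fun _ => Set.Ico (-1 / 2 : ℝ) (1 / 2)

/-- `f` is a probability density on the hypercube (values outside the hypercube are irrelevant). -/
structure IsPhaseDensity (d : ℕ) (f : (Fin d → ℝ) → ℝ) : Prop where
  measurable : Measurable f
  nonneg : ∀ z ∈ hypercube d, 0 ≤ f z
  lintegral_eq_one : ∫⁻ z in hypercube d, ENNReal.ofReal (f z) = 1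

/-- The law on the hypercube with Lebesgue density `f`. -/
def phaseLaw (d : ℕ) (f : (Fin d → ℝ) → ℝ) : Measure (Fin d → ℝ) :=
  (volume.restrict (hypercube d)).withDensity fun z => ENNReal.ofReal (f z)

/-- The density of the uniform distribution on the hypercube. -/
def uniformDensity (d : ℕ) : (Fin d → ℝ) → ℝ := fun _ => 1

/-- The `d`-fold `n^d × m` Vandermonde matrix with sampling points `x 0, …, x (m - 1)`.
The rows are indexed by the integer vectors `ℓ ∈ {0, …, n - 1}^d` themselves; numbering them by
`0, …, n^d - 1` only conjugates `V Vᴴ` by a permutation matrix. -/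
def foldVandermonde (d n m : ℕ) (x : Fin m → Fin d → ℝ) : Matrix (Fin d → Fin n) (Fin m) ℂ :=
  Matrix.of fun l q =>
    (((Real.sqrt m)⁻¹ : ℝ) : ℂ) *
      Complex.exp (-2 * Real.pi * Complex.I * ((∑ j, ((l j : ℕ) : ℝ) * x q j : ℝ) : ℂ))

/-- Empirical cumulative distribution function of the `n^d` eigenvalues (with multiplicity)
of `V Vᴴ`. -/
def empiricalSpectralCDF (d n m : ℕ) (x : Fin m → Fin d → ℝ) (z : ℝ) : ℝ :=
  (Nat.card {i : Fin d → Fin n //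
      (isHermitian_mul_conjTranspose_self (foldVandermonde d n m x)).eigenvalues i ≤ z} : ℝ)
    / (n : ℝ) ^ d

/-- Average empirical cumulative distribution function of the eigenvalues of `V Vᴴ`, for `m`
i.i.d. sampling points with density `f`. -/
def meanSpectralCDF (d n m : ℕ) (f : (Fin d → ℝ) → ℝ) (z : ℝ) : ℝ :=
  ∫ x, empiricalSpectralCDF d n m x z ∂(Measure.pi fun _ : Fin m => phaseLaw d f)

/-- `μ` is the limiting spectral distribution of `V Vᴴ` for i.i.d. sampling points with density
`f`, as `n, m → ∞` with `n^d / m → β`: the average empirical cumulative distribution functions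
converge to the one of `μ` at all its continuity points. -/
structure IsLSD (d : ℕ) (f : (Fin d → ℝ) → ℝ) (β : ℝ) (μ : Measure ℝ) : Prop where
  isProbabilityMeasure : IsProbabilityMeasure μ
  tendsto_cdf : ∀ N M : ℕ → ℕ, Tendsto N atTop atTop → Tendsto M atTop atTop →
    Tendsto (fun k => (N k : ℝ) ^ d / (M k : ℝ)) atTop (𝓝 β) →
    ∀ z : ℝ, ContinuousAt (fun t => cdf μ t) z →
      Tendsto (fun k => meanSpectralCDF d (N k) (M k) f z) atTop (𝓝 (cdf μ z))

/-- The set `A` of the points of the hypercube where `f` is strictly positive. -/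
def positivitySet (d : ℕ) (f : (Fin d → ℝ) → ℝ) : Set (Fin d → ℝ) :=
  {z | z ∈ hypercube d ∧ 0 < f z}

/-- The function `G_x(y) = |{z ∈ A : f z ≤ y}| / |A|`. -/
def phaseValueCDF (d : ℕ) (f : (Fin d → ℝ) → ℝ) (y : ℝ) : ENNReal :=
  volume {z | z ∈ positivitySet d f ∧ f z ≤ y} / volume (positivitySet d f)

/-- The distribution `g_x(y) dy` of the values of `f` on `A`, i.e. the distribution with
cumulative distribution function `G_x` (see `phaseValueLaw_Iic`). It may have atoms. -/
def phaseValueLaw (d : ℕ) (f : (Fin d → ℝ) → ℝ) : Measure ℝ :=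
  (volume (positivitySet d f))⁻¹ • (volume.restrict (positivitySet d f)).map f

theorem phaseValueLaw_Iic {d : ℕ} {f : (Fin d → ℝ) → ℝ} (hf : Measurable f) (y : ℝ) :
    phaseValueLaw d f (Set.Iic y) = phaseValueCDF d f y := by
  have h : {z | z ∈ positivitySet d f ∧ f z ≤ y} = f ⁻¹' Set.Iic y ∩ positivitySet d f := by
    ext z; simp [and_comm]
  rw [phaseValueLaw, phaseValueCDF, Measure.smul_apply, Measure.map_apply hf measurableSet_Iic,
    Measure.restrict_apply (hf measurableSet_Iic), h, smul_eq_mul, ENNReal.div_eq_inv_mul]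

/-- The measure `(1 - |A|) δ(z) + |A| ∫ g_x(y) / y · f_u(β / y, z / y) dy`, where `Λ b` is the
distribution written `f_u(b, z) dz`: the distribution `(1 / y) f_u(β / y, z / y) dz` is the image
of `Λ (β / y)` under `t ↦ y * t`, and `bind` averages it over the distribution of `y`. -/
def mixtureLSD (d : ℕ) (Λ : Kernel ℝ ℝ) (f : (Fin d → ℝ) → ℝ) (β : ℝ) : Measure ℝ :=
  (1 - volume (positivitySet d f)) • Measure.dirac 0 +
    volume (positivitySet d f) •
      (phaseValueLaw d f).bind fun y => (Λ (β / y)).map fun t => y * t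

/-- The average in `mixtureLSD` is the integral of the rescaled distributions. -/
theorem mixtureLSD_apply {d : ℕ} (Λ : Kernel ℝ ℝ) [IsSFiniteKernel Λ] (f : (Fin d → ℝ) → ℝ)
    (β : ℝ) {s : Set ℝ} (hs : MeasurableSet s) :
    mixtureLSD d Λ f β s = (1 - volume (positivitySet d f)) * s.indicator 1 0 +
      volume (positivitySet d f) *
        ∫⁻ y, Λ (β / y) {t | y * t ∈ s} ∂(phaseValueLaw d f) := by
  have hmeas : Measurable fun y : ℝ => (Λ (β / y)).map fun t => y * t := by
    refine Measure.measurable_of_measurable_coe _ fun u hu => ?_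
    have h1 : ∀ y : ℝ, ((Λ (β / y)).map fun t => y * t) u
        = (Λ.comap (fun y => β / y) (by fun_prop)) y
            (Prod.mk y ⁻¹' ((fun p : ℝ × ℝ => p.1 * p.2) ⁻¹' u)) := by
      intro y
      rw [Measure.map_apply (by fun_prop) hu, Kernel.comap_apply]
      rfl
    simp_rw [h1]
    exact Kernel.measurable_kernel_prodMk_left ((by fun_prop : Measurable _) hu)
  rw [mixtureLSD, Measure.add_apply, Measure.smul_apply, Measure.smul_apply,
    Measure.dirac_apply' _ hs, Measure.bind_apply hs hmeas.aemeasurable, smul_eq_mul, smul_eq_mul]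
  congr 2
  refine lintegral_congr fun y => ?_
  rw [Measure.map_apply (by fun_prop) hs]
  rfl

end

/-! The spectrum is tested against the functions `1 - (1 + t)⁻ᵖ`, via `resolventDefect`. They vanish
at `0`, so `V Vᴴ` may be exchanged for the Gram matrix `Vᴴ V`
(`resolventDefect_self_mul_conjTranspose`), whose entries are `1 / m` times products of Dirichlet
kernels at differences of sampling points. The defect is stable in three ways, each up to a factor
`p`: a positive rank one perturbation, however large, changes it by at most `1`
(`abs_resolventDefect_add_vecMulVec_sub_le`); a change of the Gram matrix costs `√m` times its
Frobenius norm (`abs_resolventDefect_sub_le_frobenius`); a change of the law of the points costs `m`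
times its size in total variation (`abs_meanDefect_sub_le_of_law`).

The squared Dirichlet kernel concentrates on the diagonal (`tendsto_fejerSpread_div`). Cut the cube
into `L ^ d` cells and let `n = k * L`. Gram entries between different cells have negligible
Frobenius mass, so the defect nearly splits into a sum over cells. Inside a cell the kernel at scale
`n` is nearly `L ^ d` times the kernel at scale `k` (`cubeKernel_cellMap_sub`). A density constant
on cells therefore looks, in the cell `c`, like a uniform sample at scale `k` with about `m * q c`
points; the binomial fluctuation of their number is harmless by rank one stability. Relative to `n ^
d` the error tends to zero with `k`, uniformly in `L` (`abs_normalized_phaseDefect_cells_sub_le`).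

For uniform phases this compares the scales `k` and `k'` with `k * k'`, so the normalized defect is
a Cauchy sequence: its limit `limitDefect` exists without any computation of moments. A general
density is replaced by its cell averages at small `L¹` cost, and the sum over cells becomes `∫
limitDefect p d (f x / β) β`. Near `x` the sample is that of a uniform problem with ratio `β / f x`,
but normalized by the global `m`; hence the dilation by `f x`
(`integral_one_sub_resolventWeight_mul_limitLaw`).

Finally, `(1 + t)⁻ᵖ` is a power of `w = 1 / (1 + t)`, so by Weierstrass these moments control all
continuous functions of `w ∈ [0, 1]` and thus the distribution functions. Limit laws exist because
the eigenvalues have mean `1`, which gives tightness. The mixture is the average over the cube of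
the dilated limit laws, the points with `f = 0` giving the atom at zero. -/

noncomputable section

open scoped Matrix.Norms.L2Operator ComplexOrder

set_option linter.unusedSectionVars false

/-! ### Resolvent traces and their stability under perturbation. -/

section ResolventTrace

variable {ι κ : Type*} [Fintype ι] [DecidableEq ι] [Fintype κ] [DecidableEq κ]

/-- The trace of `1 - (1 + A)⁻ᵖ`. -/
def resolventDefect (p : ℕ) (A : Matrix ι ι ℂ) : ℝ :=
  (trace (1 - ((1 + A)⁻¹) ^ p)).re

theorem Matrix.norm_mulVec_sq_le (X : Matrix κ ι ℂ) (v : ι → ℂ) :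
    ∑ i, ‖(X *ᵥ v) i‖ ^ 2 ≤ ‖X‖ ^ 2 * ∑ i, ‖v i‖ ^ 2 := by
  classical
  have h := l2_opNorm_mulVec X (WithLp.toLp 2 v)
  have h2 := pow_le_pow_left₀ (norm_nonneg _) h 2
  rw [mul_pow, EuclideanSpace.norm_sq_eq, EuclideanSpace.norm_sq_eq] at h2
  simpa using h2

theorem Matrix.norm_le_one_of_sq_le (X : Matrix ι ι ℂ)
    (h : ∀ v : ι → ℂ, ∑ i, ‖(X *ᵥ v) i‖ ^ 2 ≤ ∑ i, ‖v i‖ ^ 2) : ‖X‖ ≤ 1 := by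
  rw [l2_opNorm_def]
  refine ContinuousLinearMap.opNorm_le_bound _ zero_le_one fun v => ?_
  rw [one_mul]
  refine le_of_sq_le_sq ?_ (norm_nonneg _)
  rw [EuclideanSpace.norm_sq_eq, EuclideanSpace.norm_sq_eq]
  simpa using h v.ofLp

/-- Only an inequality, since the index type may be empty and the norm then is zero. -/
theorem Matrix.l2_opNorm_one_le : ‖(1 : Matrix ι ι ℂ)‖ ≤ 1 :=
  norm_le_one_of_sq_le _ fun v => by simp

theorem Matrix.PosSemidef.isUnit_one_add' {A : Matrix ι ι ℂ} (hA : A.PosSemidef) :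
    IsUnit (1 + A) :=
  (PosDef.one.add_posSemidef hA).isUnit

theorem Matrix.PosSemidef.isUnit_one_add {A : Matrix ι ι ℂ} (hA : A.PosSemidef) :
    IsUnit (1 + A).det :=
  (isUnit_iff_isUnit_det _).1 hA.isUnit_one_add'

theorem Matrix.norm_star_dotProduct_le (v w : ι → ℂ) :
    ‖star v ⬝ᵥ w‖ ≤ √(∑ i, ‖v i‖ ^ 2) * √(∑ i, ‖w i‖ ^ 2) := by
  refine (norm_sum_le _ _).trans ?_
  simp only [norm_mul, Pi.star_apply, norm_star]
  exact Real.sum_mul_le_sqrt_mul_sqrt _ _ _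

theorem Matrix.star_dotProduct_self_eq (v : ι → ℂ) :
    star v ⬝ᵥ v = ((∑ i, ‖v i‖ ^ 2 : ℝ) : ℂ) := by
  simp only [dotProduct, Pi.star_apply, Complex.ofReal_sum]
  refine Finset.sum_congr rfl fun i _ => ?_
  rw [Complex.star_def, ← Complex.normSq_eq_conj_mul_self, Complex.normSq_eq_norm_sq]

/-- If `y = (1 + A) x`, positivity gives `‖x‖² ≤ Re ⟨x, y⟩ ≤ ‖x‖ ‖y‖`. -/
theorem Matrix.PosSemidef.norm_inv_one_add_le {A : Matrix ι ι ℂ} (hA : A.PosSemidef) :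
    ‖(1 + A)⁻¹‖ ≤ 1 := by
  refine norm_le_one_of_sq_le _ fun y => ?_
  set x := (1 + A)⁻¹ *ᵥ y with hx
  have hy : y = x + A *ᵥ x := by
    nth_rewrite 1 [← one_mulVec x]
    rw [← add_mulVec, hx, mulVec_mulVec,
      mul_nonsing_inv _ hA.isUnit_one_add, one_mulVec]
  have h1 := hA.re_dotProduct_nonneg x
  have h2 : (star x ⬝ᵥ y).re = ∑ i, ‖x i‖ ^ 2 + (star x ⬝ᵥ (A *ᵥ x)).re := by
    rw [hy, dotProduct_add, star_dotProduct_self_eq, Complex.add_re, Complex.ofReal_re]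
  have h3 := (Complex.re_le_norm _).trans (norm_star_dotProduct_le x y)
  have h4 : ∑ i, ‖x i‖ ^ 2 ≤ √(∑ i, ‖x i‖ ^ 2) * √(∑ i, ‖y i‖ ^ 2) := by
    have : 0 ≤ (star x ⬝ᵥ (A *ᵥ x)).re := h1
    linarith
  have ha : 0 ≤ ∑ i, ‖x i‖ ^ 2 := by positivity
  have hb : 0 ≤ ∑ i, ‖y i‖ ^ 2 := by positivity
  by_contra! hlt
  have h5 := Real.sqrt_lt_sqrt hb hlt
  have h6 := Real.mul_self_sqrt ha
  nlinarith [Real.sqrt_nonneg (∑ i, ‖y i‖ ^ 2)]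

/-- Cauchy–Schwarz for the trace pairing: the columns of a contraction have length at most `1`, so
its Frobenius norm is at most the square root of the dimension. -/
theorem Matrix.norm_trace_mul_le_frobenius (D C : Matrix ι ι ℂ) (hC : ‖C‖ ≤ 1) :
    ‖trace (D * C)‖ ≤ √(Fintype.card ι) * √(∑ i, ∑ j, ‖D i j‖ ^ 2) := by
  have hC2 : ∑ j, ∑ i, ‖C j i‖ ^ 2 ≤ Fintype.card ι := by
    rw [Finset.sum_comm]
    refine (Finset.sum_le_card_nsmul _ _ 1 fun i _ => ?_).trans (by simp)
    have h := norm_mulVec_sq_le C (Pi.single i 1)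
    simp only [mulVec_single_one, col_apply] at h
    refine h.trans ?_
    have : ∑ j, ‖(Pi.single i (1 : ℂ) : ι → ℂ) j‖ ^ 2 = 1 := by
      rw [Finset.sum_eq_single i] <;> simp +contextual
    rw [this, mul_one]
    exact pow_le_one₀ (norm_nonneg _) hC
  have h1 : ‖trace (D * C)‖ ≤ ∑ x : ι × ι, ‖D x.1 x.2‖ * ‖C x.2 x.1‖ := by
    rw [Fintype.sum_prod_type]
    simp only [trace, diag_apply, mul_apply]
    refine (norm_sum_le _ _).trans (Finset.sum_le_sum fun i _ => ?_)
    refine (norm_sum_le _ _).trans (Finset.sum_le_sum fun j _ => ?_)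
    rw [norm_mul]
  refine h1.trans ((Real.sum_mul_le_sqrt_mul_sqrt _ _ _).trans ?_)
  rw [mul_comm, Fintype.sum_prod_type, Fintype.sum_prod_type]
  refine mul_le_mul_of_nonneg_right (Real.sqrt_le_sqrt ?_) (Real.sqrt_nonneg _)
  rwa [Finset.sum_comm]

/-- Bounding `trace (D * C)` over all contractions `C` is bounding the trace norm of `D` by duality,
without introducing that norm. The power difference telescopes into `p` terms, each being `A - B`
multiplied by contractions. -/
theorem Matrix.norm_trace_pow_sub_pow_mul_le {A B : Matrix ι ι ℂ} {δ : ℝ} (hA : ‖A‖ ≤ 1)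
    (hB : ‖B‖ ≤ 1) (h : ∀ C : Matrix ι ι ℂ, ‖C‖ ≤ 1 → ‖trace ((A - B) * C)‖ ≤ δ) (p : ℕ) :
    ∀ C : Matrix ι ι ℂ, ‖C‖ ≤ 1 → ‖trace ((A ^ p - B ^ p) * C)‖ ≤ p * δ := by
  have hmul : ∀ {X Y : Matrix ι ι ℂ}, ‖X‖ ≤ 1 → ‖Y‖ ≤ 1 → ‖X * Y‖ ≤ 1 := fun hX hY =>
    (norm_mul_le _ _).trans (mul_le_one₀ hX (norm_nonneg _) hY)
  have hpow : ∀ q : ℕ, ‖A ^ q‖ ≤ 1 := fun q => by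
    induction q with
    | zero => simpa using l2_opNorm_one_le
    | succ q ih => rw [pow_succ]; exact hmul ih hA
  induction p with
  | zero => intro C _; simp
  | succ p ih =>
    intro C hC
    have h1 : trace ((A ^ (p + 1) - B ^ (p + 1)) * C)
        = trace ((A - B) * (C * A ^ p)) + trace ((A ^ p - B ^ p) * (B * C)) := by
      rw [← mul_assoc (A - B), trace_mul_comm ((A - B) * C), ← trace_add, pow_succ, pow_succ]
      congr 1
      noncomm_ring
    rw [h1]
    refine (norm_add_le _ _).trans ?_
    have h2 := h _ (hmul hC (hpow p))
    have h3 := ih _ (hmul hB hC)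
    push_cast
    linarith

theorem Matrix.inv_one_add_sub_inv_one_add {A B : Matrix ι ι ℂ} (hA : IsUnit (1 + A).det)
    (hB : IsUnit (1 + B).det) :
    (1 + A)⁻¹ - (1 + B)⁻¹ = (1 + A)⁻¹ * (B - A) * (1 + B)⁻¹ := by
  have : B - A = (1 + B) - (1 + A) := by abel
  rw [this, mul_sub, sub_mul, nonsing_inv_mul _ hA, mul_assoc, mul_nonsing_inv _ hB, mul_one,
    one_mul]

/-- The resolvent identity and the telescoping of powers reduce every stability estimate to a trace
norm bound on one sandwiched difference. -/
theorem abs_resolventDefect_sub_le {A B : Matrix ι ι ℂ} (hA : A.PosSemidef)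
    (hB : B.PosSemidef) {δ : ℝ}
    (h : ∀ C : Matrix ι ι ℂ, ‖C‖ ≤ 1 →
      ‖trace ((1 + A)⁻¹ * (B - A) * (1 + B)⁻¹ * C)‖ ≤ δ) (p : ℕ) :
    |resolventDefect p A - resolventDefect p B| ≤ p * δ := by
  rw [← inv_one_add_sub_inv_one_add hA.isUnit_one_add hB.isUnit_one_add] at h
  have h1 := norm_trace_pow_sub_pow_mul_le hA.norm_inv_one_add_le hB.norm_inv_one_add_le h p 1
    l2_opNorm_one_le
  have h2 : resolventDefect p A - resolventDefect p B
      = -(trace (((1 + A)⁻¹ ^ p - (1 + B)⁻¹ ^ p) * 1)).re := by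
    simp only [resolventDefect, mul_one, trace_sub, Complex.sub_re]
    ring
  rw [h2, abs_neg]
  exact (Complex.abs_re_le_norm _).trans h1

theorem abs_resolventDefect_sub_le_frobenius {A B : Matrix ι ι ℂ} (hA : A.PosSemidef)
    (hB : B.PosSemidef) (p : ℕ) :
    |resolventDefect p A - resolventDefect p B|
      ≤ p * (√(Fintype.card ι) * √(∑ i, ∑ j, ‖A i j - B i j‖ ^ 2)) := by
  refine abs_resolventDefect_sub_le hA hB (fun C hC => ?_) p
  have h1 : trace ((1 + A)⁻¹ * (B - A) * (1 + B)⁻¹ * C)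
      = trace ((B - A) * ((1 + B)⁻¹ * C * (1 + A)⁻¹)) := by
    rw [mul_assoc, mul_assoc, trace_mul_comm]
    simp only [mul_assoc]
  rw [h1]
  have h2 : ‖(1 + B)⁻¹ * C * (1 + A)⁻¹‖ ≤ 1 :=
    (norm_mul_le _ _).trans (mul_le_one₀ ((norm_mul_le _ _).trans
      (mul_le_one₀ hB.norm_inv_one_add_le (norm_nonneg _) hC)) (norm_nonneg _)
      hA.norm_inv_one_add_le)
  refine (norm_trace_mul_le_frobenius _ _ h2).trans (le_of_eq ?_)
  simp only [Matrix.sub_apply, norm_sub_rev]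

/-- The trace against `V * Vᴴ` is a sum over the columns `v` of `V` of forms `vᴴ K v`, where `K` is
a product of two resolvents and a contraction; each is at most `‖v‖²`. -/
theorem abs_resolventDefect_smul_sub_le (V : Matrix ι κ ℂ) {s t : ℝ} (hs : 0 ≤ s) (ht : 0 ≤ t)
    (p : ℕ) :
    |resolventDefect p ((s : ℂ) • (V * Vᴴ)) - resolventDefect p ((t : ℂ) • (V * Vᴴ))|
      ≤ p * (|s - t| * ∑ i, ∑ j, ‖V i j‖ ^ 2) := by
  have hA : ((s : ℂ) • (V * Vᴴ)).PosSemidef :=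
    (posSemidef_self_mul_conjTranspose V).smul (by exact_mod_cast hs)
  have hB : ((t : ℂ) • (V * Vᴴ)).PosSemidef :=
    (posSemidef_self_mul_conjTranspose V).smul (by exact_mod_cast ht)
  refine abs_resolventDefect_sub_le hA hB (fun C hC => ?_) p
  set R := (1 + (s : ℂ) • (V * Vᴴ))⁻¹ with hR
  set S := (1 + (t : ℂ) • (V * Vᴴ))⁻¹ with hS
  have h1 : trace (R * ((t : ℂ) • (V * Vᴴ) - (s : ℂ) • (V * Vᴴ)) * S * C)
      = ((t - s : ℝ) : ℂ) * ∑ q, star (V.col q) ⬝ᵥ ((S * C * R) *ᵥ (V.col q)) := by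
    rw [← sub_smul, mul_smul_comm, smul_mul_assoc, smul_mul_assoc, trace_smul, smul_eq_mul,
      Complex.ofReal_sub]
    congr 1
    have : trace (R * (V * Vᴴ) * S * C) = trace (Vᴴ * ((S * C * R) * V)) := by
      rw [← Matrix.mul_assoc R, Matrix.mul_assoc (R * V), Matrix.mul_assoc (R * V),
        trace_mul_comm (R * V)]
      simp only [Matrix.mul_assoc]
    rw [this]
    simp only [trace, diag_apply]
    refine Finset.sum_congr rfl fun q _ => ?_
    rw [mul_apply, dotProduct]
    refine Finset.sum_congr rfl fun i _ => ?_
    rw [conjTranspose_apply, Pi.star_apply, col_apply, mulVec, mul_apply, dotProduct]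
    rfl
  have hn : ‖S * C * R‖ ≤ 1 :=
    (norm_mul_le _ _).trans (mul_le_one₀ ((norm_mul_le _ _).trans
      (mul_le_one₀ hB.norm_inv_one_add_le (norm_nonneg _) hC)) (norm_nonneg _)
      hA.norm_inv_one_add_le)
  rw [h1, norm_mul, Complex.norm_real, Real.norm_eq_abs, abs_sub_comm, Finset.sum_comm]
  refine mul_le_mul_of_nonneg_left ((norm_sum_le _ _).trans (Finset.sum_le_sum fun q _ => ?_))
    (abs_nonneg _)
  refine (norm_star_dotProduct_le _ _).trans ?_
  have h2 := norm_mulVec_sq_le (S * C * R) (V.col q)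
  have h3 : ∑ i, ‖((S * C * R) *ᵥ (V.col q)) i‖ ^ 2 ≤ ∑ i, ‖V.col q i‖ ^ 2 :=
    h2.trans (mul_le_of_le_one_left (by positivity) (pow_le_one₀ (norm_nonneg _) hn))
  calc _ ≤ √(∑ i, ‖V.col q i‖ ^ 2) * √(∑ i, ‖V.col q i‖ ^ 2) :=
        mul_le_mul_of_nonneg_left (Real.sqrt_le_sqrt h3) (Real.sqrt_nonneg _)
    _ = _ := by rw [Real.mul_self_sqrt (by positivity)]; rfl

/-- The two resolvents `R` and `S` differ by the rank one matrix `(R v) (S v)ᴴ`, of trace norm `‖R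
v‖ ‖S v‖`. This product never exceeds `1`, so the bound depends neither on the size of `v` nor on
the dimension. -/
theorem abs_resolventDefect_add_vecMulVec_sub_le {A : Matrix ι ι ℂ} (hA : A.PosSemidef)
    (v : ι → ℂ) (p : ℕ) :
    |resolventDefect p (A + vecMulVec v (star v)) - resolventDefect p A| ≤ p := by
  have hv : (vecMulVec v (star v)).PosSemidef := posSemidef_vecMulVec_self_star v
  have hB := hA.add hv
  rw [abs_sub_comm]
  refine (abs_resolventDefect_sub_le hA hB (δ := 1) (fun C hC => ?_) p).trans (by simp)
  set B := A + vecMulVec v (star v) with hBdef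
  set R := (1 + A)⁻¹ with hR
  set S := (1 + B)⁻¹ with hS
  have hBA : B - A = vecMulVec v (star v) := by rw [hBdef]; abel
  rw [hBA]
  have hRh : Rᴴ = R := by
    rw [hR, conjTranspose_nonsing_inv, conjTranspose_add, conjTranspose_one, hA.isHermitian.eq]
  have hSh : Sᴴ = S := by
    rw [hS, conjTranspose_nonsing_inv, conjTranspose_add, conjTranspose_one, hB.isHermitian.eq]
  have h1 : trace (R * vecMulVec v (star v) * S * C)
      = star (S *ᵥ v) ⬝ᵥ (C *ᵥ (R *ᵥ v)) := by
    rw [mul_vecMulVec, vecMulVec_mul, vecMulVec_mul, trace_vecMulVec, dotProduct_comm,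
      star_mulVec, hSh, dotProduct_mulVec, dotProduct_mulVec, dotProduct_mulVec]
  -- `R v = (1 + vᴴ R v) S v`
  have h2 : R *ᵥ v = (1 + star v ⬝ᵥ (R *ᵥ v)) • (S *ᵥ v) := by
    have h := inv_one_add_sub_inv_one_add hB.isUnit_one_add hA.isUnit_one_add
    rw [← neg_sub B A, hBA] at h
    have h' : R = S + S * vecMulVec v (star v) * R := by
      rw [← sub_eq_iff_eq_add', ← neg_sub, hR, hS, h]
      simp
    conv_lhs => rw [h']
    rw [add_mulVec, add_smul, one_smul, ← mulVec_mulVec, ← mulVec_mulVec, vecMulVec_mulVec,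
      mulVec_smul]
    simp
  set x := R *ᵥ v with hx
  have hvx : v = x + A *ᵥ x := by
    nth_rewrite 1 [← one_mulVec x]
    rw [← add_mulVec, hx, mulVec_mulVec, hR,
      mul_nonsing_inv _ hA.isUnit_one_add, one_mulVec]
  have h3 : ∑ i, ‖x i‖ ^ 2 ≤ (star v ⬝ᵥ x).re := by
    have h4 := hA.re_dotProduct_nonneg x
    have : star v ⬝ᵥ x = star x ⬝ᵥ x + star x ⬝ᵥ (A *ᵥ x) := by
      conv_lhs => rw [hvx]
      rw [star_add, add_dotProduct, star_mulVec A, hA.isHermitian.eq, dotProduct_mulVec _ A]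
    rw [this, star_dotProduct_self_eq, Complex.add_re, Complex.ofReal_re]
    have : 0 ≤ (star x ⬝ᵥ (A *ᵥ x)).re := h4
    linarith
  set a : ℝ := ∑ i, ‖x i‖ ^ 2 with ha
  set b : ℝ := ∑ i, ‖(S *ᵥ v) i‖ ^ 2 with hb
  have ha0 : 0 ≤ a := by positivity
  have hb0 : 0 ≤ b := by positivity
  have h4 : a = ‖1 + star v ⬝ᵥ x‖ ^ 2 * b := by
    rw [ha, h2, hb, Finset.mul_sum]
    refine Finset.sum_congr rfl fun i _ => ?_
    rw [Pi.smul_apply, norm_smul, mul_pow, ← h2]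
  have h5 : 1 + a ≤ ‖1 + star v ⬝ᵥ x‖ := by
    refine le_trans ?_ (Complex.re_le_norm _)
    simp only [Complex.add_re, Complex.one_re]
    linarith
  have h6 : a * b ≤ 1 := by
    have : (1 + a) ^ 2 * b ≤ a := by
      rw [h4]
      exact mul_le_mul_of_nonneg_right (pow_le_pow_left₀ (by positivity) (h4 ▸ h5) 2) hb0
    nlinarith [mul_nonneg ha0 hb0]
  have h7 : ∑ i, ‖(C *ᵥ x) i‖ ^ 2 ≤ a :=
    (norm_mulVec_sq_le C x).trans
      (mul_le_of_le_one_left (by positivity) (pow_le_one₀ (norm_nonneg _) hC))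
  rw [h1]
  refine (norm_star_dotProduct_le _ _).trans ?_
  calc _ ≤ √b * √a := mul_le_mul_of_nonneg_left (Real.sqrt_le_sqrt h7) (Real.sqrt_nonneg _)
    _ = √(a * b) := by rw [Real.sqrt_mul ha0, mul_comm]
    _ ≤ 1 := Real.sqrt_le_one.2 h6

/-- `V * W` and `W * V` have the same nonzero spectrum, and the test function vanishes at zero; this
is why the trace of `1 - (1 + A)⁻ᵖ` is used rather than that of the resolvent power. The proof
intertwines the resolvents, `R V = V S`, and inducts on `p` using cyclicity of the trace. -/
theorem resolventDefect_mul_comm (V : Matrix ι κ ℂ) (W : Matrix κ ι ℂ)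
    (h1 : IsUnit (1 + V * W).det) (h2 : IsUnit (1 + W * V).det) (p : ℕ) :
    resolventDefect p (V * W) = resolventDefect p (W * V) := by
  set R := (1 + V * W)⁻¹ with hR
  set S := (1 + W * V)⁻¹ with hS
  have hRV : R * V = V * S := by
    have h : V * (1 + W * V) = (1 + V * W) * V := by
      rw [Matrix.mul_add, Matrix.add_mul, Matrix.mul_one, Matrix.one_mul, Matrix.mul_assoc]
    calc R * V = R * (V * (1 + W * V)) * S := by
          rw [Matrix.mul_assoc, Matrix.mul_assoc V, mul_nonsing_inv _ h2, Matrix.mul_one]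
      _ = V * S := by rw [h, ← Matrix.mul_assoc, nonsing_inv_mul _ h1, Matrix.one_mul]
  have hpow : ∀ q : ℕ, R ^ q * V = V * S ^ q := fun q => by
    induction q with
    | zero => simp
    | succ q ih => rw [pow_succ, Matrix.mul_assoc, hRV, ← Matrix.mul_assoc, ih, Matrix.mul_assoc, ← pow_succ]
  have hR1 : R * (V * W) = 1 - R := by
    rw [eq_sub_iff_add_eq', ← mul_one_add, nonsing_inv_mul _ h1]
  have hS1 : S * (W * V) = 1 - S := by
    rw [eq_sub_iff_add_eq', ← mul_one_add, nonsing_inv_mul _ h2]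
  have key : trace (1 - R ^ p) = trace (1 - S ^ p) := by
    induction p with
    | zero => simp
    | succ p ih =>
      have e1 : (1 : Matrix ι ι ℂ) - R ^ (p + 1) = (1 - R ^ p) + R ^ p * (1 - R) := by
        rw [pow_succ]; noncomm_ring
      have e2 : (1 : Matrix κ κ ℂ) - S ^ (p + 1) = (1 - S ^ p) + S ^ p * (1 - S) := by
        rw [pow_succ]; noncomm_ring
      rw [e1, e2, trace_add, trace_add, ih, ← hR1, ← hS1]
      congr 1
      rw [← mul_assoc, ← pow_succ, ← mul_assoc, ← pow_succ, ← Matrix.mul_assoc, hpow,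
        Matrix.mul_assoc, trace_mul_comm, Matrix.mul_assoc]
  rw [resolventDefect, resolventDefect, key]

theorem resolventDefect_self_mul_conjTranspose (V : Matrix ι κ ℂ) (p : ℕ) :
    resolventDefect p (V * Vᴴ) = resolventDefect p (Vᴴ * V) :=
  resolventDefect_mul_comm _ _ (posSemidef_self_mul_conjTranspose V).isUnit_one_add
    (posSemidef_conjTranspose_mul_self V).isUnit_one_add p

theorem resolventDefect_smul_self_mul_conjTranspose (V : Matrix ι κ ℂ) {s : ℝ} (hs : 0 ≤ s)
    (p : ℕ) :
    resolventDefect p ((s : ℂ) • (V * Vᴴ)) = resolventDefect p ((s : ℂ) • (Vᴴ * V)) := by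
  have h := resolventDefect_mul_comm ((s : ℂ) • V) Vᴴ
  rw [Matrix.smul_mul, Matrix.mul_smul] at h
  exact h ((posSemidef_self_mul_conjTranspose V).smul (by exact_mod_cast hs)).isUnit_one_add
    ((posSemidef_conjTranspose_mul_self V).smul (by exact_mod_cast hs)).isUnit_one_add p

theorem resolventDefect_zero (p : ℕ) : resolventDefect p (0 : Matrix ι ι ℂ) = 0 := by
  simp [resolventDefect]

theorem resolventDefect_blockDiagonal (M : κ → Matrix ι ι ℂ) (hM : ∀ k, (M k).PosSemidef)
    (p : ℕ) :
    resolventDefect p (blockDiagonal M) = ∑ k, resolventDefect p (M k) := by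
  have h1 : (1 + blockDiagonal M)⁻¹ = blockDiagonal fun k => (1 + M k)⁻¹ := by
    refine inv_eq_right_inv ?_
    rw [← blockDiagonal_one, ← blockDiagonal_add, ← blockDiagonal_mul]
    congr 1
    funext k
    exact mul_nonsing_inv _ (hM k).isUnit_one_add
  rw [resolventDefect, h1, ← blockDiagonal_pow, ← blockDiagonal_one, ← blockDiagonal_sub,
    trace_blockDiagonal, Complex.re_sum]
  rfl

/-- The factor `y` is kept outside the eigenvalues so that dilated laws are expressed through the
spectrum of the same matrix. -/
theorem resolventDefect_smul_eq_sum_eigenvalues {A : Matrix ι ι ℂ} (hA : A.PosSemidef) (p : ℕ)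
    {y : ℝ} (hy : 0 ≤ y) :
    resolventDefect p ((y : ℂ) • A)
      = ∑ i, (1 - ((1 + y * hA.isHermitian.eigenvalues i)⁻¹) ^ p) := by
  set U : Matrix ι ι ℂ := (hA.isHermitian.eigenvectorUnitary).1 with hU
  have hU1 : U * star U = 1 := Unitary.coe_mul_star_self hA.isHermitian.eigenvectorUnitary
  have hU2 : star U * U = 1 := Unitary.coe_star_mul_self hA.isHermitian.eigenvectorUnitary
  set e : ι → ℂ := fun i => (y : ℂ) * (hA.isHermitian.eigenvalues i : ℂ) with he
  have hspec : (y : ℂ) • A = U * diagonal e * star U := by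
    have h := hA.isHermitian.spectral_theorem
    rw [Unitary.conjStarAlgAut_apply] at h
    have hd : diagonal e = (y : ℂ) • diagonal fun i => (hA.isHermitian.eigenvalues i : ℂ) := by
      rw [← diagonal_smul]
      rfl
    rw [hd, Matrix.mul_smul, Matrix.smul_mul]
    exact congrArg _ h
  have hne : ∀ i, (1 + e i) ≠ 0 := fun i => by
    have := hA.eigenvalues_nonneg i
    rw [he]
    norm_cast
    positivity
  have hinv : (1 + (y : ℂ) • A)⁻¹ = U * diagonal (fun i => (1 + e i)⁻¹) * star U := by
    refine inv_eq_right_inv ?_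
    have h1 : 1 + (y : ℂ) • A = U * diagonal (fun i => 1 + e i) * star U := by
      have : (diagonal fun i => 1 + e i) = 1 + diagonal e := by
        rw [← diagonal_one, diagonal_add]
      rw [this, mul_add, add_mul, mul_one, hU1, ← hspec]
    rw [h1]
    calc U * diagonal (fun i => 1 + e i) * star U * (U * diagonal (fun i => (1 + e i)⁻¹) * star U)
        = U * (diagonal (fun i => 1 + e i) * (star U * U) * diagonal (fun i => (1 + e i)⁻¹))
            * star U := by simp only [mul_assoc]
      _ = 1 := by
        rw [hU2, mul_one, diagonal_mul_diagonal]
        simp only [mul_inv_cancel₀ (hne _), diagonal_one, mul_one, hU1]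
  have hpow : ((1 + (y : ℂ) • A)⁻¹) ^ p = U * diagonal (fun i => (1 + e i)⁻¹ ^ p) * star U := by
    rw [hinv]
    induction p with
    | zero => simp [hU1]
    | succ p ih =>
      rw [pow_succ, ih]
      calc U * diagonal (fun i => (1 + e i)⁻¹ ^ p) * star U
            * (U * diagonal (fun i => (1 + e i)⁻¹) * star U)
          = U * (diagonal (fun i => (1 + e i)⁻¹ ^ p) * (star U * U)
            * diagonal (fun i => (1 + e i)⁻¹)) * star U := by simp only [mul_assoc]
        _ = _ := by
          rw [hU2, mul_one, diagonal_mul_diagonal]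
          simp only [pow_succ]
  rw [resolventDefect, hpow, trace_sub, trace_mul_comm, ← mul_assoc, hU2, one_mul, trace_one,
    trace_diagonal, Finset.sum_sub_distrib]
  simp only [he, Complex.sub_re, Complex.natCast_re, Complex.re_sum, Finset.sum_const,
    Finset.card_univ, nsmul_eq_mul, mul_one]
  congr 1
  refine Finset.sum_congr rfl fun i _ => ?_
  norm_cast

theorem resolventDefect_eq_sum_eigenvalues {A : Matrix ι ι ℂ} (hA : A.PosSemidef) (p : ℕ) :
    resolventDefect p A
      = ∑ i, (1 - ((1 + hA.isHermitian.eigenvalues i)⁻¹) ^ p) := by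
  have h := resolventDefect_smul_eq_sum_eigenvalues hA p zero_le_one
  simpa only [Complex.ofReal_one, one_smul, one_mul] using h

theorem abs_resolventDefect_le {A : Matrix ι ι ℂ} (hA : A.PosSemidef) (p : ℕ) :
    |resolventDefect p A| ≤ Fintype.card ι := by
  rw [resolventDefect_eq_sum_eigenvalues hA]
  refine (Finset.abs_sum_le_sum_abs _ _).trans ?_
  refine (Finset.sum_le_card_nsmul _ _ 1 fun i _ => ?_).trans (by simp)
  have h := hA.eigenvalues_nonneg i
  have h1 : (1 + hA.isHermitian.eigenvalues i)⁻¹ ≤ 1 := inv_le_one_of_one_le₀ (by linarith)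
  have h2 : 0 ≤ (1 + hA.isHermitian.eigenvalues i)⁻¹ := by positivity
  have h3 := pow_le_one₀ (n := p) h2 h1
  have h4 := pow_nonneg h2 p
  rw [abs_le]; constructor <;> linarith

theorem continuous_resolventDefect_comp {X : Type*} [TopologicalSpace X]
    {A : X → Matrix ι ι ℂ} (hA : Continuous A) (hpos : ∀ x, (A x).PosSemidef) (p : ℕ) :
    Continuous fun x => resolventDefect p (A x) := by
  have h1 : Continuous fun x => (1 + A x)⁻¹ := by
    refine continuous_iff_continuousAt.2 fun x => ?_
    have h := NormedRing.inverse_continuousAt (hpos x).isUnit_one_add'.unit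
    rw [IsUnit.unit_spec] at h
    have h2 : ContinuousAt (fun x => 1 + A x) x := by fun_prop
    have h3 := ContinuousAt.comp (f := fun x => 1 + A x) (x := x) h h2
    refine h3.congr (Eventually.of_forall fun y => ?_)
    simp [nonsing_inv_eq_ringInverse]
  exact Complex.continuous_re.comp ((continuous_const.sub (h1.pow p)).matrix_trace)

end ResolventTrace

end

noncomputable section

/-! ### The one-dimensional Dirichlet kernel and its concentration. -/

section DirichletKernel

/-- The character `t ↦ exp (2 π i t)` of the line. -/
def unitExp (t : ℝ) : ℂ := Complex.exp (((2 * Real.pi * t : ℝ) : ℂ) * Complex.I)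

theorem unitExp_add (s t : ℝ) : unitExp (s + t) = unitExp s * unitExp t := by
  rw [unitExp, unitExp, unitExp, ← Complex.exp_add]
  congr 1
  push_cast
  ring

theorem unitExp_zero : unitExp 0 = 1 := by simp [unitExp]

theorem norm_unitExp (t : ℝ) : ‖unitExp t‖ = 1 := Complex.norm_exp_ofReal_mul_I _

theorem star_unitExp (t : ℝ) : star (unitExp t) = unitExp (-t) := by
  rw [unitExp, unitExp, Complex.star_def, ← Complex.exp_conj, map_mul, Complex.conj_ofReal,
    Complex.conj_I]
  congr 1
  push_cast
  ring

theorem continuous_unitExp : Continuous unitExp := by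
  unfold unitExp
  fun_prop

theorem norm_unitExp_sub_one_le (t : ℝ) : ‖unitExp t - 1‖ ≤ 2 * Real.pi * |t| := by
  have h := Real.norm_exp_I_mul_ofReal_sub_one_le (x := 2 * Real.pi * t)
  rw [mul_comm, ← unitExp, Real.norm_eq_abs, abs_mul, abs_of_pos Real.two_pi_pos] at h
  exact h

theorem unitExp_natCast_mul (n : ℕ) (t : ℝ) : unitExp (n * t) = unitExp t ^ n := by
  rw [unitExp, unitExp, ← Complex.exp_nat_mul]
  congr 1
  push_cast
  ring

theorem norm_unitExp_sub_one (t : ℝ) : ‖unitExp t - 1‖ = 2 * |Real.sin (Real.pi * t)| := by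
  have h := Complex.norm_exp_I_mul_ofReal_sub_one (x := 2 * Real.pi * t)
  rw [mul_comm, ← unitExp] at h
  rw [h, norm_mul, Real.norm_eq_abs, Real.norm_eq_abs, abs_of_pos (zero_lt_two' ℝ)]
  congr 3
  ring

/-- Jordan's inequality on each half of `[0, 1]`. The factor `1 - t` accounts for the second zero:
differences of two points of the interval fill `(-1, 1)`, and the kernel, being periodic, peaks
again at `±1`. -/
theorem two_mul_mul_one_sub_le_sin {t : ℝ} (h0 : 0 ≤ t) (h1 : t ≤ 1) :
    2 * (t * (1 - t)) ≤ Real.sin (Real.pi * t) := by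
  have hpi := Real.pi_pos
  rcases le_total t (1 / 2) with h | h
  · have h2 := Real.mul_le_sin (x := Real.pi * t) (by positivity) (by nlinarith)
    have h3 : 2 / Real.pi * (Real.pi * t) = 2 * t := by field_simp
    nlinarith
  · have h2 := Real.mul_le_sin (x := Real.pi * (1 - t)) (by nlinarith) (by nlinarith)
    have h3 : 2 / Real.pi * (Real.pi * (1 - t)) = 2 * (1 - t) := by field_simp
    have h4 : Real.sin (Real.pi * (1 - t)) = Real.sin (Real.pi * t) := by
      rw [mul_sub, mul_one, Real.sin_pi_sub]
    nlinarith

/-- The one-sided Dirichlet kernel `∑_{a < n} exp (2 π i a t)`. -/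
def dirichletSum (n : ℕ) (t : ℝ) : ℂ := ∑ a : Fin n, unitExp ((a : ℕ) * t)

theorem continuous_dirichletSum (n : ℕ) : Continuous (dirichletSum n) := by
  unfold dirichletSum
  exact continuous_finsetSum _ fun a _ => continuous_unitExp.comp (by fun_prop)

theorem norm_dirichletSum_le (n : ℕ) (t : ℝ) : ‖dirichletSum n t‖ ≤ n := by
  refine (norm_sum_le _ _).trans ?_
  simp [norm_unitExp]

theorem norm_dirichletSum_mul_le (n : ℕ) {t : ℝ} (ht : |t| ≤ 1) :
    ‖dirichletSum n t‖ * (|t| * (1 - |t|)) ≤ 1 / 2 := by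
  have h1 : dirichletSum n t * (unitExp t - 1) = unitExp t ^ n - 1 := by
    simp only [dirichletSum, unitExp_natCast_mul]
    rw [Fin.sum_univ_eq_sum_range (fun a => unitExp t ^ a), geom_sum_mul]
  have h2 : ‖unitExp t ^ n - 1‖ ≤ 2 := by
    refine (norm_sub_le _ _).trans ?_
    rw [norm_pow, norm_unitExp]
    norm_num
  rw [← h1, norm_mul, norm_unitExp_sub_one] at h2
  have h3 : 2 * (|t| * (1 - |t|)) ≤ |Real.sin (Real.pi * t)| := by
    have h := two_mul_mul_one_sub_le_sin (abs_nonneg t) ht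
    refine h.trans (le_trans (le_abs_self _) (le_of_eq ?_))
    rcases abs_choice t with h | h <;> rw [h]
    rw [mul_neg, Real.sin_neg, abs_neg]
  nlinarith [norm_nonneg (dirichletSum n t)]

/-- The uniform law on `[-1/2, 1/2)`. -/
def intervalLaw : Measure ℝ := volume.restrict (Set.Ico (-1 / 2) (1 / 2))

instance : IsProbabilityMeasure intervalLaw := ⟨by
  rw [intervalLaw, Measure.restrict_apply_univ, Real.volume_Ico]; norm_num⟩

theorem integral_unitExp (c : ℤ) (s : ℝ) :
    ∫ u, unitExp (c * (u - s)) ∂intervalLaw = if c = 0 then 1 else 0 := by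
  split_ifs with h
  · simp [h, unitExp_zero]
  · rw [intervalLaw, integral_Ico_eq_integral_Ioo, ← integral_Ioc_eq_integral_Ioo,
      ← intervalIntegral.integral_of_le (by norm_num)]
    have hc : (2 * Real.pi * c * Complex.I : ℂ) ≠ 0 := by
      simp [Real.pi_ne_zero, h]
    have h1 : ∀ u : ℝ, unitExp (c * (u - s))
        = unitExp (-(c * s)) * Complex.exp ((2 * Real.pi * c * Complex.I) * u) := by
      intro u
      rw [unitExp, unitExp, ← Complex.exp_add]
      congr 1
      push_cast
      ring
    simp only [h1]
    rw [intervalIntegral.integral_const_mul, integral_exp_mul_complex hc]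
    have h2 : Complex.exp (2 * Real.pi * c * Complex.I * ((1 / 2 : ℝ) : ℂ))
        = Complex.exp (2 * Real.pi * c * Complex.I * ((-1 / 2 : ℝ) : ℂ)) := by
      rw [Complex.exp_eq_exp_iff_exists_int]
      exact ⟨c, by push_cast; ring⟩
    rw [h2]
    simp

theorem norm_dirichletSum_sq (n : ℕ) (t : ℝ) :
    ‖dirichletSum n t‖ ^ 2
      = (∑ a : Fin n, ∑ b : Fin n, unitExp ((((a : ℕ) : ℤ) - ((b : ℕ) : ℤ) : ℤ) * t)).re := by
  have h : (‖dirichletSum n t‖ ^ 2 : ℂ)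
      = ∑ a : Fin n, ∑ b : Fin n, unitExp ((((a : ℕ) : ℤ) - ((b : ℕ) : ℤ) : ℤ) * t) := by
    rw [← Complex.mul_conj', dirichletSum, map_sum, Finset.sum_mul_sum]
    refine Finset.sum_congr rfl fun a _ => Finset.sum_congr rfl fun b _ => ?_
    rw [← Complex.star_def, star_unitExp, ← unitExp_add]
    congr 1
    push_cast
    ring
  rw [← h]
  norm_cast

theorem integrable_of_continuous_bounded {X : Type*} [TopologicalSpace X] [MeasurableSpace X]
    [OpensMeasurableSpace X] {E : Type*} [NormedAddCommGroup E]
    [SecondCountableTopologyEither X E] {μ : Measure X} [IsFiniteMeasure μ] {f : X → E}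
    (hf : Continuous f) (C : ℝ) (hC : ∀ x, ‖f x‖ ≤ C) : Integrable f μ :=
  Integrable.of_bound hf.aestronglyMeasurable C (Eventually.of_forall hC)

/-- Parseval: the `n` characters in the sum are orthonormal over a period, and a shift does not
matter. -/
theorem integral_norm_dirichletSum_sq (n : ℕ) (s : ℝ) :
    ∫ u, ‖dirichletSum n (u - s)‖ ^ 2 ∂intervalLaw = n := by
  have hInt : ∀ c : ℤ, Integrable (fun u => unitExp (c * (u - s))) intervalLaw := fun c =>
    integrable_of_continuous_bounded (continuous_unitExp.comp (by fun_prop)) 1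
      fun u => (norm_unitExp _).le
  simp only [norm_dirichletSum_sq]
  have h1 : ∫ u, (∑ a : Fin n, ∑ b : Fin n,
      unitExp ((((a : ℕ) : ℤ) - ((b : ℕ) : ℤ) : ℤ) * (u - s))) ∂intervalLaw = n := by
    rw [integral_finsetSum _ fun a _ => integrable_finsetSum _ fun b _ => hInt _]
    have : ∀ a : Fin n, ∫ u, ∑ b : Fin n,
        unitExp ((((a : ℕ) : ℤ) - ((b : ℕ) : ℤ) : ℤ) * (u - s)) ∂intervalLaw = 1 := by
      intro a
      rw [integral_finsetSum _ fun b _ => hInt _]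
      simp only [integral_unitExp]
      rw [Finset.sum_eq_single a]
      · simp
      · intro b _ hb
        rw [if_neg]
        rw [sub_eq_zero]
        intro h
        exact hb (Fin.ext (by exact_mod_cast h.symm))
      · simp
    rw [Finset.sum_congr rfl fun a _ => this a]
    simp
  have h2 := integral_re (𝕜 := ℂ) (μ := intervalLaw) (integrable_finsetSum Finset.univ
    fun a _ => integrable_finsetSum Finset.univ fun b _ =>
      hInt (((a : Fin n) : ℕ) - ((b : Fin n) : ℕ) : ℤ))
  rw [h1] at h2
  simpa using h2

/-- The mean over `u`, `s` of `|u - s|` weighted by the Fejér kernel at `u - s`. -/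
def fejerSpread (k : ℕ) : ℝ :=
  ∫ s, ∫ u, ‖dirichletSum k (u - s)‖ ^ 2 * |u - s| ∂intervalLaw ∂intervalLaw

theorem ae_intervalLaw_abs_lt : ∀ᵐ s ∂intervalLaw, |s| < 1 / 2 := by
  have h1 : ∀ᵐ s ∂intervalLaw, s ∈ Set.Ico (-1 / 2 : ℝ) (1 / 2) :=
    ae_restrict_mem measurableSet_Ico
  have h2 : ∀ᵐ s ∂intervalLaw, s ≠ (-1 / 2 : ℝ) :=
    ae_restrict_of_ae (Measure.ae_ne volume _)
  filter_upwards [h1, h2] with s hs hne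
  rw [abs_lt]
  exact ⟨by linarith [lt_of_le_of_ne hs.1 (Ne.symm hne)], hs.2⟩

theorem fejerSpread_nonneg (k : ℕ) : 0 ≤ fejerSpread k :=
  integral_nonneg fun s => integral_nonneg fun u => by positivity

/-- Concentration of the squared kernel on the diagonal. For `s` inside the interval, `1 - |u - s| ≥
1 / 2 - |s|`, so one factor of the kernel absorbs `|u - s|`; the other has integral at most `√k` by
Parseval and Jensen. The inner integral is thus `O(√k)` for each such `s`. The constant blows up at
the endpoints, because of the periodic peak, so dominated convergence replaces a uniform estimate.
-/
theorem tendsto_fejerSpread_div : Tendsto (fun k : ℕ => fejerSpread k / k) atTop (𝓝 0) := by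
  set J : ℕ → ℝ → ℝ := fun k s =>
    (∫ u, ‖dirichletSum k (u - s)‖ ^ 2 * |u - s| ∂intervalLaw) / k with hJ
  have hcont : ∀ k : ℕ, Continuous fun z : ℝ × ℝ =>
      ‖dirichletSum k (z.2 - z.1)‖ ^ 2 * |z.2 - z.1| := fun k =>
    (((continuous_dirichletSum k).comp (by fun_prop)).norm.pow 2).mul (by fun_prop)
  have hInt : ∀ (k : ℕ) (s : ℝ), Integrable (fun u => ‖dirichletSum k (u - s)‖ ^ 2) intervalLaw :=
    fun k s => integrable_of_continuous_bounded
      (((continuous_dirichletSum k).comp (by fun_prop)).norm.pow 2) (k ^ 2) fun u => by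
        rw [Real.norm_eq_abs, abs_of_nonneg (by positivity)]
        exact pow_le_pow_left₀ (norm_nonneg _) (norm_dirichletSum_le _ _) 2
  have hint1 : ∀ (k : ℕ) (s : ℝ), Integrable (fun u => ‖dirichletSum k (u - s)‖) intervalLaw :=
    fun k s => integrable_of_continuous_bounded
      ((continuous_dirichletSum k).comp (by fun_prop)).norm k fun u => by
        rw [norm_norm]
        exact norm_dirichletSum_le _ _
  have habs : ∀ᵐ u ∂intervalLaw, |u| < 1 / 2 := ae_intervalLaw_abs_lt
  have hcs : ∀ (k : ℕ) (s : ℝ), ∫ u, ‖dirichletSum k (u - s)‖ ∂intervalLaw ≤ √k := by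
    intro k s
    have h := ConvexOn.map_integral_le (μ := intervalLaw) (s := Set.univ) (g := fun x : ℝ => x ^ 2)
      (f := fun u => ‖dirichletSum k (u - s)‖) (even_two.convexOn_pow)
      (by fun_prop) isClosed_univ (by simp) (hint1 k s) (hInt k s)
    simp only [integral_norm_dirichletSum_sq] at h
    exact Real.le_sqrt_of_sq_le h
  have key : Tendsto (fun k => ∫ s, J k s ∂intervalLaw) atTop (𝓝 (∫ _, (0 : ℝ) ∂intervalLaw)) := by
    -- The constant `1` dominates because `|u - s| ≤ 1` almost everywhere and the squared kernel has
    -- mass `k`.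
    refine tendsto_integral_of_dominated_convergence (fun _ => 1) (fun k => ?_)
      (integrable_const _) (fun k => ?_) ?_
    · exact (((hcont k).stronglyMeasurable.integral_prod_right'
        (ν := intervalLaw)).measurable.div_const _).aestronglyMeasurable
    · filter_upwards [habs] with s hs
      rw [hJ, Real.norm_eq_abs, abs_of_nonneg
        (div_nonneg (integral_nonneg fun u => by positivity) (by positivity))]
      refine div_le_one_of_le₀ ?_ (by positivity)
      rw [← integral_norm_dirichletSum_sq k s]
      refine integral_mono_of_nonneg (Eventually.of_forall fun u => by positivity) (hInt k s) ?_
      filter_upwards [habs] with u hu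
      refine mul_le_of_le_one_right (by positivity) ?_
      have := abs_sub u s
      linarith
    · filter_upwards [habs] with s hs
      have hs' : 0 < 1 / 2 - |s| := by linarith
      have hle : ∀ k : ℕ, J k s ≤ (1 / (2 * (1 / 2 - |s|))) * (√k)⁻¹ := by
        intro k
        have h1 : ∫ u, ‖dirichletSum k (u - s)‖ ^ 2 * |u - s| ∂intervalLaw
            ≤ ∫ u, (1 / (2 * (1 / 2 - |s|))) * ‖dirichletSum k (u - s)‖ ∂intervalLaw := by
          refine integral_mono_of_nonneg (Eventually.of_forall fun u => by positivity)
            ((hint1 k s).const_mul _) ?_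
          filter_upwards [habs] with u hu
          have h2 := abs_sub u s
          have h3 := norm_dirichletSum_mul_le k (t := u - s) (by linarith)
          have h4 : ‖dirichletSum k (u - s)‖ * |u - s| * (1 / 2 - |s|) ≤ 1 / 2 := by
            refine le_trans ?_ h3
            rw [mul_assoc]
            refine mul_le_mul_of_nonneg_left ?_ (norm_nonneg _)
            exact mul_le_mul_of_nonneg_left (by linarith) (abs_nonneg _)
          have h5 : ‖dirichletSum k (u - s)‖ * |u - s| ≤ 1 / (2 * (1 / 2 - |s|)) := by
            rw [le_div_iff₀ (by positivity)]
            linarith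
          calc _ = ‖dirichletSum k (u - s)‖ * |u - s| * ‖dirichletSum k (u - s)‖ := by ring
            _ ≤ _ := mul_le_mul_of_nonneg_right h5 (norm_nonneg _)
        rw [integral_const_mul] at h1
        have h2 := h1.trans (mul_le_mul_of_nonneg_left (hcs k s) (by positivity))
        rcases Nat.eq_zero_or_pos k with rfl | hk
        · simp [hJ]
        · have hk' : (0 : ℝ) < k := by exact_mod_cast hk
          refine (div_le_div_of_nonneg_right h2 hk'.le).trans (le_of_eq ?_)
          rw [mul_div_assoc, Real.sqrt_div_self]
      refine squeeze_zero (fun k => div_nonneg (integral_nonneg fun u => by positivity)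
        (by positivity)) hle ?_
      rw [← mul_zero (1 / (2 * (1 / 2 - |s|)))]
      exact (Tendsto.inv_tendsto_atTop
        (Real.tendsto_sqrt_atTop.comp tendsto_natCast_atTop_atTop)).const_mul _
  simp only [integral_zero] at key
  refine key.congr fun k => ?_
  rw [hJ, integral_div, fejerSpread]

/-- The mean of `exp (2 π i b t / L)` over `b < L`. -/
def phaseAverage (L : ℕ) (t : ℝ) : ℂ := (L : ℂ)⁻¹ * dirichletSum L (t / L)

theorem norm_phaseAverage_le (L : ℕ) (t : ℝ) : ‖phaseAverage L t‖ ≤ 1 := by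
  rw [phaseAverage, norm_mul, norm_inv, Complex.norm_natCast]
  rcases Nat.eq_zero_or_pos L with rfl | hL
  · simp
  · rw [inv_mul_le_iff₀ (by exact_mod_cast hL), mul_one]
    exact norm_dirichletSum_le _ _

theorem norm_phaseAverage_sub_one_le {L : ℕ} (hL : 0 < L) (t : ℝ) :
    ‖phaseAverage L t - 1‖ ≤ 2 * Real.pi * |t| := by
  have hL' : (L : ℂ) ≠ 0 := by exact_mod_cast hL.ne'
  have hLr : (0 : ℝ) < L := by exact_mod_cast hL
  have h1 : phaseAverage L t - 1 = (L : ℂ)⁻¹ * ∑ b : Fin L, (unitExp ((b : ℕ) * (t / L)) - 1) := by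
    rw [Finset.sum_sub_distrib, mul_sub, phaseAverage, dirichletSum]
    simp [hL']
  rw [h1, norm_mul, norm_inv, Complex.norm_natCast, inv_mul_le_iff₀ hLr]
  refine (norm_sum_le _ _).trans ((Finset.sum_le_card_nsmul _ _ (2 * Real.pi * |t|)
    fun b _ => ?_).trans (by simp))
  refine (norm_unitExp_sub_one_le _).trans (mul_le_mul_of_nonneg_left ?_ Real.two_pi_pos.le)
  rw [abs_mul, abs_div, Nat.abs_cast, Nat.abs_cast, mul_div_assoc', mul_comm, mul_div_assoc]
  refine mul_le_of_le_one_right (abs_nonneg _) (div_le_one_of_le₀ ?_ hLr.le)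
  exact_mod_cast b.2.le

/-- Write each frequency below `k * L` as `b + L * a` with `b < L`: at the point `t / L` the part
`a` gives the kernel at scale `k`, and the part `b` a slowly varying phase. -/
theorem dirichletSum_mul_div {k L : ℕ} (hL : 0 < L) (t : ℝ) :
    dirichletSum (k * L) (t / L) = L * (dirichletSum k t * phaseAverage L t) := by
  have hL' : (L : ℂ) ≠ 0 := by exact_mod_cast hL.ne'
  have hLr : (L : ℝ) ≠ 0 := by exact_mod_cast hL.ne'
  rw [phaseAverage, mul_left_comm, mul_inv_cancel_left₀ hL']
  simp only [dirichletSum]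
  rw [← finProdFinEquiv.sum_comp, Fintype.sum_prod_type, Finset.sum_mul_sum]
  refine Finset.sum_congr rfl fun a _ => Finset.sum_congr rfl fun b _ => ?_
  rw [← unitExp_add, finProdFinEquiv_apply_val]
  congr 1
  push_cast
  field_simp
  ring

end DirichletKernel

end

noncomputable section

/-! ### The product kernel on the cube. -/

section CubeKernel

/-- The uniform law on the hypercube. -/
def cubeLaw (d : ℕ) : Measure (Fin d → ℝ) := volume.restrict (hypercube d)

theorem cubeLaw_eq_pi (d : ℕ) : cubeLaw d = Measure.pi fun _ => intervalLaw := by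
  rw [cubeLaw, hypercube, volume_pi, Measure.restrict_pi_pi]
  rfl

instance (d : ℕ) : IsProbabilityMeasure (cubeLaw d) := by
  rw [cubeLaw_eq_pi]
  infer_instance

theorem measurableSet_hypercube (d : ℕ) : MeasurableSet (hypercube d) :=
  MeasurableSet.univ_pi fun _ => measurableSet_Ico

theorem hypercube_subset_Icc (d : ℕ) :
    hypercube d ⊆ Set.Icc (fun _ => (-1 / 2 : ℝ)) (fun _ => (1 / 2 : ℝ)) := fun _ hz =>
  ⟨fun j => (hz j (Set.mem_univ j)).1, fun j => (hz j (Set.mem_univ j)).2.le⟩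

theorem integrable_cubeLaw_of_continuous {d : ℕ} {F : (Fin d → ℝ) → ℝ} (hF : Continuous F) :
    Integrable F (cubeLaw d) :=
  (hF.continuousOn.integrableOn_compact isCompact_Icc).mono_set (hypercube_subset_Icc d)

theorem integrable_cubeLaw_prod_of_continuous {d : ℕ} {F : (Fin d → ℝ) × (Fin d → ℝ) → ℝ}
    (hF : Continuous F) : Integrable F ((cubeLaw d).prod (cubeLaw d)) := by
  rw [cubeLaw, Measure.prod_restrict]
  exact (hF.continuousOn.integrableOn_compact (isCompact_Icc.prod isCompact_Icc)).mono_set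
    (Set.prod_mono (hypercube_subset_Icc d) (hypercube_subset_Icc d))

/-- The `d`-fold product of Dirichlet kernels. -/
def cubeKernel (d n : ℕ) (x : Fin d → ℝ) : ℂ := ∏ j, dirichletSum n (x j)

@[fun_prop]
theorem continuous_cubeKernel (d n : ℕ) : Continuous (cubeKernel d n) :=
  continuous_finsetProd _ fun j _ => (continuous_dirichletSum n).comp (continuous_apply j)

theorem norm_cubeKernel_le (d n : ℕ) (x : Fin d → ℝ) : ‖cubeKernel d n x‖ ≤ (n : ℝ) ^ d := by
  rw [cubeKernel, norm_prod]
  refine (Finset.prod_le_prod (fun j _ => norm_nonneg _)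
    fun j _ => norm_dirichletSum_le n (x j)).trans ?_
  simp

theorem cubeKernel_eq_sum (d n : ℕ) (x : Fin d → ℝ) :
    cubeKernel d n x = ∑ l : Fin d → Fin n, unitExp (∑ j, ((l j : ℕ) : ℝ) * x j) := by
  have hexp : ∀ (s : Finset (Fin d)) (f : Fin d → ℝ),
      unitExp (∑ j ∈ s, f j) = ∏ j ∈ s, unitExp (f j) := by
    intro s f
    induction s using Finset.induction_on with
    | empty => simp [unitExp_zero]
    | insert a s ha ih => rw [Finset.sum_insert ha, Finset.prod_insert ha, unitExp_add, ih]
  simp only [hexp, cubeKernel, dirichletSum]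
  rw [Finset.prod_univ_sum, Fintype.piFinset_univ]

theorem norm_cubeKernel_sq_le (d n : ℕ) (x : Fin d → ℝ) :
    ‖cubeKernel d n x‖ ^ 2 ≤ ((n : ℝ) ^ d) ^ 2 :=
  pow_le_pow_left₀ (norm_nonneg _) (norm_cubeKernel_le d n x) 2

theorem integral_norm_cubeKernel_sq (d n : ℕ) (s : Fin d → ℝ) :
    ∫ u, ‖cubeKernel d n (u - s)‖ ^ 2 ∂cubeLaw d = (n : ℝ) ^ d := by
  simp only [cubeKernel, norm_prod, ← Finset.prod_pow, Pi.sub_apply, cubeLaw_eq_pi]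
  rw [integral_fintype_prod_eq_prod (fun j u => ‖dirichletSum n (u - s j)‖ ^ 2)]
  simp [integral_norm_dirichletSum_sq]

/-- Fubini: the weight affects the coordinate `j` only, and each other coordinate contributes its
full mass `k`. -/
theorem integral_norm_cubeKernel_sq_mul_abs (d k : ℕ) (j : Fin d) :
    ∫ s, ∫ u, ‖cubeKernel d k (u - s)‖ ^ 2 * |u j - s j| ∂cubeLaw d ∂cubeLaw d
      = (k : ℝ) ^ d * (fejerSpread k / k) := by
  set w : Fin d → ℝ → ℝ := fun i t => if i = j then |t| else 1 with hw
  have h1 : ∀ u s : Fin d → ℝ, ‖cubeKernel d k (u - s)‖ ^ 2 * |u j - s j|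
      = ∏ i, (‖dirichletSum k (u i - s i)‖ ^ 2 * w i (u i - s i)) := by
    intro u s
    simp only [cubeKernel, norm_prod, ← Finset.prod_pow, Pi.sub_apply, Finset.prod_mul_distrib, hw,
      Finset.prod_ite_eq', Finset.mem_univ, if_true]
  simp only [h1, cubeLaw_eq_pi]
  have h2 : ∀ s : Fin d → ℝ, ∫ u, ∏ i, (‖dirichletSum k (u i - s i)‖ ^ 2 * w i (u i - s i))
        ∂(Measure.pi fun _ => intervalLaw)
      = ∏ i, ∫ u, ‖dirichletSum k (u - s i)‖ ^ 2 * w i (u - s i) ∂intervalLaw := fun s =>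
    integral_fintype_prod_eq_prod (μ := fun _ => intervalLaw)
      (fun i u => ‖dirichletSum k (u - s i)‖ ^ 2 * w i (u - s i))
  simp only [h2]
  rw [integral_fintype_prod_eq_prod (μ := fun _ => intervalLaw)
      (fun i s => ∫ u, ‖dirichletSum k (u - s)‖ ^ 2 * w i (u - s) ∂intervalLaw)]
  have h3 : ∀ i, ∫ s, ∫ u, ‖dirichletSum k (u - s)‖ ^ 2 * w i (u - s) ∂intervalLaw ∂intervalLaw
      = k * (if i = j then fejerSpread k / k else 1) := by
    intro i
    by_cases hij : i = j
    · rcases Nat.eq_zero_or_pos k with rfl | hk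
      · simp [dirichletSum]
      · have hk' : (k : ℝ) ≠ 0 := by exact_mod_cast hk.ne'
        simp only [hw, hij, if_true]
        rw [mul_div_cancel₀ _ hk']
        rfl
    · simp [hw, hij, integral_norm_dirichletSum_sq]
  simp only [h3, Finset.prod_mul_distrib, Finset.prod_const, Finset.card_univ, Fintype.card_fin,
    Finset.prod_ite_eq', Finset.mem_univ, if_true]

theorem integral_norm_cubeKernel_sq_mul_sum (d k : ℕ) :
    ∫ s, ∫ u, ‖cubeKernel d k (u - s)‖ ^ 2 * ∑ j, |u j - s j| ∂cubeLaw d ∂cubeLaw d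
      = (k : ℝ) ^ d * (d * (fejerSpread k / k)) := by
  have hc : ∀ j, Continuous fun z : (Fin d → ℝ) × (Fin d → ℝ) =>
      ‖cubeKernel d k (z.2 - z.1)‖ ^ 2 * |z.2 j - z.1 j| := fun j => by
    fun_prop
  simp only [Finset.mul_sum]
  have h0 : ∀ (s : Fin d → ℝ) (j : Fin d),
      Integrable (fun u => ‖cubeKernel d k (u - s)‖ ^ 2 * |u j - s j|) (cubeLaw d) := fun s j =>
    integrable_cubeLaw_of_continuous (by fun_prop)
  have h1 : ∀ s : Fin d → ℝ, ∫ u, ∑ j, ‖cubeKernel d k (u - s)‖ ^ 2 * |u j - s j| ∂cubeLaw d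
      = ∑ j, ∫ u, ‖cubeKernel d k (u - s)‖ ^ 2 * |u j - s j| ∂cubeLaw d := fun s =>
    integral_finsetSum _ fun j _ => h0 s j
  simp only [h1]
  have h2 : ∀ j, Integrable (fun s => ∫ u, ‖cubeKernel d k (u - s)‖ ^ 2 * |u j - s j| ∂cubeLaw d)
      (cubeLaw d) := fun j => (integrable_cubeLaw_prod_of_continuous (hc j)).integral_prod_left
  have h3 : ∫ s, ∑ j, ∫ u, ‖cubeKernel d k (u - s)‖ ^ 2 * |u j - s j| ∂cubeLaw d ∂cubeLaw d
      = ∑ j, ∫ s, ∫ u, ‖cubeKernel d k (u - s)‖ ^ 2 * |u j - s j| ∂cubeLaw d ∂cubeLaw d :=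
    integral_finsetSum _ (fun j _ => h2 j)
  rw [h3]
  simp only [integral_norm_cubeKernel_sq_mul_abs, Finset.sum_const, Finset.card_univ,
    Fintype.card_fin, nsmul_eq_mul]
  ring

theorem cubeKernel_mul_smul {d k L : ℕ} (hL : 0 < L) (x : Fin d → ℝ) :
    cubeKernel d (k * L) ((L : ℝ)⁻¹ • x)
      = (L : ℂ) ^ d * (cubeKernel d k x * ∏ j, phaseAverage L (x j)) := by
  simp only [cubeKernel, Pi.smul_apply, smul_eq_mul, inv_mul_eq_div, dirichletSum_mul_div hL,
    Finset.prod_mul_distrib, Finset.prod_const, Finset.card_univ, Fintype.card_fin]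

theorem norm_prod_phaseAverage_le {d : ℕ} (L : ℕ) (x : Fin d → ℝ) :
    ‖∏ j, phaseAverage L (x j)‖ ≤ 1 := by
  rw [norm_prod]
  exact Finset.prod_le_one (fun _ _ => norm_nonneg _) fun _ _ => norm_phaseAverage_le _ _

theorem norm_prod_phaseAverage_sub_one_le {d L : ℕ} (hL : 0 < L) (x : Fin d → ℝ) :
    ‖∏ j, phaseAverage L (x j) - 1‖ ≤ 2 * Real.pi * ∑ j, |x j| := by
  have key : ∀ s : Finset (Fin d),
      ‖∏ j ∈ s, phaseAverage L (x j) - 1‖ ≤ ∑ j ∈ s, 2 * Real.pi * |x j| := by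
    intro s
    induction s using Finset.induction_on with
    | empty => simp
    | insert a s ha ih =>
      rw [Finset.prod_insert ha, Finset.sum_insert ha]
      have : phaseAverage L (x a) * ∏ j ∈ s, phaseAverage L (x j) - 1
          = phaseAverage L (x a) * (∏ j ∈ s, phaseAverage L (x j) - 1)
            + (phaseAverage L (x a) - 1) := by ring
      rw [this, add_comm]
      refine (norm_add_le _ _).trans (add_le_add (norm_phaseAverage_sub_one_le hL _) ?_)
      rw [norm_mul]
      exact (mul_le_of_le_one_left (norm_nonneg _) (norm_phaseAverage_le _ _)).trans ih
  rw [Finset.mul_sum]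
  exact key _

/-! ### Subdivision of the cube into cells, and the kernel mass inside and across cells. -/

/-- The affine map from the hypercube onto the cell `i` of its subdivision into `L ^ d` cubes. -/
def cellMap {d : ℕ} (L : ℕ) (i : Fin d → Fin L) (u : Fin d → ℝ) : Fin d → ℝ :=
  fun j => -1 / 2 + ((i j : ℕ) + (u j + 1 / 2)) / L

@[fun_prop]
theorem continuous_cellMap {d L : ℕ} (i : Fin d → Fin L) : Continuous (cellMap L i) := by
  unfold cellMap
  fun_prop

theorem cellMap_sub_cellMap {d L : ℕ} (i : Fin d → Fin L) (u s : Fin d → ℝ) :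
    cellMap L i u - cellMap L i s = (L : ℝ)⁻¹ • (u - s) := by
  ext j
  simp only [cellMap, Pi.sub_apply, Pi.smul_apply, smul_eq_mul]
  ring

/-- The self-similarity behind the comparison of scales; the phase averages, close to `1` near the
diagonal, are its only defect. -/
theorem cubeKernel_cellMap_sub {d k L : ℕ} (hL : 0 < L) (i : Fin d → Fin L)
    (u s : Fin d → ℝ) :
    cubeKernel d (k * L) (cellMap L i u - cellMap L i s)
      = (L : ℂ) ^ d * (cubeKernel d k (u - s) * ∏ j, phaseAverage L ((u - s) j)) := by
  rw [cellMap_sub_cellMap, cubeKernel_mul_smul hL]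

/-- The cell `i` of the subdivision of the hypercube into `L ^ d` cubes. -/
def cell {d : ℕ} (L : ℕ) (i : Fin d → Fin L) : Set (Fin d → ℝ) :=
  Set.univ.pi fun j => Set.Ico (-1 / 2 + (i j : ℕ) / (L : ℝ)) (-1 / 2 + ((i j : ℕ) + 1) / (L : ℝ))

theorem mem_cell_iff {d L : ℕ} (hL : 0 < L) (i : Fin d → Fin L) (z : Fin d → ℝ) :
    z ∈ cell L i ↔ ∀ j, ((i j : ℕ) : ℝ) ≤ L * (z j + 1 / 2) ∧ L * (z j + 1 / 2) < (i j : ℕ) + 1 := by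
  have hL' : (0 : ℝ) < L := by exact_mod_cast hL
  simp only [cell, Set.mem_univ_pi, Set.mem_Ico]
  refine forall_congr' fun j => and_congr ?_ ?_
  · rw [← le_sub_iff_add_le', div_le_iff₀ hL']
    constructor <;> intro h <;> linarith
  · rw [← sub_lt_iff_lt_add', lt_div_iff₀ hL']
    constructor <;> intro h <;> linarith

theorem iUnion_cell {d L : ℕ} (hL : 0 < L) : ⋃ i : Fin d → Fin L, cell L i = hypercube d := by
  have hL' : (0 : ℝ) < L := by exact_mod_cast hL
  ext z
  simp only [Set.mem_iUnion, mem_cell_iff hL, hypercube, Set.mem_univ_pi, Set.mem_Ico]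
  constructor
  · rintro ⟨i, hi⟩ j
    obtain ⟨h1, h2⟩ := hi j
    have h3 : ((i j : ℕ) : ℝ) + 1 ≤ L := by exact_mod_cast (i j).2
    have h4 : (0 : ℝ) ≤ (i j : ℕ) := Nat.cast_nonneg _
    constructor <;> nlinarith
  · intro h
    have h0 : ∀ j, 0 ≤ L * (z j + 1 / 2) := fun j =>
      mul_nonneg hL'.le (by linarith [(h j).1])
    refine ⟨fun j => ⟨⌊L * (z j + 1 / 2)⌋₊, ?_⟩, fun j => ⟨Nat.floor_le (h0 j),
      Nat.lt_floor_add_one _⟩⟩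
    rw [Nat.floor_lt (h0 j)]
    nlinarith [(h j).2]

theorem pairwise_disjoint_cell {d L : ℕ} (hL : 0 < L) :
    Pairwise (Function.onFun Disjoint fun i : Fin d → Fin L => cell L i) := by
  intro i i' hne
  rw [Function.onFun, Set.disjoint_left]
  intro z hz hz'
  rw [mem_cell_iff hL] at hz hz'
  refine hne (funext fun j => Fin.ext ?_)
  have h1 : ((i j : ℕ) : ℝ) < (i' j : ℕ) + 1 := (hz j).1.trans_lt (hz' j).2
  have h2 : ((i' j : ℕ) : ℝ) < (i j : ℕ) + 1 := (hz' j).1.trans_lt (hz j).2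
  have h3 : (i j : ℕ) < i' j + 1 := by exact_mod_cast h1
  have h4 : (i' j : ℕ) < i j + 1 := by exact_mod_cast h2
  omega

theorem cellMap_preimage_cell {d L : ℕ} (hL : 0 < L) (i : Fin d → Fin L) :
    cellMap L i ⁻¹' cell L i = hypercube d := by
  have hL' : (0 : ℝ) < L := by exact_mod_cast hL
  ext u
  simp only [Set.mem_preimage, mem_cell_iff hL, hypercube, Set.mem_univ_pi, Set.mem_Ico]
  refine forall_congr' fun j => ?_
  have : L * (cellMap L i u j + 1 / 2) = (i j : ℕ) + (u j + 1 / 2) := by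
    simp only [cellMap]
    field_simp
    ring
  rw [this]
  constructor <;> rintro ⟨h1, h2⟩ <;> constructor <;> linarith

theorem volume_cellMap_preimage {d L : ℕ} (hL : 0 < L) (i : Fin d → Fin L)
    (s : Set (Fin d → ℝ)) : volume (cellMap L i ⁻¹' s) = (L : ENNReal) ^ d * volume s := by
  have hL' : (0 : ℝ) < L := by exact_mod_cast hL
  set c : Fin d → ℝ := fun j => -1 / 2 + ((i j : ℕ) + 1 / 2) / L with hc
  have h1 : cellMap L i = fun u => c + (L : ℝ)⁻¹ • u := by
    ext u j
    simp only [cellMap, hc, Pi.add_apply, Pi.smul_apply, smul_eq_mul]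
    ring
  have h2 : cellMap L i ⁻¹' s = ((L : ℝ)⁻¹ • ·) ⁻¹' ((c + ·) ⁻¹' s) := by
    rw [h1]; rfl
  rw [h2, Measure.addHaar_preimage_smul _ (inv_ne_zero hL'.ne'), measure_preimage_add]
  congr 1
  rw [Module.finrank_fin_fun, inv_pow, inv_inv, abs_of_pos (by positivity),
    ENNReal.ofReal_pow hL'.le, ENNReal.ofReal_natCast]

/-- A uniform point of the cube is a uniform point of a uniformly chosen cell. -/
theorem cubeLaw_eq_sum_map {d L : ℕ} (hL : 0 < L) :
    cubeLaw d = ∑ i : Fin d → Fin L, ((L : ENNReal) ^ d)⁻¹ • (cubeLaw d).map (cellMap L i) := by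
  ext s hs
  have hcell : ∀ i : Fin d → Fin L, MeasurableSet (cell L i) := fun i =>
    MeasurableSet.univ_pi fun _ => measurableSet_Ico
  have hL' : (L : ENNReal) ^ d ≠ 0 := pow_ne_zero _ (by exact_mod_cast hL.ne')
  rw [Measure.finsetSum_apply, cubeLaw, Measure.restrict_apply hs]
  have h1 : ∀ i : Fin d → Fin L,
      (((L : ENNReal) ^ d)⁻¹ • (volume.restrict (hypercube d)).map (cellMap L i)) s
        = volume (s ∩ cell L i) := by
    intro i
    rw [Measure.smul_apply, Measure.map_apply (continuous_cellMap i).measurable hs,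
      Measure.restrict_apply ((continuous_cellMap i).measurable hs),
      ← cellMap_preimage_cell hL i, ← Set.preimage_inter, volume_cellMap_preimage hL, smul_eq_mul,
      ← mul_assoc, ENNReal.inv_mul_cancel hL' (by finiteness), one_mul]
  rw [Finset.sum_congr rfl fun i _ => h1 i, ← iUnion_cell hL, Set.inter_iUnion,
    measure_iUnion (fun i j hij => ((pairwise_disjoint_cell hL hij).mono Set.inter_subset_right
      Set.inter_subset_right)) fun i => hs.inter (hcell i), tsum_fintype]

theorem integrable_comp_cellMap {d L : ℕ} (hL : 0 < L) {φ : (Fin d → ℝ) → ℝ}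
    (hφ : Integrable φ (cubeLaw d)) (i : Fin d → Fin L) :
    Integrable (fun u => φ (cellMap L i u)) (cubeLaw d) := by
  have hL' : (L : ENNReal) ^ d ≠ 0 := pow_ne_zero _ (by exact_mod_cast hL.ne')
  rw [cubeLaw_eq_sum_map hL, integrable_finsetSum_measure] at hφ
  have h := hφ i (Finset.mem_univ i)
  rw [integrable_smul_measure (ENNReal.inv_ne_zero.2 (by finiteness))
    (ENNReal.inv_ne_top.2 hL')] at h
  exact h.comp_measurable (continuous_cellMap i).measurable

theorem integral_cubeLaw_eq_sum {d L : ℕ} (hL : 0 < L) {φ : (Fin d → ℝ) → ℝ}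
    (hφ : Integrable φ (cubeLaw d)) :
    ∫ x, φ x ∂cubeLaw d
      = ((L : ℝ) ^ d)⁻¹ * ∑ i : Fin d → Fin L, ∫ u, φ (cellMap L i u) ∂cubeLaw d := by
  have hφ' := hφ
  rw [cubeLaw_eq_sum_map hL, integrable_finsetSum_measure] at hφ'
  have hL' : (L : ENNReal) ^ d ≠ 0 := pow_ne_zero _ (by exact_mod_cast hL.ne')
  conv_lhs => rw [cubeLaw_eq_sum_map hL]
  rw [integral_finsetSum_measure hφ', Finset.mul_sum]
  refine Finset.sum_congr rfl fun i hi => ?_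
  have h := hφ' i hi
  rw [integrable_smul_measure (ENNReal.inv_ne_zero.2 (by finiteness))
    (ENNReal.inv_ne_top.2 hL')] at h
  rw [integral_smul_measure, integral_map (continuous_cellMap i).aemeasurable
    h.aestronglyMeasurable]
  simp

theorem integral_integral_cubeLaw_mono {d : ℕ} {F G : (Fin d → ℝ) → (Fin d → ℝ) → ℝ}
    (hF : Continuous fun z : (Fin d → ℝ) × (Fin d → ℝ) => F z.1 z.2)
    (hG : Continuous fun z : (Fin d → ℝ) × (Fin d → ℝ) => G z.1 z.2)
    (h : ∀ s u, F s u ≤ G s u) :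
    ∫ s, ∫ u, F s u ∂cubeLaw d ∂cubeLaw d ≤ ∫ s, ∫ u, G s u ∂cubeLaw d ∂cubeLaw d := by
  have hF' : Integrable (fun s => ∫ u, F s u ∂cubeLaw d) (cubeLaw d) :=
    (integrable_cubeLaw_prod_of_continuous hF).integral_prod_left
  have hG' : Integrable (fun s => ∫ u, G s u ∂cubeLaw d) (cubeLaw d) :=
    (integrable_cubeLaw_prod_of_continuous hG).integral_prod_left
  refine integral_mono hF' hG' fun s => ?_
  exact integral_mono (integrable_cubeLaw_of_continuous (hF.comp (Continuous.prodMk_right s)))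
    (integrable_cubeLaw_of_continuous (hG.comp (Continuous.prodMk_right s))) (h s)

@[fun_prop]
theorem continuous_prod_phaseAverage (d L : ℕ) :
    Continuous fun x : Fin d → ℝ => ∏ j, phaseAverage L (x j) := by
  unfold phaseAverage
  exact continuous_finsetProd _ fun j _ => continuous_const.mul
    ((continuous_dirichletSum L).comp (by fun_prop))

theorem continuous_norm_cubeKernel_sq_mul_sum (d k : ℕ) :
    Continuous fun z : (Fin d → ℝ) × (Fin d → ℝ) =>
      ‖cubeKernel d k (z.2 - z.1)‖ ^ 2 * ∑ j, |z.2 j - z.1 j| :=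
  (((continuous_cubeKernel d k).comp (by fun_prop)).norm.pow 2).mul (by fun_prop)

/-- The phase product `P` satisfies both `|P - 1| ≤ 2` and `|P - 1| ≤ 2π ∑ |u j - s j|`. Multiplying
the two bounds the square linearly in the distance, which is what `fejerSpread` measures. -/
theorem integral_norm_cubeKernel_sq_mul_phaseAverage_sub_one_le {d k L : ℕ} (hL : 0 < L) :
    ∫ s, ∫ u, ‖cubeKernel d k (u - s) * (∏ j, phaseAverage L ((u - s) j) - 1)‖ ^ 2
        ∂cubeLaw d ∂cubeLaw d
      ≤ (k : ℝ) ^ d * (4 * Real.pi * (d * (fejerSpread k / k))) := by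
  have h1 := integral_integral_cubeLaw_mono (d := d)
    (F := fun s u => ‖cubeKernel d k (u - s) * (∏ j, phaseAverage L ((u - s) j) - 1)‖ ^ 2)
    (G := fun s u => 4 * Real.pi * (‖cubeKernel d k (u - s)‖ ^ 2 * ∑ j, |u j - s j|))
    ((((continuous_cubeKernel d k).comp (by fun_prop)).mul
      (((continuous_prod_phaseAverage d L).comp (by fun_prop)).sub continuous_const)).norm.pow 2)
    (continuous_const.mul (continuous_norm_cubeKernel_sq_mul_sum d k)) (fun s u => by
      rw [norm_mul, mul_pow]
      have h2 := norm_prod_phaseAverage_sub_one_le hL (u - s)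
      have h3 : ‖∏ j, phaseAverage L ((u - s) j) - 1‖ ≤ 2 := by
        refine (norm_sub_le _ _).trans ?_
        have := norm_prod_phaseAverage_le L (u - s)
        rw [norm_one]
        linarith
      have h4 : ‖∏ j, phaseAverage L ((u - s) j) - 1‖ ^ 2 ≤ 4 * Real.pi * ∑ j, |u j - s j| := by
        simp only [Pi.sub_apply] at h2 h3 ⊢
        nlinarith [norm_nonneg (∏ j, phaseAverage L (u j - s j) - 1)]
      calc _ ≤ ‖cubeKernel d k (u - s)‖ ^ 2 * (4 * Real.pi * ∑ j, |u j - s j|) :=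
            mul_le_mul_of_nonneg_left h4 (by positivity)
        _ = _ := by ring)
  refine h1.trans (le_of_eq ?_)
  simp only [integral_const_mul]
  rw [integral_norm_cubeKernel_sq_mul_sum]
  ring

/-- From `|P| ≥ 1 - 2π ∑ |u j - s j|` for the phase product `P` one gets `|P|² ≥ 1 - 4π ∑ |u j - s
j|`: almost all the mass of the kernel stays within a cell. -/
theorem le_integral_norm_cubeKernel_sq_cell {d k L : ℕ} (hL : 0 < L) (i : Fin d → Fin L) :
    ((L : ℝ) ^ d) ^ 2 * ((k : ℝ) ^ d - (k : ℝ) ^ d * (4 * Real.pi * (d * (fejerSpread k / k))))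
      ≤ ∫ s, ∫ u, ‖cubeKernel d (k * L) (cellMap L i u - cellMap L i s)‖ ^ 2
        ∂cubeLaw d ∂cubeLaw d := by
  have hK : Continuous fun z : (Fin d → ℝ) × (Fin d → ℝ) => ‖cubeKernel d k (z.2 - z.1)‖ ^ 2 :=
    ((continuous_cubeKernel d k).comp (by fun_prop)).norm.pow 2
  have h1 := integral_integral_cubeLaw_mono (d := d)
    (F := fun s u => ((L : ℝ) ^ d) ^ 2 * (‖cubeKernel d k (u - s)‖ ^ 2
      - 4 * Real.pi * (‖cubeKernel d k (u - s)‖ ^ 2 * ∑ j, |u j - s j|)))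
    (G := fun s u => ‖cubeKernel d (k * L) (cellMap L i u - cellMap L i s)‖ ^ 2)
    (continuous_const.mul (hK.sub
      (continuous_const.mul (continuous_norm_cubeKernel_sq_mul_sum d k))))
    (((continuous_cubeKernel d (k * L)).comp
      (((continuous_cellMap i).comp continuous_snd).sub
        ((continuous_cellMap i).comp continuous_fst))).norm.pow 2) (fun s u => by
      rw [cubeKernel_cellMap_sub hL, norm_mul, norm_mul, mul_pow, mul_pow, norm_pow,
        Complex.norm_natCast]
      refine mul_le_mul_of_nonneg_left ?_ (by positivity)
      have h2 := norm_prod_phaseAverage_sub_one_le hL (u - s)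
      have h3 := norm_prod_phaseAverage_le L (u - s)
      have h4 := norm_sub_norm_le 1 (∏ j, phaseAverage L ((u - s) j))
      rw [norm_one, norm_sub_rev] at h4
      have h5 : 1 - 4 * Real.pi * ∑ j, |u j - s j| ≤ ‖∏ j, phaseAverage L ((u - s) j)‖ ^ 2 := by
        simp only [Pi.sub_apply] at h2 h3 h4 ⊢
        nlinarith [norm_nonneg (∏ j, phaseAverage L (u j - s j)),
          sq_nonneg (1 - ‖∏ j, phaseAverage L (u j - s j)‖)]
      calc _ = ‖cubeKernel d k (u - s)‖ ^ 2 * (1 - 4 * Real.pi * ∑ j, |u j - s j|) := by ring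
        _ ≤ _ := mul_le_mul_of_nonneg_left h5 (by positivity))
  refine le_trans (le_of_eq ?_) h1
  have e1 : ∀ s : Fin d → ℝ, Integrable (fun u => ‖cubeKernel d k (u - s)‖ ^ 2) (cubeLaw d) :=
    fun s => integrable_cubeLaw_of_continuous (by fun_prop)
  have e2 : ∀ s : Fin d → ℝ, Integrable (fun u =>
      4 * Real.pi * (‖cubeKernel d k (u - s)‖ ^ 2 * ∑ j, |u j - s j|)) (cubeLaw d) :=
    fun s => integrable_cubeLaw_of_continuous (by fun_prop)
  have e3 : Integrable (fun s => ∫ u, ‖cubeKernel d k (u - s)‖ ^ 2 * ∑ j, |u j - s j| ∂cubeLaw d)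
      (cubeLaw d) := (integrable_cubeLaw_prod_of_continuous
        (continuous_norm_cubeKernel_sq_mul_sum d k)).integral_prod_left
  have e4 : ∀ s : Fin d → ℝ, ∫ u, ((L : ℝ) ^ d) ^ 2 * (‖cubeKernel d k (u - s)‖ ^ 2
      - 4 * Real.pi * (‖cubeKernel d k (u - s)‖ ^ 2 * ∑ j, |u j - s j|)) ∂cubeLaw d
      = ((L : ℝ) ^ d) ^ 2 * ((k : ℝ) ^ d - 4 * Real.pi *
        ∫ u, ‖cubeKernel d k (u - s)‖ ^ 2 * ∑ j, |u j - s j| ∂cubeLaw d) := by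
    intro s
    rw [integral_const_mul, integral_sub (e1 s) (e2 s), integral_const_mul,
      integral_norm_cubeKernel_sq]
  simp only [e4]
  have e5 := integral_sub (μ := cubeLaw d) (integrable_const ((k : ℝ) ^ d))
    (e3.const_mul (4 * Real.pi))
  rw [integral_const_mul, e5, integral_const_mul, integral_norm_cubeKernel_sq_mul_sum,
    integral_const, probReal_univ, one_smul]
  ring

/-- The mass of the squared kernel at pairs of points in different cells. -/
theorem sum_integral_norm_cubeKernel_sq_offDiag_le {d k L : ℕ} (hL : 0 < L) :
    ∑ i' : Fin d → Fin L, ∑ i : Fin d → Fin L, (if i = i' then 0 else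
        ∫ s, ∫ u, ‖cubeKernel d (k * L) (cellMap L i u - cellMap L i' s)‖ ^ 2 ∂cubeLaw d ∂cubeLaw d)
      ≤ ((L : ℝ) ^ d) ^ 2 * (((k * L : ℕ) : ℝ) ^ d * (4 * Real.pi * (d * (fejerSpread k / k)))) := by
  set I : (Fin d → Fin L) → (Fin d → Fin L) → ℝ := fun i i' =>
    ∫ s, ∫ u, ‖cubeKernel d (k * L) (cellMap L i u - cellMap L i' s)‖ ^ 2 ∂cubeLaw d ∂cubeLaw d
    with hI
  have hLr : (0 : ℝ) < L := by exact_mod_cast hL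
  have hc : ∀ i i' : Fin d → Fin L, Continuous fun z : (Fin d → ℝ) × (Fin d → ℝ) =>
      ‖cubeKernel d (k * L) (cellMap L i z.2 - cellMap L i' z.1)‖ ^ 2 := fun i i' =>
    ((continuous_cubeKernel d (k * L)).comp (((continuous_cellMap i).comp continuous_snd).sub
        ((continuous_cellMap i').comp continuous_fst))).norm.pow 2
  have hInt : ∀ i i', Integrable (fun s => ∫ u, ‖cubeKernel d (k * L)
      (cellMap L i u - cellMap L i' s)‖ ^ 2 ∂cubeLaw d) (cubeLaw d) := fun i i' =>
    (integrable_cubeLaw_prod_of_continuous (hc i i')).integral_prod_left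
  -- Parseval gives the exact total mass, so the lower bound on the mass inside a cell is an upper
  -- bound on the mass outside it. No pointwise estimate between distinct cells is needed.
  have htot : ∀ i', ∑ i, I i i' = (L : ℝ) ^ d * ((k * L : ℕ) : ℝ) ^ d := by
    intro i'
    rw [← integral_finsetSum _ fun i _ => hInt i i']
    have h1 : ∀ s : Fin d → ℝ, ∑ i : Fin d → Fin L, ∫ u, ‖cubeKernel d (k * L)
        (cellMap L i u - cellMap L i' s)‖ ^ 2 ∂cubeLaw d
          = (L : ℝ) ^ d * ((k * L : ℕ) : ℝ) ^ d := by
      intro s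
      have h2 := integral_cubeLaw_eq_sum hL (φ := fun x =>
        ‖cubeKernel d (k * L) (x - cellMap L i' s)‖ ^ 2)
        (integrable_cubeLaw_of_continuous
          (((continuous_cubeKernel d (k * L)).comp (by fun_prop)).norm.pow 2))
      rw [integral_norm_cubeKernel_sq] at h2
      rw [h2, mul_inv_cancel_left₀ (by positivity)]
    simp only [h1]
    simp
  have hdiag := fun i : Fin d → Fin L => le_integral_norm_cubeKernel_sq_cell (k := k) hL i
  have h3 : ∀ i', ∑ i, (if i = i' then 0 else I i i')
      ≤ (L : ℝ) ^ d * (((k * L : ℕ) : ℝ) ^ d * (4 * Real.pi * (d * (fejerSpread k / k)))) := by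
    intro i'
    have h4 : ∑ i, (if i = i' then 0 else I i i') = ∑ i, I i i' - I i' i' := by
      rw [eq_sub_iff_add_eq, ← Finset.sum_erase_add Finset.univ (fun i => I i i')
        (Finset.mem_univ i'), Finset.sum_ite, Finset.sum_const_zero, zero_add]
      congr 2
      ext i
      simp
    rw [h4, htot]
    have h5 := hdiag i'
    have : ((k * L : ℕ) : ℝ) ^ d = (k : ℝ) ^ d * (L : ℝ) ^ d := by
      rw [Nat.cast_mul, mul_pow]
    rw [this]
    change _ ≤ I i' i' at h5
    nlinarith
  refine (Finset.sum_le_sum fun i' _ => h3 i').trans (le_of_eq ?_)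
  simp
  ring

end CubeKernel

end

noncomputable section

theorem abs_integral_le_of_forall_abs_le {X : Type*} [MeasurableSpace X] {μ : Measure X}
    [IsProbabilityMeasure μ] {f : X → ℝ} {C : ℝ} (h : ∀ x, |f x| ≤ C) : |∫ x, f x ∂μ| ≤ C := by
  refine (norm_integral_le_of_norm_le_const (f := f) (C := C) (Eventually.of_forall h)).trans ?_
  simp

/-! ### Binomial averages of Lipschitz functions. -/

section BinomialMean

/-- The mean of `φ` under the binomial law with `m` trials of success probability `q`. -/
def binomialMean (q : ℝ) : ℕ → (ℕ → ℝ) → ℝ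
  | 0, φ => φ 0
  | m + 1, φ => (1 - q) * binomialMean q m φ + q * binomialMean q m fun j => φ (j + 1)

theorem binomialMean_mono {q : ℝ} (h0 : 0 ≤ q) (h1 : q ≤ 1) (m : ℕ) {φ ψ : ℕ → ℝ}
    (h : ∀ j, φ j ≤ ψ j) : binomialMean q m φ ≤ binomialMean q m ψ := by
  induction m generalizing φ ψ with
  | zero => exact h 0
  | succ m ih =>
    exact add_le_add (mul_le_mul_of_nonneg_left (ih h) (by linarith))
      (mul_le_mul_of_nonneg_left (ih fun j => h (j + 1)) h0)

/-- The free shift `a` is what lets the induction on `m` close, since one more success replaces `a`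
by `a + 1`. Taking `a = -(m * q)` gives the variance. -/
theorem binomialMean_sq_add (q : ℝ) (m : ℕ) (a b c : ℝ) :
    binomialMean q m (fun j => b * ((j : ℝ) + a) ^ 2 + c)
      = b * ((m * q + a) ^ 2 + m * q * (1 - q)) + c := by
  induction m generalizing a with
  | zero => simp [binomialMean]
  | succ m ih =>
    have h := ih (a + 1)
    simp only [binomialMean, ih]
    have e : (fun j : ℕ => b * (((j + 1 : ℕ) : ℝ) + a) ^ 2 + c)
        = fun j : ℕ => b * ((j : ℝ) + (a + 1)) ^ 2 + c := by
      funext j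
      push_cast
      ring
    rw [e, h]
    push_cast
    ring

/-- The standard deviation is at most `c = √(m q)`. The inequality `|x| ≤ x² / (2 c) + c / 2` turns
the Lipschitz bound into a quadratic one, whose mean is explicit; the additional `1` pays for the
floor. -/
theorem abs_binomialMean_sub_le {q : ℝ} (h0 : 0 ≤ q) (h1 : q ≤ 1) (m : ℕ) {φ : ℕ → ℝ} {C : ℝ}
    (hC : 0 ≤ C) (hφ : ∀ i j, |φ i - φ j| ≤ C * |(i : ℝ) - j|) :
    |binomialMean q m φ - φ ⌊m * q⌋₊| ≤ C * (√(m * q) + 1) := by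
  set N := ⌊m * q⌋₊ with hN
  have hmq : 0 ≤ m * q := by positivity
  have hN1 : (N : ℝ) ≤ m * q := Nat.floor_le hmq
  have hN2 : m * q < N + 1 := Nat.lt_floor_add_one _
  rcases eq_or_lt_of_le hmq with h | h
  · -- the law is concentrated at zero
    have hq : m = 0 ∨ q = 0 := by
      rcases mul_eq_zero.1 h.symm with h | h
      · exact Or.inl (by exact_mod_cast h)
      · exact Or.inr h
    have hz : binomialMean q m φ = φ 0 := by
      rcases hq with rfl | rfl
      · rfl
      · clear * -
        induction m with
        | zero => rfl
        | succ m ih => simp [binomialMean, ih]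
    have : N = 0 := by rw [hN, ← h]; simp
    rw [hz, this, sub_self, abs_zero]
    positivity
  · set c := √(m * q) with hc
    have hc0 : 0 < c := Real.sqrt_pos.2 h
    have hcc : c * c = m * q := Real.mul_self_sqrt hmq
    have hpt : ∀ j : ℕ, |φ j - φ N| ≤ C / (2 * c) * ((j : ℝ) + -(m * q)) ^ 2 + C * (c / 2 + 1) := by
      intro j
      refine (hφ j N).trans ?_
      have h3 : |(j : ℝ) - N| ≤ |(j : ℝ) + -(m * q)| + 1 := by
        have : (j : ℝ) - N = ((j : ℝ) + -(m * q)) + (m * q - N) := by ring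
        rw [this]
        refine (abs_add_le _ _).trans ?_
        have : |m * q - N| ≤ 1 := by rw [abs_le]; constructor <;> linarith
        linarith
      have h4 : |(j : ℝ) + -(m * q)| ≤ ((j : ℝ) + -(m * q)) ^ 2 / (2 * c) + c / 2 := by
        rw [← sq_abs ((j : ℝ) + -(m * q)), div_add_div _ _ (by positivity) two_ne_zero,
          le_div_iff₀ (by positivity)]
        nlinarith [sq_nonneg (|(j : ℝ) + -(m * q)| - c)]
      calc C * |(j : ℝ) - N| ≤ C * (((j : ℝ) + -(m * q)) ^ 2 / (2 * c) + c / 2 + 1) :=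
            mul_le_mul_of_nonneg_left (by linarith) hC
        _ = _ := by ring
    have hval : C / (2 * c) * ((m * q + -(m * q)) ^ 2 + m * q * (1 - q)) + C * (c / 2 + 1)
        ≤ C * (c + 1) := by
      have : C / (2 * c) * ((m * q + -(m * q)) ^ 2 + m * q * (1 - q)) ≤ C * (c / 2) := by
        rw [← hcc]
        have : C / (2 * c) * ((c * c + -(c * c)) ^ 2 + c * c * (1 - q))
            = C * (c / 2) * (1 - q) := by
          field_simp
          ring
        rw [this]
        exact mul_le_of_le_one_right (by positivity) (by linarith)
      linarith
    have hconst : ∀ x : ℝ, binomialMean q m (fun _ => x) = x := fun x => by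
      simpa using binomialMean_sq_add q m 0 0 x
    rw [abs_le]
    constructor
    · have h5 := binomialMean_mono h0 h1 m (φ := fun j => -(C / (2 * c)) * ((j : ℝ) + -(m * q)) ^ 2
        + (φ N - C * (c / 2 + 1))) (ψ := φ) (fun j => by
          have := (abs_le.1 (hpt j)).1
          linarith)
      rw [binomialMean_sq_add] at h5
      linarith
    · have h5 := binomialMean_mono h0 h1 m (φ := φ) (ψ := fun j => C / (2 * c) *
        ((j : ℝ) + -(m * q)) ^ 2 + (φ N + C * (c / 2 + 1))) (fun j => by
          have := (abs_le.1 (hpt j)).2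
          linarith)
      rw [binomialMean_sq_add] at h5
      linarith

theorem integral_binomialMean {X : Type*} [MeasurableSpace X] {μ : Measure X} (q : ℝ) (m : ℕ)
    {φ : X → ℕ → ℝ} (hφ : ∀ j, Integrable (fun x => φ x j) μ) :
    Integrable (fun x => binomialMean q m (φ x)) μ ∧
      ∫ x, binomialMean q m (φ x) ∂μ = binomialMean q m fun j => ∫ x, φ x j ∂μ := by
  induction m generalizing φ with
  | zero => exact ⟨hφ 0, rfl⟩
  | succ m ih =>
    obtain ⟨i1, e1⟩ := ih hφ
    obtain ⟨i2, e2⟩ := ih (φ := fun x j => φ x (j + 1)) fun j => hφ (j + 1)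
    refine ⟨(i1.const_mul _).add (i2.const_mul _), ?_⟩
    simp only [binomialMean]
    rw [integral_add (i1.const_mul _) (i2.const_mul _), integral_const_mul, integral_const_mul,
      e1, e2]

end BinomialMean

/-! ### Mean defect of sums of independent rank one matrices. -/

section MeanDefect

set_option linter.unusedSectionVars false

open scoped ComplexOrder

variable {ι : Type*} [Fintype ι] [DecidableEq ι]

/-- The rank one matrix `w wᴴ`. -/
def rankOne (w : ι → ℂ) : Matrix ι ι ℂ := vecMulVec w (star w)

theorem posSemidef_rankOne (w : ι → ℂ) : (rankOne w).PosSemidef :=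
  posSemidef_vecMulVec_self_star w

theorem posSemidef_add_sum_rankOne {A : Matrix ι ι ℂ} (hA : A.PosSemidef) {m : ℕ}
    (W : Fin m → ι → ℂ) : (A + ∑ r, rankOne (W r)).PosSemidef :=
  hA.add (posSemidef_sum _ fun r _ => posSemidef_rankOne (W r))

/-- The mean of the resolvent defect of `A + ∑ r, w r (w r)ᴴ` for `m` independent vectors `w r`
with law `ν`. -/
def meanDefect (p : ℕ) (A : Matrix ι ι ℂ) (m : ℕ) (ν : Measure (ι → ℂ)) : ℝ :=
  ∫ W, resolventDefect p (A + ∑ r, rankOne (W r)) ∂(Measure.pi fun _ : Fin m => ν)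

@[fun_prop]
theorem continuous_rankOne : Continuous (rankOne : (ι → ℂ) → Matrix ι ι ℂ) := by
  unfold rankOne
  refine continuous_matrix fun i j => ?_
  simp only [vecMulVec_apply, Pi.star_apply]
  fun_prop

theorem continuous_resolventDefect_add_sum {A : Matrix ι ι ℂ} (hA : A.PosSemidef) (p m : ℕ) :
    Continuous fun W : Fin m → ι → ℂ => resolventDefect p (A + ∑ r, rankOne (W r)) := by
  refine continuous_resolventDefect_comp ?_ (fun W => posSemidef_add_sum_rankOne hA W) p
  fun_prop

theorem integrable_resolventDefect_add_sum {A : Matrix ι ι ℂ} (hA : A.PosSemidef) (p m : ℕ)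
    (μ : Measure (Fin m → ι → ℂ)) [IsFiniteMeasure μ] :
    Integrable (fun W => resolventDefect p (A + ∑ r, rankOne (W r))) μ :=
  integrable_of_continuous_bounded (continuous_resolventDefect_add_sum hA p m) (Fintype.card ι)
    fun W => abs_resolventDefect_le (posSemidef_add_sum_rankOne hA W) p

variable {ν ν' : Measure (ι → ℂ)} [IsProbabilityMeasure ν] [IsProbabilityMeasure ν']

theorem meanDefect_zero (p : ℕ) (A : Matrix ι ι ℂ) :
    meanDefect p A 0 ν = resolventDefect p A := by
  simp [meanDefect]

theorem abs_meanDefect_le {A : Matrix ι ι ℂ} (hA : A.PosSemidef) (p m : ℕ) :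
    |meanDefect p A m ν| ≤ Fintype.card ι := by
  exact abs_integral_le_of_forall_abs_le fun W =>
    abs_resolventDefect_le (posSemidef_add_sum_rankOne hA W) p

theorem measurable_meanDefect_add_rankOne {A : Matrix ι ι ℂ} (hA : A.PosSemidef) (p m : ℕ) :
    Measurable fun w => meanDefect p (A + rankOne w) m ν := by
  have h : Continuous fun z : (ι → ℂ) × (Fin m → ι → ℂ) =>
      resolventDefect p (A + rankOne z.1 + ∑ r, rankOne (z.2 r)) :=
    continuous_resolventDefect_comp (by fun_prop)
      (fun z => posSemidef_add_sum_rankOne (hA.add (posSemidef_rankOne _)) _) p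
  exact (h.stronglyMeasurable.integral_prod_right' (ν := Measure.pi fun _ => ν)).measurable

theorem integrable_meanDefect_add_rankOne {A : Matrix ι ι ℂ} (hA : A.PosSemidef) (p m : ℕ)
    (μ : Measure (ι → ℂ)) [IsFiniteMeasure μ] :
    Integrable (fun w => meanDefect p (A + rankOne w) m ν) μ :=
  Integrable.of_bound (measurable_meanDefect_add_rankOne hA p m).aestronglyMeasurable
    (Fintype.card ι) (Eventually.of_forall fun w =>
      abs_meanDefect_le (hA.add (posSemidef_rankOne w)) p m)

/-- Conditioning on one vector moves it into the base matrix. This is why the base matrix is a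
variable: the inductions on `m` that follow need it arbitrary. -/
theorem meanDefect_succ {A : Matrix ι ι ℂ} (hA : A.PosSemidef) (p m : ℕ) :
    meanDefect p A (m + 1) ν = ∫ w, meanDefect p (A + rankOne w) m ν ∂ν := by
  have h := measurePreserving_piFinSuccAbove (fun _ : Fin (m + 1) => ν) 0
  have hc : Continuous fun z : (ι → ℂ) × (Fin m → ι → ℂ) =>
      resolventDefect p (A + rankOne z.1 + ∑ r, rankOne (z.2 r)) :=
    continuous_resolventDefect_comp (by fun_prop)
      (fun z => posSemidef_add_sum_rankOne (hA.add (posSemidef_rankOne _)) _) p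
  have hInt : Integrable (fun z : (ι → ℂ) × (Fin m → ι → ℂ) =>
      resolventDefect p (A + rankOne z.1 + ∑ r, rankOne (z.2 r)))
      (ν.prod (Measure.pi fun _ => ν)) :=
    integrable_of_continuous_bounded hc (Fintype.card ι) fun z =>
      abs_resolventDefect_le (posSemidef_add_sum_rankOne (hA.add (posSemidef_rankOne _)) _) p
  rw [meanDefect]
  have h2 := h.integral_comp' (g := fun z : (ι → ℂ) × (Fin m → ι → ℂ) =>
      resolventDefect p (A + rankOne z.1 + ∑ r, rankOne (z.2 r)))
  rw [integral_prod _ hInt] at h2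
  simp only [meanDefect]
  rw [← h2]
  refine integral_congr_ae (Eventually.of_forall fun W => ?_)
  simp only [MeasurableEquiv.piFinSuccAbove_apply, Fin.insertNthEquiv_zero, Fin.sum_univ_succ, add_assoc]
  rfl

theorem abs_meanDefect_add_rankOne_sub_le {A : Matrix ι ι ℂ} (hA : A.PosSemidef) (p m : ℕ)
    (w : ι → ℂ) : |meanDefect p (A + rankOne w) m ν - meanDefect p A m ν| ≤ p := by
  rw [meanDefect, meanDefect, ← integral_sub
    (integrable_resolventDefect_add_sum (hA.add (posSemidef_rankOne w)) p m _)
    (integrable_resolventDefect_add_sum hA p m _)]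
  refine abs_integral_le_of_forall_abs_le fun W => ?_
  rw [add_right_comm]
  exact abs_resolventDefect_add_vecMulVec_sub_le (posSemidef_add_sum_rankOne hA W) w p

theorem abs_meanDefect_succ_sub_le {A : Matrix ι ι ℂ} (hA : A.PosSemidef) (p m : ℕ) :
    |meanDefect p A (m + 1) ν - meanDefect p A m ν| ≤ p := by
  have h1 : meanDefect p A (m + 1) ν - meanDefect p A m ν
      = ∫ w, (meanDefect p (A + rankOne w) m ν - meanDefect p A m ν) ∂ν := by
    rw [integral_sub (integrable_meanDefect_add_rankOne hA p m ν) (integrable_const _),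
      meanDefect_succ hA]
    simp
  rw [h1]
  exact abs_integral_le_of_forall_abs_le fun w => abs_meanDefect_add_rankOne_sub_le hA p m w

theorem abs_meanDefect_sub_le_mul_abs {A : Matrix ι ι ℂ} (hA : A.PosSemidef) (p i j : ℕ) :
    |meanDefect p A i ν - meanDefect p A j ν| ≤ p * |(i : ℝ) - j| := by
  wlog h : j ≤ i generalizing i j
  · rw [abs_sub_comm, abs_sub_comm (i : ℝ)]
    exact this j i (le_of_not_ge h)
  induction i, h using Nat.le_induction with
  | base => simp
  | succ i hi ih =>
    have h1 := abs_meanDefect_succ_sub_le (ν := ν) hA p i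
    have h2 := abs_sub_le (meanDefect p A (i + 1) ν) (meanDefect p A i ν) (meanDefect p A j ν)
    have h3 : (j : ℝ) ≤ i := by exact_mod_cast hi
    rw [abs_of_nonneg (a := (i : ℝ) - j) (by linarith)] at ih
    push_cast
    rw [abs_of_nonneg (a := (i : ℝ) + 1 - j) (by linarith)]
    linarith

/-- The mean defect depends continuously on the law in total variation. -/
theorem abs_meanDefect_sub_le_of_law {A : Matrix ι ι ℂ} (hA : A.PosSemidef) (p m : ℕ) {δ : ℝ}
    (h : ∀ φ : (ι → ℂ) → ℝ, Measurable φ → (∀ w, |φ w| ≤ 1) →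
      |∫ w, φ w ∂ν - ∫ w, φ w ∂ν'| ≤ δ) :
    |meanDefect p A m ν - meanDefect p A m ν'| ≤ m * (p * δ) := by
  induction m generalizing A with
  | zero => simp [meanDefect_zero]
  | succ m ih =>
    have h1 : |∫ w, meanDefect p (A + rankOne w) m ν ∂ν
        - ∫ w, meanDefect p (A + rankOne w) m ν ∂ν'| ≤ p * δ := by
      rcases Nat.eq_zero_or_pos p with rfl | hp
      · simp [meanDefect, resolventDefect]
      · have hp' : (0 : ℝ) < p := by exact_mod_cast hp
        -- Subtracting the value without `w` makes the test function bounded by `p` instead of by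
        -- the dimension, through rank one stability. Each replaced vector then costs `p * δ` only.
        have h2 := h (fun w => (p : ℝ)⁻¹ * (meanDefect p (A + rankOne w) m ν - meanDefect p A m ν))
          (((measurable_meanDefect_add_rankOne hA p m).sub_const _).const_mul _) (fun w => by
            rw [abs_mul, abs_of_pos (inv_pos.2 hp'), inv_mul_le_iff₀ hp', mul_one]
            exact abs_meanDefect_add_rankOne_sub_le hA p m w)
        rw [integral_const_mul, integral_const_mul,
          integral_sub (integrable_meanDefect_add_rankOne hA p m ν) (integrable_const _),
          integral_sub (integrable_meanDefect_add_rankOne hA p m ν') (integrable_const _),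
          integral_const, integral_const, probReal_univ, probReal_univ, ← mul_sub,
          sub_sub_sub_cancel_right, abs_mul, abs_of_pos (inv_pos.2 hp'), inv_mul_le_iff₀ hp'] at h2
        exact h2
    have h2 : |∫ w, meanDefect p (A + rankOne w) m ν ∂ν'
        - ∫ w, meanDefect p (A + rankOne w) m ν' ∂ν'| ≤ m * (p * δ) := by
      rw [← integral_sub (integrable_meanDefect_add_rankOne hA p m ν')
        (integrable_meanDefect_add_rankOne hA p m ν')]
      exact abs_integral_le_of_forall_abs_le fun w => ih (hA.add (posSemidef_rankOne w))
    rw [meanDefect_succ hA, meanDefect_succ hA]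
    refine (abs_sub_le _ _ _).trans ((add_le_add h1 h2).trans (le_of_eq ?_))
    push_cast
    ring

/-- Thinning: a vector that vanishes with probability `1 - q`. -/
theorem meanDefect_eq_binomialMean {A : Matrix ι ι ℂ} (hA : A.PosSemidef) (p m : ℕ) {q : ℝ}
    (h : ∀ φ : (ι → ℂ) → ℝ, Measurable φ → (∃ C, ∀ w, |φ w| ≤ C) →
      ∫ w, φ w ∂ν = (1 - q) * φ 0 + q * ∫ w, φ w ∂ν') :
    meanDefect p A m ν = binomialMean q m fun j => meanDefect p A j ν' := by
  induction m generalizing A with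
  | zero => simp [meanDefect_zero, binomialMean]
  | succ m ih =>
    rw [meanDefect_succ hA, h _ (measurable_meanDefect_add_rankOne hA p m)
      ⟨Fintype.card ι, fun w => abs_meanDefect_le (hA.add (posSemidef_rankOne w)) p m⟩]
    have h0 : A + rankOne (0 : ι → ℂ) = A := by
      simp [rankOne]
    rw [h0, ih hA]
    have h1 : ∀ w : ι → ℂ, meanDefect p (A + rankOne w) m ν
        = binomialMean q m fun j => meanDefect p (A + rankOne w) j ν' := fun w =>
      ih (hA.add (posSemidef_rankOne w))
    simp only [h1]
    rw [(integral_binomialMean q m fun j => integrable_meanDefect_add_rankOne hA p j ν').2,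
      binomialMean]
    simp only [meanDefect_succ hA]

theorem meanDefect_map {Ω : Type*} [MeasurableSpace Ω] {μ : Measure Ω} [IsProbabilityMeasure μ]
    {w : Ω → ι → ℂ} (hw : Measurable w) {A : Matrix ι ι ℂ} (hA : A.PosSemidef) (p m : ℕ) :
    meanDefect p A m (μ.map w)
      = ∫ x, resolventDefect p (A + ∑ r, rankOne (w (x r))) ∂(Measure.pi fun _ : Fin m => μ) := by
  have : IsProbabilityMeasure (μ.map w) := Measure.isProbabilityMeasure_map hw.aemeasurable
  rw [meanDefect, ← Measure.pi_map_pi fun _ => hw.aemeasurable, integral_map]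
  · exact (measurable_pi_lambda _ fun r => hw.comp (measurable_pi_apply r)).aemeasurable
  · exact (continuous_resolventDefect_add_sum hA p m).aestronglyMeasurable

end MeanDefect

/-! ### Mean of the square root of a sum over pairs of independent points. -/

section PairSums

variable {Ω : Type*} [MeasurableSpace Ω] {μ : Measure Ω} [IsProbabilityMeasure μ]

theorem integral_pi_pair {m : ℕ} {r r' : Fin m} (hr : r ≠ r') {H : Ω × Ω → ℝ}
    (hH : Measurable H) :
    ∫ x, H (x r, x r') ∂(Measure.pi fun _ : Fin m => μ) = ∫ z, H z ∂(μ.prod μ) := by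
  have h1 : iIndepFun (fun (i : Fin m) (x : Fin m → Ω) => x i) (Measure.pi fun _ => μ) :=
    iIndepFun_pi (X := fun _ ω => ω) fun _ => aemeasurable_id
  have h2 := (h1.indepFun hr).map_prod_eq_prod_map_map (measurable_pi_apply r).aemeasurable
    (measurable_pi_apply r').aemeasurable
  have h3 : ∀ i : Fin m, (Measure.pi fun _ : Fin m => μ).map (fun x => x i) = μ := fun i =>
    (measurePreserving_eval (fun _ : Fin m => μ) i).map_eq
  rw [h3, h3] at h2
  rw [← h2, integral_map ((measurable_pi_apply r).prodMk (measurable_pi_apply r')).aemeasurable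
    hH.aestronglyMeasurable]

/-- Jensen moves the square root outside the mean. As `H` vanishes on the diagonal, at most `m ^ 2`
pairs of independent points remain; with `H` a squared matrix entry, this bounds a mean Frobenius
norm. -/
theorem integral_sqrt_sum_pair_le {m : ℕ} {H : Ω × Ω → ℝ} (hH : Measurable H)
    (h0 : ∀ z, 0 ≤ H z) {C : ℝ} (hC : ∀ z, H z ≤ C) (hdiag : ∀ ω, H (ω, ω) = 0) :
    ∫ x, √(∑ r, ∑ r', H (x r, x r')) ∂(Measure.pi fun _ : Fin m => μ)
      ≤ m * √(∫ z, H z ∂(μ.prod μ)) := by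
  set P : Measure (Fin m → Ω) := Measure.pi fun _ => μ with hP
  have hmeas : ∀ r r' : Fin m, Measurable fun x : Fin m → Ω => H (x r, x r') := fun r r' =>
    hH.comp ((measurable_pi_apply r).prodMk (measurable_pi_apply r'))
  have hI : ∀ r r' : Fin m, Integrable (fun x : Fin m → Ω => H (x r, x r')) P := fun r r' =>
    Integrable.of_bound (hmeas r r').aestronglyMeasurable C
      (Eventually.of_forall fun x => by rw [Real.norm_eq_abs, abs_of_nonneg (h0 _)]; exact hC _)
  have hS : Integrable (fun x : Fin m → Ω => ∑ r, ∑ r', H (x r, x r')) P :=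
    integrable_finsetSum _ fun r _ => integrable_finsetSum _ fun r' _ => hI r r'
  have hS0 : ∀ x : Fin m → Ω, 0 ≤ ∑ r, ∑ r', H (x r, x r') := fun x =>
    Finset.sum_nonneg fun r _ => Finset.sum_nonneg fun r' _ => h0 _
  have hJ : 0 ≤ ∫ z, H z ∂(μ.prod μ) := integral_nonneg h0
  have hsq : Integrable (fun x : Fin m → Ω => √(∑ r, ∑ r', H (x r, x r'))) P := by
    refine Integrable.mono' (hS.add (integrable_const 1)) 
      hS.aestronglyMeasurable.aemeasurable.sqrt.aestronglyMeasurable (Eventually.of_forall fun x => ?_)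
    rw [Real.norm_eq_abs, abs_of_nonneg (Real.sqrt_nonneg _)]
    refine Real.sqrt_le_iff.2 ⟨add_nonneg (hS0 x) zero_le_one, ?_⟩
    simp only [Pi.add_apply]
    nlinarith [hS0 x]
  have h1 : (∫ x, √(∑ r, ∑ r', H (x r, x r')) ∂P) ^ 2 ≤ ∫ x, ∑ r, ∑ r', H (x r, x r') ∂P := by
    have h := ConvexOn.map_integral_le (μ := P) (s := Set.univ) (g := fun x : ℝ => x ^ 2)
      (f := fun x : Fin m → Ω => √(∑ r, ∑ r', H (x r, x r'))) (even_two.convexOn_pow)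
      (by fun_prop) isClosed_univ (by simp) hsq
      (by
        have : (fun x : ℝ => x ^ 2) ∘ (fun x : Fin m → Ω => √(∑ r, ∑ r', H (x r, x r')))
            = fun x => ∑ r, ∑ r', H (x r, x r') := by
          funext x
          exact Real.sq_sqrt (hS0 x)
        rw [this]
        exact hS)
    simpa only [Real.sq_sqrt (hS0 _)] using h
  have h2 : ∫ x, ∑ r, ∑ r', H (x r, x r') ∂P ≤ (m : ℝ) ^ 2 * ∫ z, H z ∂(μ.prod μ) := by
    rw [integral_finsetSum _ fun r _ => integrable_finsetSum _ fun r' _ => hI r r']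
    simp only [integral_finsetSum _ fun r' _ => hI _ r']
    have : ∀ r r' : Fin m, ∫ x, H (x r, x r') ∂P ≤ ∫ z, H z ∂(μ.prod μ) := by
      intro r r'
      by_cases hr : r = r'
      · subst hr
        simpa [hdiag] using hJ
      · exact (integral_pi_pair hr hH).le
    refine (Finset.sum_le_sum fun r _ => Finset.sum_le_sum fun r' _ => this r r').trans
      (le_of_eq ?_)
    simp
    ring
  refine le_of_sq_le_sq ((h1.trans h2).trans (le_of_eq ?_)) (by positivity)
  rw [mul_pow, Real.sq_sqrt hJ]

end PairSums

end

noncomputable section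

open scoped ComplexOrder

/-! ### Phase vectors, their Gram matrix and the defect of a sample. -/

section PhaseSample

/-- The vector of the phases `exp (-2 π i l ⬝ x)`, `l ∈ {0, …, n - 1}^d`. -/
def phaseVec (d n : ℕ) (x : Fin d → ℝ) : (Fin d → Fin n) → ℂ :=
  fun l => unitExp (-∑ j, ((l j : ℕ) : ℝ) * x j)

/-- The vector `√s • phaseVec d n x`. -/
def weightedVec (d n : ℕ) (s : ℝ) (x : Fin d → ℝ) : (Fin d → Fin n) → ℂ :=
  ((√s : ℝ) : ℂ) • phaseVec d n x

/-- The matrix whose columns are the phase vectors of the sampling points. -/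
def sampleMatrix (d n : ℕ) {κ : Type*} (x : κ → Fin d → ℝ) : Matrix (Fin d → Fin n) κ ℂ :=
  Matrix.of fun l q => phaseVec d n (x q) l

@[fun_prop]
theorem continuous_phaseVec (d n : ℕ) : Continuous (phaseVec d n) :=
  continuous_pi fun l => continuous_unitExp.comp (by fun_prop)

@[fun_prop]
theorem continuous_weightedVec (d n : ℕ) (s : ℝ) : Continuous (weightedVec d n s) := by
  unfold weightedVec
  fun_prop

theorem measurable_weightedVec (d n : ℕ) (s : ℝ) : Measurable (weightedVec d n s) :=
  (continuous_weightedVec d n s).measurable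

theorem norm_phaseVec (d n : ℕ) (x : Fin d → ℝ) (l : Fin d → Fin n) : ‖phaseVec d n x l‖ = 1 :=
  norm_unitExp _

theorem sum_star_phaseVec_mul (d n : ℕ) (x y : Fin d → ℝ) :
    ∑ l, star (phaseVec d n x l) * phaseVec d n y l = cubeKernel d n (x - y) := by
  rw [cubeKernel_eq_sum]
  refine Finset.sum_congr rfl fun l _ => ?_
  rw [phaseVec, phaseVec, star_unitExp, ← unitExp_add, neg_neg, ← sub_eq_add_neg,
    ← Finset.sum_sub_distrib]
  congr 1
  refine Finset.sum_congr rfl fun j _ => ?_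
  rw [Pi.sub_apply]
  ring

theorem conjTranspose_sampleMatrix_mul (d n : ℕ) {κ : Type*} (x : κ → Fin d → ℝ) (r r' : κ) :
    ((sampleMatrix d n x)ᴴ * sampleMatrix d n x) r r' = cubeKernel d n (x r - x r') := by
  rw [← sum_star_phaseVec_mul]
  rfl

theorem sum_rankOne_weightedVec (d n : ℕ) {s : ℝ} (hs : 0 ≤ s) {κ : Type*} [Fintype κ]
    (x : κ → Fin d → ℝ) :
    ∑ r, rankOne (weightedVec d n s (x r))
      = (s : ℂ) • (sampleMatrix d n x * (sampleMatrix d n x)ᴴ) := by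
  ext l l'
  rw [Matrix.sum_apply, Matrix.smul_apply, mul_apply, Finset.smul_sum]
  refine Finset.sum_congr rfl fun r _ => ?_
  simp only [rankOne, weightedVec, sampleMatrix, vecMulVec_apply, Pi.smul_apply, Pi.star_apply,
    conjTranspose_apply, of_apply, smul_eq_mul, star_mul', Complex.star_def, Complex.conj_ofReal]
  have h : (((√s : ℝ) : ℂ)) * ((√s : ℝ) : ℂ) = (s : ℂ) := by
    rw [← Complex.ofReal_mul, Real.mul_self_sqrt hs]
  rw [← h]
  ring

/-- The resolvent defect of `s • ∑ r, v (x r) (v (x r))ᴴ`, `v` the phase vector. -/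
def phaseDefect (p d n : ℕ) (s : ℝ) {m : ℕ} (x : Fin m → Fin d → ℝ) : ℝ :=
  resolventDefect p ((s : ℂ) • (sampleMatrix d n x * (sampleMatrix d n x)ᴴ))

theorem phaseDefect_eq_gram (p d n : ℕ) {s : ℝ} (hs : 0 ≤ s) {m : ℕ} (x : Fin m → Fin d → ℝ) :
    phaseDefect p d n s x
      = resolventDefect p ((s : ℂ) • ((sampleMatrix d n x)ᴴ * sampleMatrix d n x)) :=
  resolventDefect_smul_self_mul_conjTranspose _ hs p

theorem posSemidef_smul_gram (d n : ℕ) {s : ℝ} (hs : 0 ≤ s) {m : ℕ} (x : Fin m → Fin d → ℝ) :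
    ((s : ℂ) • ((sampleMatrix d n x)ᴴ * sampleMatrix d n x)).PosSemidef :=
  (posSemidef_conjTranspose_mul_self _).smul (by exact_mod_cast hs)

theorem posSemidef_smul_sampleMatrix (d n : ℕ) {s : ℝ} (hs : 0 ≤ s) {m : ℕ}
    (x : Fin m → Fin d → ℝ) :
    ((s : ℂ) • (sampleMatrix d n x * (sampleMatrix d n x)ᴴ)).PosSemidef :=
  (posSemidef_self_mul_conjTranspose _).smul (by exact_mod_cast hs)

theorem phaseDefect_eq_sum_rankOne (p d n : ℕ) {s : ℝ} (hs : 0 ≤ s) {m : ℕ}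
    (x : Fin m → Fin d → ℝ) :
    phaseDefect p d n s x
      = resolventDefect p (0 + ∑ r, rankOne (weightedVec d n s (x r))) := by
  rw [sum_rankOne_weightedVec d n hs, zero_add, phaseDefect]

theorem continuous_phaseDefect (p d n : ℕ) {s : ℝ} (hs : 0 ≤ s) (m : ℕ) :
    Continuous fun x : Fin m → Fin d → ℝ => phaseDefect p d n s x := by
  simp only [phaseDefect_eq_sum_rankOne p d n hs]
  exact (continuous_resolventDefect_add_sum PosSemidef.zero p m).comp
    (continuous_pi fun r => (continuous_weightedVec d n s).comp (continuous_apply r))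

theorem abs_phaseDefect_le (p d n : ℕ) {s : ℝ} (hs : 0 ≤ s) {m : ℕ} (x : Fin m → Fin d → ℝ) :
    |phaseDefect p d n s x| ≤ (n : ℝ) ^ d :=
  (abs_resolventDefect_le (posSemidef_smul_sampleMatrix d n hs x) p).trans (by simp)

theorem integral_phaseDefect_eq_meanDefect (p d n : ℕ) {s : ℝ} (hs : 0 ≤ s) (m : ℕ)
    (μ : Measure (Fin d → ℝ)) [IsProbabilityMeasure μ] :
    ∫ x, phaseDefect p d n s x ∂(Measure.pi fun _ : Fin m => μ)
      = meanDefect p 0 m (μ.map (weightedVec d n s)) := by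
  rw [meanDefect_map (measurable_weightedVec d n s) PosSemidef.zero]
  simp only [phaseDefect_eq_sum_rankOne p d n hs]

/-- The mean of `phaseDefect` for `N` independent uniform sampling points. -/
def uniformDefect (p d n N : ℕ) (s : ℝ) : ℝ :=
  ∫ x, phaseDefect p d n s x ∂(Measure.pi fun _ : Fin N => cubeLaw d)

instance isProbabilityMeasure_map_weightedVec (d n : ℕ) (s : ℝ) (μ : Measure (Fin d → ℝ))
    [IsProbabilityMeasure μ] : IsProbabilityMeasure (μ.map (weightedVec d n s)) :=
  Measure.isProbabilityMeasure_map (measurable_weightedVec d n s).aemeasurable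

theorem integrable_phaseDefect (p d n : ℕ) {s : ℝ} (hs : 0 ≤ s) (m : ℕ)
    (μ : Measure (Fin m → Fin d → ℝ)) [IsFiniteMeasure μ] :
    Integrable (fun x => phaseDefect p d n s x) μ :=
  integrable_of_continuous_bounded (continuous_phaseDefect p d n hs m) ((n : ℝ) ^ d)
    fun x => abs_phaseDefect_le p d n hs x

theorem abs_uniformDefect_sub_le_card (p d n : ℕ) {s : ℝ} (hs : 0 ≤ s) (N N' : ℕ) :
    |uniformDefect p d n N s - uniformDefect p d n N' s| ≤ p * |(N : ℝ) - N'| := by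
  rw [uniformDefect, uniformDefect, integral_phaseDefect_eq_meanDefect p d n hs,
    integral_phaseDefect_eq_meanDefect p d n hs]
  exact abs_meanDefect_sub_le_mul_abs PosSemidef.zero p N N'

/-- All entries of the sample matrix have modulus one, so the sum of their squares is `n ^ d * N`.
-/
theorem abs_uniformDefect_sub_le_weight (p d n N : ℕ) {s t : ℝ} (hs : 0 ≤ s) (ht : 0 ≤ t) :
    |uniformDefect p d n N s - uniformDefect p d n N t| ≤ p * (|s - t| * (n ^ d * N)) := by
  rw [uniformDefect, uniformDefect, ← integral_sub (integrable_phaseDefect p d n hs N _)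
    (integrable_phaseDefect p d n ht N _)]
  refine abs_integral_le_of_forall_abs_le fun x => ?_
  refine (abs_resolventDefect_smul_sub_le (sampleMatrix d n x) hs ht p).trans (le_of_eq ?_)
  simp [sampleMatrix, norm_phaseVec]

theorem abs_resolventDefect_add_sum_rankOne_sub_le {ι κ : Type*} [Fintype ι] [DecidableEq ι]
    {A : Matrix ι ι ℂ} (hA : A.PosSemidef) (t : Finset κ) (w : κ → ι → ℂ) (p : ℕ) :
    |resolventDefect p (A + ∑ r ∈ t, rankOne (w r)) - resolventDefect p A| ≤ p * t.card := by
  classical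
  induction t using Finset.induction_on with
  | empty => simp
  | insert a t ha ih =>
    have h1 := abs_resolventDefect_add_vecMulVec_sub_le
      (hA.add (posSemidef_sum t fun r _ => posSemidef_rankOne (w r))) (w a) p
    rw [Finset.sum_insert ha, Finset.card_insert_of_notMem ha, add_comm (rankOne _), ← add_assoc]
    refine (abs_sub_le _ _ _).trans ((add_le_add h1 ih).trans (le_of_eq ?_))
    push_cast
    ring

/-- The expansion of the Gram matrix by rows instead of sampling points: removing a frequency is a
rank one perturbation, which allows rounding `n` to a multiple of the number of cells per side. -/
theorem smul_gram_eq_sum_rankOne (d n : ℕ) {s : ℝ} (hs : 0 ≤ s) {m : ℕ} (x : Fin m → Fin d → ℝ) :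
    (s : ℂ) • ((sampleMatrix d n x)ᴴ * sampleMatrix d n x)
      = ∑ l : Fin d → Fin n, rankOne fun r => ((√s : ℝ) : ℂ) * star (phaseVec d n (x r) l) := by
  ext r r'
  rw [Matrix.sum_apply, Matrix.smul_apply, mul_apply, Finset.smul_sum]
  refine Finset.sum_congr rfl fun l _ => ?_
  simp only [rankOne, sampleMatrix, vecMulVec_apply, Pi.star_apply,
    conjTranspose_apply, of_apply, smul_eq_mul, star_mul', star_star]
  rw [Complex.star_def, Complex.conj_ofReal]
  have h : (((√s : ℝ) : ℂ)) * ((√s : ℝ) : ℂ) = (s : ℂ) := by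
    rw [← Complex.ofReal_mul, Real.mul_self_sqrt hs]
  rw [← h]
  ring

/-- Dropping rows. -/
theorem abs_phaseDefect_sub_le_rows (p d : ℕ) {n n' : ℕ} (hn : n' ≤ n) {s : ℝ} (hs : 0 ≤ s)
    {m : ℕ} (x : Fin m → Fin d → ℝ) :
    |phaseDefect p d n s x - phaseDefect p d n' s x| ≤ p * ((n : ℝ) ^ d - (n' : ℝ) ^ d) := by
  rw [phaseDefect_eq_gram p d n hs, phaseDefect_eq_gram p d n' hs]
  have hA := posSemidef_smul_gram d n' hs x
  set A := (s : ℂ) • ((sampleMatrix d n' x)ᴴ * sampleMatrix d n' x) with hAdef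
  let e : (Fin d → Fin n') ↪ (Fin d → Fin n) :=
    ⟨fun l j => Fin.castLE hn (l j), fun l l' h => funext fun j =>
      Fin.castLE_injective hn (congrFun h j)⟩
  set w : (Fin d → Fin n) → Fin m → ℂ := fun l r =>
    ((√s : ℝ) : ℂ) * star (phaseVec d n (x r) l) with hw
  have h1 : (s : ℂ) • ((sampleMatrix d n x)ᴴ * sampleMatrix d n x)
      = A + ∑ l ∈ (Finset.univ.map e)ᶜ, rankOne (w l) := by
    rw [smul_gram_eq_sum_rankOne d n hs, ← Finset.sum_add_sum_compl (Finset.univ.map e),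
      Finset.sum_map, hAdef, smul_gram_eq_sum_rankOne d n' hs]
    rfl
  rw [h1]
  refine (abs_resolventDefect_add_sum_rankOne_sub_le hA _ w p).trans (le_of_eq ?_)
  have h2 : n' ^ d ≤ n ^ d := Nat.pow_le_pow_left hn d
  rw [Finset.card_compl, Finset.card_map]
  simp [Nat.cast_sub h2]

end PhaseSample

/-! ### Sampling from cells with prescribed weights. -/

section Cells

variable {d L : ℕ}

/-- The law of a random cell index, drawn with weights `q`, and an independent uniform point. -/
def cellLaw (q : (Fin d → Fin L) → ℝ) : Measure ((Fin d → Fin L) × (Fin d → ℝ)) :=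
  ∑ i, ENNReal.ofReal (q i) • (cubeLaw d).map (Prod.mk i)

theorem isProbabilityMeasure_cellLaw {q : (Fin d → Fin L) → ℝ} (hq : ∀ i, 0 ≤ q i)
    (hq1 : ∑ i, q i = 1) : IsProbabilityMeasure (cellLaw q) := by
  constructor
  rw [cellLaw, Measure.finsetSum_apply]
  have h : ∀ i : Fin d → Fin L, (ENNReal.ofReal (q i) • (cubeLaw d).map (Prod.mk i)) Set.univ
      = ENNReal.ofReal (q i) := fun i => by
    rw [Measure.smul_apply, Measure.map_apply measurable_prodMk_left MeasurableSet.univ]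
    simp
  rw [Finset.sum_congr rfl fun i _ => h i, ← ENNReal.ofReal_sum_of_nonneg fun i _ => hq i, hq1,
    ENNReal.ofReal_one]

theorem integral_cellLaw {q : (Fin d → Fin L) → ℝ} (hq : ∀ i, 0 ≤ q i)
    {φ : (Fin d → Fin L) × (Fin d → ℝ) → ℝ} (hφ : Measurable φ) {C : ℝ} (hC : ∀ z, |φ z| ≤ C) :
    ∫ z, φ z ∂cellLaw q = ∑ i, q i * ∫ u, φ (i, u) ∂cubeLaw d := by
  rw [cellLaw, integral_finsetSum_measure]
  · refine Finset.sum_congr rfl fun i _ => ?_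
    rw [integral_smul_measure, integral_map measurable_prodMk_left.aemeasurable
      hφ.aestronglyMeasurable, ENNReal.toReal_ofReal (hq i), smul_eq_mul]
  · intro i _
    have : IsProbabilityMeasure ((cubeLaw d).map (Prod.mk i)) :=
      Measure.isProbabilityMeasure_map measurable_prodMk_left.aemeasurable
    refine Integrable.smul_measure (Integrable.of_bound hφ.aestronglyMeasurable C
      (Eventually.of_forall hC)) (by finiteness)

/-- The point of the hypercube with given cell and position in the cell. -/
def cellPoint (z : (Fin d → Fin L) × (Fin d → ℝ)) : Fin d → ℝ := cellMap L z.1 z.2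

theorem measurable_cellPoint : Measurable (cellPoint (d := d) (L := L)) :=
  measurable_from_prod_countable_right fun i => (continuous_cellMap i).measurable

end Cells

end

noncomputable section

open scoped ComplexOrder

/-! ### Splitting the defect into cells and rescaling each of them. -/

section CellComparison

variable {d L : ℕ}

/-- The relative error, at scale `k`, of replacing the kernel by its localization to a cell. -/
def spreadBound (d k : ℕ) : ℝ := 4 * Real.pi * (d * (fejerSpread k / k))

theorem spreadBound_nonneg (d k : ℕ) : 0 ≤ spreadBound d k := by
  have := fejerSpread_nonneg k
  have := Real.pi_pos
  unfold spreadBound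
  positivity

theorem tendsto_spreadBound (d : ℕ) : Tendsto (spreadBound d) atTop (𝓝 0) := by
  have h := (tendsto_fejerSpread_div.const_mul (d : ℝ)).const_mul (4 * Real.pi)
  simp only [mul_zero] at h
  exact h

theorem measurable_weightedVec_cellMap (n : ℕ) (s : ℝ) (i : Fin d → Fin L) :
    Measurable fun u => weightedVec d n s (cellMap L i u) :=
  (measurable_weightedVec d n s).comp (continuous_cellMap i).measurable

theorem phaseAverage_zero {L : ℕ} (hL : 0 < L) : phaseAverage L 0 = 1 := by
  have h := norm_phaseAverage_sub_one_le hL 0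
  rw [abs_zero, mul_zero] at h
  exact sub_eq_zero.1 (norm_le_zero_iff.1 h)

/-- Uniform points in one cell, at scale `k * L`, against uniform points in the hypercube, at
scale `k`. -/
theorem abs_meanDefect_cell_sub_le (hL : 0 < L) (i : Fin d → Fin L) (p k N : ℕ) {s : ℝ}
    (hs : 0 ≤ s) :
    |meanDefect p 0 N ((cubeLaw d).map fun u => weightedVec d (k * L) s (cellMap L i u))
        - uniformDefect p d k N (s * (L : ℝ) ^ d)|
      ≤ p * (√N * (N * (s * (L : ℝ) ^ d * √((k : ℝ) ^ d * spreadBound d k)))) := by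
  have hsL : 0 ≤ s * (L : ℝ) ^ d := by positivity
  have hc1 : Continuous fun x : Fin N → Fin d → ℝ =>
      phaseDefect p d (k * L) s (fun r => cellMap L i (x r)) :=
    (continuous_phaseDefect p d (k * L) hs N).comp
      (continuous_pi fun r => (continuous_cellMap i).comp (continuous_apply r))
  rw [meanDefect_map (measurable_weightedVec_cellMap (k * L) s i) PosSemidef.zero]
  have e1 : ∀ x : Fin N → Fin d → ℝ,
      resolventDefect p (0 + ∑ r, rankOne (weightedVec d (k * L) s (cellMap L i (x r))))
        = phaseDefect p d (k * L) s (fun r => cellMap L i (x r)) := fun x =>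
    (phaseDefect_eq_sum_rankOne p d (k * L) hs _).symm
  simp only [e1]
  have hi1 : Integrable (fun x : Fin N → Fin d → ℝ =>
      phaseDefect p d (k * L) s (fun r => cellMap L i (x r))) (Measure.pi fun _ => cubeLaw d) :=
    integrable_of_continuous_bounded hc1 _ fun x => abs_phaseDefect_le p d (k * L) hs _
  rw [uniformDefect, ← integral_sub hi1 (integrable_phaseDefect p d k hsL N _)]
  -- The squared entrywise difference of the two Gram matrices, computed by self-similarity. It
  -- vanishes on the diagonal because the phase average at zero is `1`.
  set F : (Fin d → ℝ) × (Fin d → ℝ) → ℝ := fun z =>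
    (s * (L : ℝ) ^ d) ^ 2 * ‖cubeKernel d k (z.2 - z.1) *
      (∏ j, phaseAverage L ((z.2 - z.1) j) - 1)‖ ^ 2 with hF
  have hFc : Continuous F := by
    have h2 : Continuous fun z : (Fin d → ℝ) × (Fin d → ℝ) =>
        ∏ j, phaseAverage L ((z.2 - z.1) j) :=
      (continuous_prod_phaseAverage d L).comp (by fun_prop)
    have h3 : Continuous fun z : (Fin d → ℝ) × (Fin d → ℝ) => cubeKernel d k (z.2 - z.1) := by
      fun_prop
    exact continuous_const.mul ((h3.mul (h2.sub continuous_const)).norm.pow 2)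
  have hF0 : ∀ z, 0 ≤ F z := fun z => by positivity
  have hFC : ∀ z, F z ≤ (s * (L : ℝ) ^ d) ^ 2 * ((k : ℝ) ^ d * 2) ^ 2 := fun z => by
    refine mul_le_mul_of_nonneg_left (pow_le_pow_left₀ (norm_nonneg _) ?_ 2) (by positivity)
    rw [norm_mul]
    refine mul_le_mul (norm_cubeKernel_le _ _ _) ?_ (norm_nonneg _) (by positivity)
    refine (norm_sub_le _ _).trans ?_
    have := norm_prod_phaseAverage_le L (z.2 - z.1)
    rw [norm_one]
    linarith
  have hFd : ∀ u, F (u, u) = 0 := fun u => by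
    simp [hF, phaseAverage_zero hL]
  have hpt : ∀ x : Fin N → Fin d → ℝ,
      |phaseDefect p d (k * L) s (fun r => cellMap L i (x r))
          - phaseDefect p d k (s * (L : ℝ) ^ d) x|
        ≤ p * √N * √(∑ r, ∑ r', F (x r, x r')) := by
    intro x
    rw [phaseDefect_eq_gram p d (k * L) hs, phaseDefect_eq_gram p d k hsL, mul_assoc]
    refine (abs_resolventDefect_sub_le_frobenius (posSemidef_smul_gram d (k * L) hs _)
      (posSemidef_smul_gram d k hsL x) p).trans (le_of_eq ?_)
    rw [Fintype.card_fin, Finset.sum_comm]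
    congr 3
    refine Finset.sum_congr rfl fun r' _ => Finset.sum_congr rfl fun r _ => ?_
    rw [Matrix.smul_apply, Matrix.smul_apply, conjTranspose_sampleMatrix_mul,
      conjTranspose_sampleMatrix_mul, cubeKernel_cellMap_sub hL, hF]
    simp only [smul_eq_mul, Complex.ofReal_mul, Complex.ofReal_pow, Complex.ofReal_natCast]
    have : (s : ℂ) * ((L : ℂ) ^ d * (cubeKernel d k (x r - x r') *
        ∏ j, phaseAverage L ((x r - x r') j))) - (s : ℂ) * (L : ℂ) ^ d * cubeKernel d k (x r - x r')
        = ((s * (L : ℝ) ^ d : ℝ) : ℂ) * (cubeKernel d k (x r - x r') *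
          (∏ j, phaseAverage L ((x r - x r') j) - 1)) := by
      push_cast
      ring
    rw [this, norm_mul, mul_pow, Complex.norm_real, Real.norm_eq_abs, sq_abs]
  have hFm : Measurable F := hFc.measurable
  have hI := integral_sqrt_sum_pair_le (μ := cubeLaw d) (m := N) hFm hF0 hFC hFd
  have hFint : ∫ z, F z ∂((cubeLaw d).prod (cubeLaw d))
      ≤ (s * (L : ℝ) ^ d) ^ 2 * ((k : ℝ) ^ d * spreadBound d k) := by
    rw [integral_prod _ (integrable_cubeLaw_prod_of_continuous hFc)]
    simp only [hF, integral_const_mul]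
    exact mul_le_mul_of_nonneg_left
      (integral_norm_cubeKernel_sq_mul_phaseAverage_sub_one_le hL) (by positivity)
  have hsqm : Integrable (fun x : Fin N → Fin d → ℝ => p * √N * √(∑ r, ∑ r', F (x r, x r')))
      (Measure.pi fun _ => cubeLaw d) := by
    refine integrable_of_continuous_bounded ?_ (p * √N *
      √(∑ r : Fin N, ∑ r' : Fin N, (s * (L : ℝ) ^ d) ^ 2 * ((k : ℝ) ^ d * 2) ^ 2)) fun x => ?_
    · refine continuous_const.mul (Real.continuous_sqrt.comp ?_)
      exact continuous_finsetSum _ fun r _ => continuous_finsetSum _ fun r' _ =>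
        hFc.comp (by fun_prop)
    · rw [Real.norm_eq_abs, abs_of_nonneg (by positivity)]
      exact mul_le_mul_of_nonneg_left (Real.sqrt_le_sqrt (Finset.sum_le_sum fun r _ =>
        Finset.sum_le_sum fun r' _ => hFC _)) (by positivity)
  refine (abs_integral_le_integral_abs).trans ?_
  refine (integral_mono_of_nonneg (Eventually.of_forall fun x => abs_nonneg _) hsqm
    (Eventually.of_forall hpt)).trans ?_
  rw [integral_const_mul, mul_assoc]
  refine mul_le_mul_of_nonneg_left (mul_le_mul_of_nonneg_left (hI.trans ?_) (by positivity))
    (by positivity)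
  refine mul_le_mul_of_nonneg_left ?_ (by positivity)
  refine (Real.sqrt_le_sqrt hFint).trans (le_of_eq ?_)
  rw [Real.sqrt_mul (by positivity), Real.sqrt_sq hsL]

/-- The weighted phase vector of a point in the cell `c`, and zero for points in other cells. -/
def cellVec (n : ℕ) (s : ℝ) (c : Fin d → Fin L) (z : (Fin d → Fin L) × (Fin d → ℝ)) :
    (Fin d → Fin n) → ℂ :=
  if z.1 = c then weightedVec d n s (cellPoint z) else 0

theorem measurable_cellVec (n : ℕ) (s : ℝ) (c : Fin d → Fin L) : Measurable (cellVec n s c) :=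
  Measurable.ite (measurable_fst (measurableSet_singleton c))
    ((measurable_weightedVec d n s).comp measurable_cellPoint) measurable_const

/-- The defect of the pinched Gram matrix is the sum of the defects of the cells. -/
theorem sum_resolventDefect_cellVec (p n m : ℕ) {s : ℝ} (hs : 0 ≤ s)
    (ω : Fin m → (Fin d → Fin L) × (Fin d → ℝ)) :
    ∃ G : Matrix (Fin m) (Fin m) ℂ, G.PosSemidef ∧
      (∀ r r', G r r' = if (ω r).1 = (ω r').1 then
        (s : ℂ) * cubeKernel d n (cellPoint (ω r) - cellPoint (ω r')) else 0) ∧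
      ∑ c, resolventDefect p (0 + ∑ r, rankOne (cellVec n s c (ω r))) = resolventDefect p G := by
  -- The cell becomes an additional row index. Then `W * Wᴴ` is block diagonal, with one block per
  -- cell, while `Wᴴ * W` is the Gram matrix with the entries between different cells erased; both
  -- have the same defect.
  set W : Matrix ((Fin d → Fin n) × (Fin d → Fin L)) (Fin m) ℂ :=
    Matrix.of fun a r => cellVec n s a.2 (ω r) a.1 with hW
  have h1 : W * Wᴴ = blockDiagonal fun c => 0 + ∑ r, rankOne (cellVec n s c (ω r)) := by
    ext ⟨l, c⟩ ⟨l', c'⟩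
    rw [blockDiagonal_apply, mul_apply]
    simp only [hW, conjTranspose_apply, of_apply, zero_add]
    split_ifs with h
    · subst h
      rw [Matrix.sum_apply]
      rfl
    · refine Finset.sum_eq_zero fun r _ => ?_
      simp only [cellVec]
      split_ifs with h2 h3
      · exact absurd (h2.symm.trans h3) h
      all_goals simp
  refine ⟨Wᴴ * W, posSemidef_conjTranspose_mul_self W, fun r r' => ?_, ?_⟩
  · rw [mul_apply, Fintype.sum_prod_type, Finset.sum_comm]
    simp only [hW, conjTranspose_apply, of_apply, cellVec]
    have hss : (((√s : ℝ) : ℂ)) * ((√s : ℝ) : ℂ) = (s : ℂ) := by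
      rw [← Complex.ofReal_mul, Real.mul_self_sqrt hs]
    rw [Finset.sum_eq_single (ω r).1]
    · simp only [if_true, eq_comm (a := (ω r').1)]
      split_ifs with h2
      · rw [← sum_star_phaseVec_mul, Finset.mul_sum]
        refine Finset.sum_congr rfl fun l _ => ?_
        simp only [weightedVec, Pi.smul_apply, smul_eq_mul, star_mul', Complex.star_def,
          Complex.conj_ofReal]
        rw [← hss]
        ring
      · simp
    · intro c _ hc
      refine Finset.sum_eq_zero fun l _ => ?_
      rw [if_neg (fun h => hc h.symm)]
      simp
    · simp
  · rw [← resolventDefect_self_mul_conjTranspose, h1, resolventDefect_blockDiagonal]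
    exact fun c => posSemidef_add_sum_rankOne PosSemidef.zero _

/-- The sampling density is bounded by `R`, so the mean is at most `R ^ 2` times the one for uniform
points, already controlled by the kernel mass across cells. -/
theorem integral_offDiag_le (hL : 0 < L) {q : (Fin d → Fin L) → ℝ} (hq : ∀ i, 0 ≤ q i) {R : ℝ}
    (hR : ∀ i, q i ≤ R / (L : ℝ) ^ d) (k : ℕ) (hq1 : ∑ i, q i = 1) :
    ∫ z, (if z.1.1 = z.2.1 then 0 else
        ‖cubeKernel d (k * L) (cellPoint z.2 - cellPoint z.1)‖ ^ 2)
          ∂((cellLaw q).prod (cellLaw q))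
      ≤ R ^ 2 * (((k * L : ℕ) : ℝ) ^ d * spreadBound d k) := by
  have := isProbabilityMeasure_cellLaw hq hq1
  have hLd : (0 : ℝ) < (L : ℝ) ^ d := pow_pos (by exact_mod_cast hL) d
  set C : ℝ := (((k * L : ℕ) : ℝ) ^ d) ^ 2 with hC
  have hC0 : 0 ≤ C := by positivity
  set H : ((Fin d → Fin L) × (Fin d → ℝ)) × ((Fin d → Fin L) × (Fin d → ℝ)) → ℝ := fun z =>
    if z.1.1 = z.2.1 then 0 else
      ‖cubeKernel d (k * L) (cellPoint z.2 - cellPoint z.1)‖ ^ 2 with hH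
  have hHm : Measurable H := by
    refine Measurable.ite (measurableSet_eq_fun (by fun_prop) (by fun_prop)) measurable_const ?_
    exact ((continuous_cubeKernel d (k * L)).measurable.comp
      ((measurable_cellPoint.comp measurable_snd).sub
        (measurable_cellPoint.comp measurable_fst))).norm.pow_const 2
  have hH0 : ∀ z, 0 ≤ H z := fun z => by
    simp only [hH]; split_ifs <;> positivity
  have hHC : ∀ z, |H z| ≤ C := fun z => by
    rw [abs_of_nonneg (hH0 z)]
    simp only [hH]
    split_ifs
    · exact hC0
    · exact norm_cubeKernel_sq_le _ _ _
  have hInt : Integrable H ((cellLaw q).prod (cellLaw q)) :=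
    Integrable.of_bound hHm.aestronglyMeasurable C (Eventually.of_forall hHC)
  rw [integral_prod _ hInt]
  have hin : ∀ z, ∫ y, H (z, y) ∂cellLaw q = ∑ i, q i * ∫ u, H (z, (i, u)) ∂cubeLaw d := fun z =>
    integral_cellLaw hq (hHm.comp measurable_prodMk_left) (fun y => hHC (z, y))
  have hinm : Measurable fun z => ∫ y, H (z, y) ∂cellLaw q :=
    (hHm.stronglyMeasurable.integral_prod_right' (ν := cellLaw q)).measurable
  rw [integral_cellLaw hq hinm (fun z => abs_integral_le_of_forall_abs_le fun y => hHC (z, y))]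
  simp only [hin]
  have hmi : ∀ (i i' : Fin d → Fin L), Integrable (fun v => ∫ u, H ((i', v), (i, u)) ∂cubeLaw d)
      (cubeLaw d) := fun i i' => by
    have hm : Measurable fun z : (Fin d → ℝ) × (Fin d → ℝ) => H ((i', z.1), (i, z.2)) :=
      hHm.comp (by fun_prop)
    exact (Integrable.of_bound (μ := (cubeLaw d).prod (cubeLaw d)) hm.aestronglyMeasurable C
      (Eventually.of_forall fun z => hHC _)).integral_prod_left
  have e1 : ∀ i', ∫ v, ∑ i, q i * ∫ u, H ((i', v), (i, u)) ∂cubeLaw d ∂cubeLaw d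
      = ∑ i, q i * ∫ v, ∫ u, H ((i', v), (i, u)) ∂cubeLaw d ∂cubeLaw d := by
    intro i'
    rw [integral_finsetSum _ fun i _ => (hmi i i').const_mul _]
    simp only [integral_const_mul]
  simp only [e1, Finset.mul_sum]
  set J : (Fin d → Fin L) → (Fin d → Fin L) → ℝ := fun i' i => if i = i' then 0 else
    ∫ s, ∫ u, ‖cubeKernel d (k * L) (cellMap L i u - cellMap L i' s)‖ ^ 2 ∂cubeLaw d ∂cubeLaw d
    with hJ
  have e2 : ∀ i' i, ∫ v, ∫ u, H ((i', v), (i, u)) ∂cubeLaw d ∂cubeLaw d = J i' i := by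
    intro i' i
    simp only [hH, hJ, cellPoint]
    by_cases h : i = i'
    · simp [h]
    · simp [h, Ne.symm h]
  have hJ0 : ∀ i' i, 0 ≤ J i' i := fun i' i => by
    simp only [hJ]
    split_ifs
    · exact le_rfl
    · exact integral_nonneg fun s => integral_nonneg fun u => by positivity
  have e3 : ∀ i' i, q i' * (q i * J i' i) ≤ (R / (L : ℝ) ^ d) ^ 2 * J i' i := by
    intro i' i
    rw [← mul_assoc, sq]
    exact mul_le_mul_of_nonneg_right (mul_le_mul (hR i') (hR i) (hq i)
      ((hq i').trans (hR i'))) (hJ0 i' i)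
  simp only [e2]
  refine (Finset.sum_le_sum fun i' _ => Finset.sum_le_sum fun i _ => e3 i' i).trans ?_
  simp only [← Finset.mul_sum]
  refine (mul_le_mul_of_nonneg_left (sum_integral_norm_cubeKernel_sq_offDiag_le (k := k) hL)
    (by positivity)).trans (le_of_eq ?_)
  rw [spreadBound]
  field_simp

/-- Locality: up to a small error, the defect is the sum of the contributions of the cells. -/
theorem abs_integral_phaseDefect_sub_sum_cells_le (hL : 0 < L) {q : (Fin d → Fin L) → ℝ}
    (hq : ∀ i, 0 ≤ q i) (hq1 : ∑ i, q i = 1) {R : ℝ} (hR0 : 0 ≤ R)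
    (hR : ∀ i, q i ≤ R / (L : ℝ) ^ d) (p k m : ℕ) {s : ℝ} (hs : 0 ≤ s) :
    |∫ ω, phaseDefect p d (k * L) s (fun r => cellPoint (ω r))
          ∂(Measure.pi fun _ : Fin m => cellLaw q)
        - ∑ c, meanDefect p 0 m ((cellLaw q).map (cellVec (k * L) s c))|
      ≤ p * (√m * (m * (s * R * √(((k * L : ℕ) : ℝ) ^ d * spreadBound d k)))) := by
  have := isProbabilityMeasure_cellLaw hq hq1
  have hmd : ∀ c, meanDefect p 0 m ((cellLaw q).map (cellVec (k * L) s c))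
      = ∫ ω, resolventDefect p (0 + ∑ r, rankOne (cellVec (k * L) s c (ω r)))
        ∂(Measure.pi fun _ : Fin m => cellLaw q) := fun c =>
    meanDefect_map (measurable_cellVec (k * L) s c) PosSemidef.zero p m
  simp only [hmd]
  set P : Measure (Fin m → (Fin d → Fin L) × (Fin d → ℝ)) := Measure.pi fun _ => cellLaw q with hP
  have hi1 : Integrable (fun ω : Fin m → (Fin d → Fin L) × (Fin d → ℝ) =>
      phaseDefect p d (k * L) s (fun r => cellPoint (ω r))) P := by
    refine Integrable.of_bound (Measurable.aestronglyMeasurable ?_) (((k * L : ℕ) : ℝ) ^ d)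
      (Eventually.of_forall fun ω => abs_phaseDefect_le p d (k * L) hs _)
    exact (continuous_phaseDefect p d (k * L) hs m).measurable.comp
      (measurable_pi_lambda _ fun r => measurable_cellPoint.comp (measurable_pi_apply r))
  have hi2 : ∀ c, Integrable (fun ω : Fin m → (Fin d → Fin L) × (Fin d → ℝ) =>
      resolventDefect p (0 + ∑ r, rankOne (cellVec (k * L) s c (ω r)))) P := fun c => by
    refine Integrable.of_bound (Measurable.aestronglyMeasurable ?_)
      (Fintype.card (Fin d → Fin (k * L))) (Eventually.of_forall fun ω =>
        abs_resolventDefect_le (posSemidef_add_sum_rankOne PosSemidef.zero _) p)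
    exact (continuous_resolventDefect_add_sum PosSemidef.zero p m).measurable.comp
      (measurable_pi_lambda _ fun r => (measurable_cellVec (k * L) s c).comp
        (measurable_pi_apply r))
  rw [← integral_finsetSum _ fun c _ => hi2 c,
    ← integral_sub hi1 (integrable_finsetSum _ fun c _ => hi2 c)]
  set H : ((Fin d → Fin L) × (Fin d → ℝ)) × ((Fin d → Fin L) × (Fin d → ℝ)) → ℝ := fun z =>
    if z.1.1 = z.2.1 then 0 else
      ‖cubeKernel d (k * L) (cellPoint z.2 - cellPoint z.1)‖ ^ 2 with hH
  have hHm : Measurable H := by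
    refine Measurable.ite (measurableSet_eq_fun (by fun_prop) (by fun_prop)) measurable_const ?_
    exact ((continuous_cubeKernel d (k * L)).measurable.comp
      ((measurable_cellPoint.comp measurable_snd).sub
        (measurable_cellPoint.comp measurable_fst))).norm.pow_const 2
  have hH0 : ∀ z, 0 ≤ H z := fun z => by
    simp only [hH]; split_ifs <;> positivity
  have hHC : ∀ z, H z ≤ (((k * L : ℕ) : ℝ) ^ d) ^ 2 := fun z => by
    simp only [hH]
    split_ifs
    · positivity
    · exact norm_cubeKernel_sq_le _ _ _
  have hI := integral_sqrt_sum_pair_le (μ := cellLaw q) (m := m) hHm hH0 hHC (by simp [hH])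
  -- Erasing the entries between cells changes the Gram matrix by `s` times the root of the `H` sum
  -- in Frobenius norm.
  have hpt : ∀ ω : Fin m → (Fin d → Fin L) × (Fin d → ℝ),
      |phaseDefect p d (k * L) s (fun r => cellPoint (ω r))
          - ∑ c, resolventDefect p (0 + ∑ r, rankOne (cellVec (k * L) s c (ω r)))|
        ≤ p * √m * s * √(∑ r, ∑ r', H (ω r, ω r')) := by
    intro ω
    obtain ⟨G, hG, hGe, hsum⟩ := sum_resolventDefect_cellVec p (k * L) m hs ω
    rw [hsum, phaseDefect_eq_gram p d (k * L) hs]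
    refine (abs_resolventDefect_sub_le_frobenius (posSemidef_smul_gram d (k * L) hs _) hG p).trans
      (le_of_eq ?_)
    rw [mul_assoc, mul_assoc, Fintype.card_fin, Finset.sum_comm]
    congr 2
    have e : ∑ r', ∑ r, ‖((s : ℂ) • ((sampleMatrix d (k * L) fun r => cellPoint (ω r))ᴴ *
        sampleMatrix d (k * L) fun r => cellPoint (ω r))) r r' - G r r'‖ ^ 2
        = s ^ 2 * ∑ r', ∑ r, H (ω r', ω r) := by
      simp only [Finset.mul_sum]
      refine Finset.sum_congr rfl fun r' _ => Finset.sum_congr rfl fun r _ => ?_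
      rw [Matrix.smul_apply, conjTranspose_sampleMatrix_mul, hGe, hH]
      by_cases h : (ω r).1 = (ω r').1
      · simp [h]
      · simp [h, Ne.symm h, mul_pow]
    rw [e, Real.sqrt_mul (sq_nonneg s), Real.sqrt_sq hs]
  have hsqm : Integrable (fun ω : Fin m → (Fin d → Fin L) × (Fin d → ℝ) =>
      p * √m * s * √(∑ r, ∑ r', H (ω r, ω r'))) P := by
    refine Integrable.of_bound (Measurable.aestronglyMeasurable ?_) (p * √m * s *
      √(∑ r : Fin m, ∑ r' : Fin m, (((k * L : ℕ) : ℝ) ^ d) ^ 2)) (Eventually.of_forall fun x => ?_)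
    · refine Measurable.const_mul (Measurable.sqrt ?_) _
      exact Finset.measurable_fun_sum _ fun r _ => Finset.measurable_fun_sum _ fun r' _ =>
        hHm.comp (by fun_prop)
    · rw [Real.norm_eq_abs, abs_of_nonneg (by positivity)]
      exact mul_le_mul_of_nonneg_left (Real.sqrt_le_sqrt (Finset.sum_le_sum fun r _ =>
        Finset.sum_le_sum fun r' _ => hHC _)) (by positivity)
  refine (abs_integral_le_integral_abs).trans ?_
  refine (integral_mono_of_nonneg (Eventually.of_forall fun x => abs_nonneg _) hsqm
    (Eventually.of_forall hpt)).trans ?_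
  rw [integral_const_mul]
  have hfin := hI.trans (mul_le_mul_of_nonneg_left (Real.sqrt_le_sqrt
    (integral_offDiag_le hL hq hR k hq1)) (Nat.cast_nonneg m))
  rw [Real.sqrt_mul (sq_nonneg R), Real.sqrt_sq hR0] at hfin
  refine (mul_le_mul_of_nonneg_left hfin (by positivity)).trans (le_of_eq ?_)
  ring

/-- The law of the vector of the cell `c` is a thinning of the law of a uniform point there. -/
theorem integral_map_cellVec {q : (Fin d → Fin L) → ℝ} (hq : ∀ i, 0 ≤ q i) (hq1 : ∑ i, q i = 1)
    (n : ℕ) (s : ℝ) (c : Fin d → Fin L) (φ : ((Fin d → Fin n) → ℂ) → ℝ) (hφ : Measurable φ)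
    (hC : ∃ C, ∀ w, |φ w| ≤ C) :
    ∫ w, φ w ∂((cellLaw q).map (cellVec n s c)) = (1 - q c) * φ 0 +
      q c * ∫ w, φ w ∂((cubeLaw d).map fun u => weightedVec d n s (cellMap L c u)) := by
  obtain ⟨C, hC⟩ := hC
  rw [integral_map (measurable_cellVec n s c).aemeasurable hφ.aestronglyMeasurable,
    integral_map (measurable_weightedVec_cellMap n s c).aemeasurable hφ.aestronglyMeasurable,
    integral_cellLaw hq (φ := fun z => φ (cellVec n s c z)) (hφ.comp (measurable_cellVec n s c))
      fun z => hC _,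
    ← Finset.add_sum_erase _ _ (Finset.mem_univ c), add_comm]
  congr 1
  · have h1 : ∀ i ∈ Finset.univ.erase c, q i * ∫ u, φ (cellVec n s c (i, u)) ∂cubeLaw d
        = q i * φ 0 := fun i hi => by
      simp [cellVec, Finset.ne_of_mem_erase hi]
    rw [Finset.sum_congr rfl h1, ← Finset.sum_mul, ← hq1,
      ← Finset.add_sum_erase _ _ (Finset.mem_univ c), add_sub_cancel_left]
  · simp [cellVec, cellPoint]

/-- The mean defect for points drawn from the cells with weights `q`, in terms of the mean defect
for uniform points at a smaller scale. -/
theorem abs_integral_phaseDefect_cells_sub_le (hL : 0 < L) {q : (Fin d → Fin L) → ℝ}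
    (hq : ∀ i, 0 ≤ q i) (hq1 : ∑ i, q i = 1) {R : ℝ} (hR0 : 0 ≤ R)
    (hR : ∀ i, q i ≤ R / (L : ℝ) ^ d) (p k m : ℕ) {s : ℝ} (hs : 0 ≤ s) :
    |∫ ω, phaseDefect p d (k * L) s (fun r => cellPoint (ω r))
          ∂(Measure.pi fun _ : Fin m => cellLaw q)
        - ∑ c, uniformDefect p d k ⌊m * q c⌋₊ (s * (L : ℝ) ^ d)|
      ≤ p * (√m * (m * (s * R * √(((k * L : ℕ) : ℝ) ^ d * spreadBound d k))))
        + (L : ℝ) ^ d * (p * (√(m * (R / (L : ℝ) ^ d)) + 1)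
          + p * (√(m * (R / (L : ℝ) ^ d)) * (m * (R / (L : ℝ) ^ d) *
            (s * (L : ℝ) ^ d * √((k : ℝ) ^ d * spreadBound d k))))) := by
  have h1 := abs_integral_phaseDefect_sub_sum_cells_le hL hq hq1 hR0 hR p k m hs
  have := isProbabilityMeasure_cellLaw hq hq1
  have hη := spreadBound_nonneg d k
  have h2 : ∀ c, |meanDefect p 0 m ((cellLaw q).map (cellVec (k * L) s c))
      - uniformDefect p d k ⌊m * q c⌋₊ (s * (L : ℝ) ^ d)|
      ≤ p * (√(m * (R / (L : ℝ) ^ d)) + 1)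
          + p * (√(m * (R / (L : ℝ) ^ d)) * (m * (R / (L : ℝ) ^ d) *
            (s * (L : ℝ) ^ d * √((k : ℝ) ^ d * spreadBound d k)))) := by
    intro c
    have hi1 : IsProbabilityMeasure ((cellLaw q).map (cellVec (k * L) s c)) :=
      Measure.isProbabilityMeasure_map (measurable_cellVec (k * L) s c).aemeasurable
    have hi2 : IsProbabilityMeasure
        ((cubeLaw d).map fun u => weightedVec d (k * L) s (cellMap L c u)) :=
      Measure.isProbabilityMeasure_map (measurable_weightedVec_cellMap (k * L) s c).aemeasurable
    have hqc1 : q c ≤ 1 := hq1 ▸ Finset.single_le_sum (fun i _ => hq i) (Finset.mem_univ c)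
    have hmq : (m : ℝ) * q c ≤ m * (R / (L : ℝ) ^ d) :=
      mul_le_mul_of_nonneg_left (hR c) (Nat.cast_nonneg m)
    -- Seen from the cell `c`, a sample of `m` points is a uniform sample in that cell of binomial
    -- size, replaced next by the deterministic size `⌊m * q c⌋₊`.
    rw [meanDefect_eq_binomialMean PosSemidef.zero p m (q := q c)
      (ν' := (cubeLaw d).map fun u => weightedVec d (k * L) s (cellMap L c u))
      (integral_map_cellVec hq hq1 (k * L) s c)]
    have h3 := abs_binomialMean_sub_le (hq c) hqc1 m (C := p) (Nat.cast_nonneg p)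
      (φ := fun j => meanDefect p 0 j
        ((cubeLaw d).map fun u => weightedVec d (k * L) s (cellMap L c u)))
      (fun i j => abs_meanDefect_sub_le_mul_abs PosSemidef.zero p i j)
    have h4 := abs_meanDefect_cell_sub_le hL c p k ⌊m * q c⌋₊ hs
    have hN : (⌊m * q c⌋₊ : ℝ) ≤ m * (R / (L : ℝ) ^ d) :=
      (Nat.floor_le (mul_nonneg (Nat.cast_nonneg m) (hq c))).trans hmq
    refine (abs_sub_le _ _ _).trans (add_le_add (h3.trans ?_) (h4.trans ?_))
    · gcongr
    · gcongr
  refine (abs_sub_le _ (∑ c, meanDefect p 0 m ((cellLaw q).map (cellVec (k * L) s c))) _).trans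
    (add_le_add h1 ?_)
  rw [← Finset.sum_sub_distrib]
  refine (Finset.abs_sum_le_sum_abs _ _).trans ((Finset.sum_le_sum fun c _ => h2 c).trans
    (le_of_eq ?_))
  rw [Finset.sum_const, Finset.card_univ, nsmul_eq_mul, Fintype.card_fun, Fintype.card_fin,
    Fintype.card_fin, Nat.cast_pow]

end CellComparison

end

noncomputable section

open scoped ComplexOrder

/-! ### Existence of the limit for uniform phases. -/

section UniformLimit

variable {d L : ℕ}

/-- A bound, tending to zero with `k`, for the relative error of the decomposition into cells. -/
def cellError (p d : ℕ) (R : ℝ) (k : ℕ) : ℝ :=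
  p * ((R ^ 3 * √R + R ^ 4) * √(spreadBound d k) + R * (√((k : ℝ) ^ d))⁻¹ + ((k : ℝ) ^ d)⁻¹)

theorem tendsto_natCast_pow_atTop (hd : 1 ≤ d) :
    Tendsto (fun k : ℕ => (k : ℝ) ^ d) atTop atTop :=
  (tendsto_pow_atTop (by omega)).comp tendsto_natCast_atTop_atTop

theorem tendsto_cellError (p : ℕ) (hd : 1 ≤ d) (R : ℝ) :
    Tendsto (cellError p d R) atTop (𝓝 0) := by
  have h1 : Tendsto (fun k => √(spreadBound d k)) atTop (𝓝 0) := by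
    have h := (Real.continuous_sqrt.tendsto 0).comp (tendsto_spreadBound d)
    rw [Real.sqrt_zero] at h
    exact h
  have h2 := tendsto_natCast_pow_atTop hd
  have h3 : Tendsto (fun k : ℕ => (√((k : ℝ) ^ d))⁻¹) atTop (𝓝 0) :=
    (Real.tendsto_sqrt_atTop.comp h2).inv_tendsto_atTop
  have h4 := (((h1.const_mul (R ^ 3 * √R + R ^ 4)).add (h3.const_mul R)).add
    h2.inv_tendsto_atTop).const_mul (p : ℝ)
  simp only [mul_zero, add_zero] at h4
  exact h4

/-- When `m` is at most of order `n ^ d` and `s` at most of order `n ^ (-d)`, with `n = k * L`,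
dividing by `n ^ d` cancels every power of `L`. The bound depends on `L` only through `R`, which
makes the comparison of arbitrary scales possible. -/
theorem abs_normalized_phaseDefect_cells_sub_le (hL : 0 < L) {q : (Fin d → Fin L) → ℝ}
    (hq : ∀ i, 0 ≤ q i) (hq1 : ∑ i, q i = 1) {R : ℝ} (hR0 : 0 ≤ R)
    (hR : ∀ i, q i ≤ R / (L : ℝ) ^ d) (p : ℕ) {k m : ℕ} (hk : 0 < k) {s : ℝ} (hs : 0 ≤ s)
    (hm : (m : ℝ) ≤ R * ((k * L : ℕ) : ℝ) ^ d) (hsR : s * ((k * L : ℕ) : ℝ) ^ d ≤ R) :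
    |(∫ ω, phaseDefect p d (k * L) s (fun r => cellPoint (ω r))
          ∂(Measure.pi fun _ : Fin m => cellLaw q)) / ((k * L : ℕ) : ℝ) ^ d
        - ((L : ℝ) ^ d)⁻¹ *
          ∑ c, uniformDefect p d k ⌊m * q c⌋₊ (s * (L : ℝ) ^ d) / (k : ℝ) ^ d|
      ≤ cellError p d R k := by
  have h := abs_integral_phaseDefect_cells_sub_le hL hq hq1 hR0 hR p k m hs
  have hη := spreadBound_nonneg d k
  have hkL : ((k * L : ℕ) : ℝ) ^ d = (k : ℝ) ^ d * (L : ℝ) ^ d := by rw [Nat.cast_mul, mul_pow]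
  rw [hkL] at h hm hsR ⊢
  set X := ∫ ω, phaseDefect p d (k * L) s (fun r => cellPoint (ω r))
          ∂(Measure.pi fun _ : Fin m => cellLaw q) with hX
  set Y := ∑ c, uniformDefect p d k ⌊m * q c⌋₊ (s * (L : ℝ) ^ d) with hY
  -- In terms of `a`, `b` and `e`, all square roots of products become monomials.
  set a := √((k : ℝ) ^ d) with ha
  set b := √((L : ℝ) ^ d) with hb
  have hkp : (0 : ℝ) < (k : ℝ) ^ d := pow_pos (by exact_mod_cast hk) d
  have hLp : (0 : ℝ) < (L : ℝ) ^ d := pow_pos (by exact_mod_cast hL) d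
  have ha0 : 0 < a := Real.sqrt_pos.2 hkp
  have hb0 : 0 < b := Real.sqrt_pos.2 hLp
  have haa : (k : ℝ) ^ d = a ^ 2 := (Real.sq_sqrt hkp.le).symm
  have hbb : (L : ℝ) ^ d = b ^ 2 := (Real.sq_sqrt hLp.le).symm
  have hsm : √(m : ℝ) ≤ √R * (a * b) := by
    refine (Real.sqrt_le_sqrt hm).trans (le_of_eq ?_)
    rw [Real.sqrt_mul hR0, Real.sqrt_mul hkp.le]
  have hms : (m : ℝ) * s ≤ R * R := by
    calc (m : ℝ) * s ≤ R * ((k : ℝ) ^ d * (L : ℝ) ^ d) * s := mul_le_mul_of_nonneg_right hm hs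
      _ = R * (s * ((k : ℝ) ^ d * (L : ℝ) ^ d)) := by ring
      _ ≤ R * R := mul_le_mul_of_nonneg_left hsR hR0
  have hmR : (m : ℝ) * (R / (L : ℝ) ^ d) ≤ (R * a) ^ 2 := by
    rw [mul_div_assoc', div_le_iff₀ hLp]
    calc (m : ℝ) * R ≤ R * ((k : ℝ) ^ d * (L : ℝ) ^ d) * R := mul_le_mul_of_nonneg_right hm hR0
      _ = (R * a) ^ 2 * (L : ℝ) ^ d := by rw [haa]; ring
  have hsmR : √((m : ℝ) * (R / (L : ℝ) ^ d)) ≤ R * a :=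
    Real.sqrt_le_iff.2 ⟨by positivity, hmR⟩
  have hsk : s * (L : ℝ) ^ d * a ^ 2 ≤ R := by
    rw [← haa]
    calc _ = s * ((k : ℝ) ^ d * (L : ℝ) ^ d) := by ring
      _ ≤ R := hsR
  set e := √(spreadBound d k) with he
  have he0 : 0 ≤ e := Real.sqrt_nonneg _
  have t1 : p * (√m * (m * (s * R * √((k : ℝ) ^ d * (L : ℝ) ^ d * spreadBound d k))))
      ≤ p * (R ^ 3 * √R * e) * (a ^ 2 * b ^ 2) := by
    rw [Real.sqrt_mul (by positivity), Real.sqrt_mul hkp.le]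
    calc p * (√m * (m * (s * R * (a * b * e)))) = p * (√m * ((m * s) * (R * (a * b * e)))) := by ring
      _ ≤ p * (√R * (a * b) * (R * R * (R * (a * b * e)))) := by gcongr
      _ = _ := by ring
  have t3 : p * (√((m : ℝ) * (R / (L : ℝ) ^ d)) * (m * (R / (L : ℝ) ^ d) *
            (s * (L : ℝ) ^ d * √((k : ℝ) ^ d * spreadBound d k))))
      ≤ p * (R ^ 4 * e) * a ^ 2 := by
    rw [Real.sqrt_mul hkp.le]
    calc p * (√((m : ℝ) * (R / (L : ℝ) ^ d)) * (m * (R / (L : ℝ) ^ d) *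
            (s * (L : ℝ) ^ d * (a * e))))
        ≤ p * ((R * a) * ((R * a) ^ 2 * (s * (L : ℝ) ^ d * (a * e)))) := by gcongr
      _ = p * (R ^ 3 * (s * (L : ℝ) ^ d * a ^ 2) * e) * a ^ 2 := by ring
      _ ≤ p * (R ^ 3 * R * e) * a ^ 2 := by gcongr
      _ = _ := by ring
  have t2 : p * (√((m : ℝ) * (R / (L : ℝ) ^ d)) + 1) ≤ p * (R * a + 1) := by gcongr
  have hXY : X / ((k : ℝ) ^ d * (L : ℝ) ^ d) - ((L : ℝ) ^ d)⁻¹ *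
          ∑ c, uniformDefect p d k ⌊m * q c⌋₊ (s * (L : ℝ) ^ d) / (k : ℝ) ^ d
      = (X - Y) / (a ^ 2 * b ^ 2) := by
    rw [← Finset.sum_div, ← hY, haa, hbb]
    field_simp
  rw [hXY, abs_div, abs_of_pos (by positivity : 0 < a ^ 2 * b ^ 2), div_le_iff₀ (by positivity)]
  have h5 : (L : ℝ) ^ d * (p * (√((m : ℝ) * (R / (L : ℝ) ^ d)) + 1)
          + p * (√((m : ℝ) * (R / (L : ℝ) ^ d)) * (m * (R / (L : ℝ) ^ d) *
            (s * (L : ℝ) ^ d * √((k : ℝ) ^ d * spreadBound d k)))))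
      ≤ (L : ℝ) ^ d * (p * (R * a + 1) + p * (R ^ 4 * e) * a ^ 2) :=
    mul_le_mul_of_nonneg_left (add_le_add t2 t3) hLp.le
  refine h.trans ((add_le_add t1 h5).trans (le_of_eq ?_))
  rw [cellError, ← he, ← ha, haa, hbb]
  field_simp
  ring

theorem measurable_phaseDefect (p d n : ℕ) {s : ℝ} (hs : 0 ≤ s) (m : ℕ) :
    Measurable fun x : Fin m → Fin d → ℝ => phaseDefect p d n s x :=
  (continuous_phaseDefect p d n hs m).measurable

theorem integral_phaseDefect_cellPoint {q : (Fin d → Fin L) → ℝ} (hq : ∀ i, 0 ≤ q i)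
    (hq1 : ∑ i, q i = 1) (p n m : ℕ) {s : ℝ} (hs : 0 ≤ s) :
    ∫ ω, phaseDefect p d n s (fun r => cellPoint (ω r)) ∂(Measure.pi fun _ : Fin m => cellLaw q)
      = ∫ x, phaseDefect p d n s x ∂(Measure.pi fun _ : Fin m => (cellLaw q).map cellPoint) := by
  have := isProbabilityMeasure_cellLaw hq hq1
  have h2 : IsProbabilityMeasure ((cellLaw q).map cellPoint) :=
    Measure.isProbabilityMeasure_map measurable_cellPoint.aemeasurable
  rw [← Measure.pi_map_pi fun _ => measurable_cellPoint.aemeasurable, integral_map]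
  · exact (measurable_pi_lambda _ fun r => measurable_cellPoint.comp
      (measurable_pi_apply r)).aemeasurable
  · exact (measurable_phaseDefect p d n hs m).aestronglyMeasurable

theorem map_cellPoint_cellLaw (q : (Fin d → Fin L) → ℝ) :
    (cellLaw q).map cellPoint = ∑ i, ENNReal.ofReal (q i) • (cubeLaw d).map (cellMap L i) := by
  ext t ht
  rw [Measure.map_apply measurable_cellPoint ht, cellLaw, Measure.finsetSum_apply,
    Measure.finsetSum_apply]
  refine Finset.sum_congr rfl fun i _ => ?_
  rw [Measure.smul_apply, Measure.smul_apply, Measure.map_apply measurable_prodMk_left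
    (measurable_cellPoint ht), Measure.map_apply (continuous_cellMap i).measurable ht]
  rfl

theorem map_cellPoint_cellLaw_const (hL : 0 < L) :
    (cellLaw fun _ : Fin d → Fin L => ((L : ℝ) ^ d)⁻¹).map cellPoint = cubeLaw d := by
  rw [map_cellPoint_cellLaw]
  conv_rhs => rw [cubeLaw_eq_sum_map hL]
  have hLr : (0 : ℝ) < L := by exact_mod_cast hL
  rw [ENNReal.ofReal_inv_of_pos (by positivity), ENNReal.ofReal_pow hLr.le, ENNReal.ofReal_natCast]

/-- The mean defect per dimension of uniform points with `b` points per dimension and weights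
`σ / k ^ d`. -/
def scaledDefect (p d : ℕ) (b σ : ℝ) (k : ℕ) : ℝ :=
  uniformDefect p d k ⌊b * (k : ℝ) ^ d⌋₊ (σ / (k : ℝ) ^ d) / (k : ℝ) ^ d

/-- Uniform points are cell points with equal weights, so every cell gives the same problem at scale
`k`. The `2 / k ^ d` covers the mismatch of the integer parts in the numbers of points. -/
theorem abs_scaledDefect_mul_sub_le (p : ℕ) {b σ : ℝ} (hb : 0 ≤ b) (hσ : 0 ≤ σ) {k : ℕ}
    (hk : 0 < k) (hL : 0 < L) :
    |scaledDefect p d b σ (k * L) - scaledDefect p d b σ k|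
      ≤ cellError p d (b + σ + 1) k + p * (2 * ((k : ℝ) ^ d)⁻¹) := by
  have hkp : (0 : ℝ) < (k : ℝ) ^ d := pow_pos (by exact_mod_cast hk) d
  have hLp : (0 : ℝ) < (L : ℝ) ^ d := pow_pos (by exact_mod_cast hL) d
  have hkL : ((k * L : ℕ) : ℝ) ^ d = (k : ℝ) ^ d * (L : ℝ) ^ d := by rw [Nat.cast_mul, mul_pow]
  set m := ⌊b * ((k * L : ℕ) : ℝ) ^ d⌋₊ with hm
  set s := σ / ((k * L : ℕ) : ℝ) ^ d with hs
  have hs0 : 0 ≤ s := by positivity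
  set q : (Fin d → Fin L) → ℝ := fun _ => ((L : ℝ) ^ d)⁻¹ with hqdef
  have hq : ∀ i, 0 ≤ q i := fun i => by positivity
  have hq1 : ∑ i, q i = 1 := by
    simp only [hqdef, Finset.sum_const, Finset.card_univ, Fintype.card_fun, Fintype.card_fin,
      nsmul_eq_mul, Nat.cast_pow]
    exact mul_inv_cancel₀ hLp.ne'
  have hm1 : (m : ℝ) ≤ b * ((k * L : ℕ) : ℝ) ^ d := Nat.floor_le (by positivity)
  have hm2 : b * ((k * L : ℕ) : ℝ) ^ d < m + 1 := Nat.lt_floor_add_one _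
  have h1 := abs_normalized_phaseDefect_cells_sub_le hL hq hq1 (R := b + σ + 1) (by positivity)
    (fun i => by
      rw [hqdef, inv_eq_one_div]
      exact div_le_div_of_nonneg_right (by linarith) hLp.le) p hk hs0
    (hm1.trans (mul_le_mul_of_nonneg_right (by linarith) (by positivity)))
    (by rw [hs, div_mul_cancel₀ _ (by positivity)]; linarith)
  rw [integral_phaseDefect_cellPoint hq hq1 p (k * L) m hs0, map_cellPoint_cellLaw_const hL] at h1
  have hsL : s * (L : ℝ) ^ d = σ / (k : ℝ) ^ d := by
    rw [hs, hkL]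
    field_simp
  have h2 : ((L : ℝ) ^ d)⁻¹ * ∑ c, uniformDefect p d k ⌊m * q c⌋₊ (s * (L : ℝ) ^ d) / (k : ℝ) ^ d
      = uniformDefect p d k ⌊m * ((L : ℝ) ^ d)⁻¹⌋₊ (σ / (k : ℝ) ^ d) / (k : ℝ) ^ d := by
    rw [hsL]
    simp only [hqdef, Finset.sum_const, Finset.card_univ, Fintype.card_fun, Fintype.card_fin,
      nsmul_eq_mul, Nat.cast_pow]
    exact inv_mul_cancel_left₀ hLp.ne' _
  rw [h2] at h1
  refine (abs_sub_le _ _ _).trans (add_le_add h1 ?_)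
  rw [scaledDefect, ← sub_div, abs_div, abs_of_pos hkp, div_eq_mul_inv, ← mul_assoc]
  refine mul_le_mul_of_nonneg_right ?_ (by positivity)
  refine (abs_uniformDefect_sub_le_card p d k (by positivity) _ _).trans
    (mul_le_mul_of_nonneg_left ?_ (Nat.cast_nonneg p))
  have a1 : (⌊m * ((L : ℝ) ^ d)⁻¹⌋₊ : ℝ) ≤ m * ((L : ℝ) ^ d)⁻¹ := Nat.floor_le (by positivity)
  have a2 : m * ((L : ℝ) ^ d)⁻¹ < (⌊m * ((L : ℝ) ^ d)⁻¹⌋₊ : ℝ) + 1 := Nat.lt_floor_add_one _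
  have a3 : (⌊b * (k : ℝ) ^ d⌋₊ : ℝ) ≤ b * (k : ℝ) ^ d := Nat.floor_le (by positivity)
  have a4 : b * (k : ℝ) ^ d < (⌊b * (k : ℝ) ^ d⌋₊ : ℝ) + 1 := Nat.lt_floor_add_one _
  have hL1 : (1 : ℝ) ≤ (L : ℝ) ^ d := one_le_pow₀ (by exact_mod_cast hL)
  have a5 : m * ((L : ℝ) ^ d)⁻¹ ≤ b * (k : ℝ) ^ d := by
    rw [← div_eq_mul_inv, div_le_iff₀ hLp, mul_assoc, ← hkL]
    exact hm1
  have a6 : b * (k : ℝ) ^ d ≤ m * ((L : ℝ) ^ d)⁻¹ + 1 := by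
    have : b * (k : ℝ) ^ d = b * ((k : ℝ) ^ d * (L : ℝ) ^ d) * ((L : ℝ) ^ d)⁻¹ := by
      field_simp
    rw [this, ← hkL]
    calc b * ((k * L : ℕ) : ℝ) ^ d * ((L : ℝ) ^ d)⁻¹ ≤ (m + 1) * ((L : ℝ) ^ d)⁻¹ := by gcongr
      _ ≤ m * ((L : ℝ) ^ d)⁻¹ + 1 := by
        rw [add_mul, one_mul]
        gcongr
        exact inv_le_one_of_one_le₀ hL1
  rw [abs_le]
  constructor <;> linarith

/-- Two scales `k` and `k'` are both compared with their common multiple `k * k'`; the errors depend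
on `k` and on `k'` separately, not on the multiplier. -/
theorem cauchySeq_scaledDefect (p : ℕ) (hd : 1 ≤ d) {b σ : ℝ} (hb : 0 ≤ b) (hσ : 0 ≤ σ) :
    CauchySeq (scaledDefect p d b σ) := by
  have h1 : Tendsto (fun k : ℕ => cellError p d (b + σ + 1) k + p * (2 * ((k : ℝ) ^ d)⁻¹)) atTop
      (𝓝 0) := by
    have := (tendsto_cellError p hd (b + σ + 1)).add
      (((tendsto_natCast_pow_atTop hd).inv_tendsto_atTop.const_mul 2).const_mul (p : ℝ))
    simpa using this
  rw [Metric.cauchySeq_iff]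
  intro ε hε
  obtain ⟨K, hK⟩ := eventually_atTop.1 ((tendsto_order.1 h1).2 (ε / 2) (by linarith))
  refine ⟨K + 1, fun k hk k' hk' => ?_⟩
  have e1 := abs_scaledDefect_mul_sub_le (d := d) p hb hσ (k := k) (L := k') (by omega) (by omega)
  have e2 := abs_scaledDefect_mul_sub_le (d := d) p hb hσ (k := k') (L := k) (by omega) (by omega)
  rw [mul_comm k' k] at e2
  have e3 := hK k (by omega)
  have e4 := hK k' (by omega)
  rw [Real.dist_eq]
  have e5 := abs_sub_le (scaledDefect p d b σ k) (scaledDefect p d b σ (k * k'))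
    (scaledDefect p d b σ k')
  rw [abs_sub_comm (scaledDefect p d b σ k) (scaledDefect p d b σ (k * k'))] at e5
  linarith

/-- The limit of `scaledDefect`. -/
def limitDefect (p d : ℕ) (b σ : ℝ) : ℝ := limUnder atTop (scaledDefect p d b σ)

theorem tendsto_scaledDefect (p : ℕ) (hd : 1 ≤ d) {b σ : ℝ} (hb : 0 ≤ b) (hσ : 0 ≤ σ) :
    Tendsto (scaledDefect p d b σ) atTop (𝓝 (limitDefect p d b σ)) :=
  (cauchySeq_scaledDefect p hd hb hσ).tendsto_limUnder

/-- Lipschitz dependence on the number of points and on the weight frees the limit from the special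
choices in `scaledDefect`: only the asymptotic ratios matter. -/
theorem tendsto_uniformDefect_div (p : ℕ) (hd : 1 ≤ d) {b σ : ℝ} (hb : 0 ≤ b) (hσ : 0 ≤ σ)
    {k N : ℕ → ℕ} {s : ℕ → ℝ} (hs : ∀ j, 0 ≤ s j) (hk : Tendsto k atTop atTop)
    (hN : Tendsto (fun j => (N j : ℝ) / (k j : ℝ) ^ d) atTop (𝓝 b))
    (hsσ : Tendsto (fun j => s j * (k j : ℝ) ^ d) atTop (𝓝 σ)) :
    Tendsto (fun j => uniformDefect p d (k j) (N j) (s j) / (k j : ℝ) ^ d) atTop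
      (𝓝 (limitDefect p d b σ)) := by
  have h1 := (tendsto_scaledDefect p hd hb hσ).comp hk
  have hinv : Tendsto (fun j => ((k j : ℝ) ^ d)⁻¹) atTop (𝓝 0) :=
    (tendsto_natCast_pow_atTop hd).inv_tendsto_atTop.comp hk
  have hB : Tendsto (fun j => p * (|(N j : ℝ) / (k j : ℝ) ^ d - b| + ((k j : ℝ) ^ d)⁻¹)
      + p * (|s j * (k j : ℝ) ^ d - σ| * b)) atTop (𝓝 0) := by
    have a1 : Tendsto (fun j => |(N j : ℝ) / (k j : ℝ) ^ d - b|) atTop (𝓝 0) := by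
      simpa using (hN.sub_const b).abs
    have a2 : Tendsto (fun j => |s j * (k j : ℝ) ^ d - σ|) atTop (𝓝 0) := by
      simpa using (hsσ.sub_const σ).abs
    simpa using ((a1.add hinv).const_mul (p : ℝ)).add ((a2.mul_const b).const_mul (p : ℝ))
  refine tendsto_of_tendsto_of_dist h1 ?_
  refine squeeze_zero' (Eventually.of_forall fun j => dist_nonneg) ?_ hB
  filter_upwards [hk.eventually_ge_atTop 1] with j hj
  have hkp : (0 : ℝ) < (k j : ℝ) ^ d := pow_pos (by exact_mod_cast hj) d
  set M := ⌊b * (k j : ℝ) ^ d⌋₊ with hM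
  have m1 : (M : ℝ) ≤ b * (k j : ℝ) ^ d := Nat.floor_le (by positivity)
  have m2 : b * (k j : ℝ) ^ d < M + 1 := Nat.lt_floor_add_one _
  rw [dist_comm, Real.dist_eq, Function.comp_apply, scaledDefect, ← sub_div, abs_div,
    abs_of_pos hkp, div_le_iff₀ hkp]
  refine (abs_sub_le _ (uniformDefect p d (k j) M (s j)) _).trans ?_
  have e1 := abs_uniformDefect_sub_le_card p d (k j) (hs j) (N j) M
  have e2 := abs_uniformDefect_sub_le_weight p d (k j) M (hs j)
    (div_nonneg hσ hkp.le : 0 ≤ σ / (k j : ℝ) ^ d)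
  refine (add_le_add e1 e2).trans ?_
  rw [add_mul, mul_assoc, mul_assoc]
  have f1 : |(N j : ℝ) - M| ≤ (|(N j : ℝ) / (k j : ℝ) ^ d - b| + ((k j : ℝ) ^ d)⁻¹)
      * (k j : ℝ) ^ d := by
    rw [add_mul, inv_mul_cancel₀ hkp.ne', ← abs_of_pos hkp, ← abs_mul, abs_of_pos hkp, sub_mul,
      div_mul_cancel₀ _ hkp.ne']
    have : (N j : ℝ) - M = (N j - b * (k j : ℝ) ^ d) + (b * (k j : ℝ) ^ d - M) := by ring
    rw [this]
    refine (abs_add_le _ _).trans (add_le_add le_rfl ?_)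
    rw [abs_le]; constructor <;> linarith
  have f2 : |s j - σ / (k j : ℝ) ^ d| * ((k j : ℝ) ^ d * M)
      ≤ |s j * (k j : ℝ) ^ d - σ| * b * (k j : ℝ) ^ d := by
    have : |s j * (k j : ℝ) ^ d - σ| = |s j - σ / (k j : ℝ) ^ d| * (k j : ℝ) ^ d := by
      rw [← abs_of_pos hkp, ← abs_mul, abs_of_pos hkp, sub_mul, div_mul_cancel₀ _ hkp.ne']
    rw [this]
    calc _ = |s j - σ / (k j : ℝ) ^ d| * (k j : ℝ) ^ d * M := by ring
      _ ≤ |s j - σ / (k j : ℝ) ^ d| * (k j : ℝ) ^ d * (b * (k j : ℝ) ^ d) := by gcongr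
      _ = _ := by ring
  gcongr

theorem limitDefect_zero_left (p : ℕ) (hd : 1 ≤ d) {σ : ℝ} (hσ : 0 ≤ σ) :
    limitDefect p d 0 σ = 0 := by
  refine tendsto_nhds_unique (tendsto_scaledDefect p hd le_rfl hσ) ?_
  refine tendsto_const_nhds.congr fun k => ?_
  rw [scaledDefect, zero_mul, Nat.floor_zero, uniformDefect]
  have : ∀ x : Fin 0 → Fin d → ℝ, phaseDefect p d k (σ / (k : ℝ) ^ d) x = 0 := fun x => by
    rw [phaseDefect_eq_sum_rankOne _ _ _ (by positivity)]
    simp [resolventDefect_zero]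
  simp [this]

theorem abs_limitDefect_sub_le (p : ℕ) (hd : 1 ≤ d) {b b' σ : ℝ} (hb : 0 ≤ b) (hb' : 0 ≤ b')
    (hσ : 0 ≤ σ) : |limitDefect p d b σ - limitDefect p d b' σ| ≤ p * |b - b'| := by
  have h1 := ((tendsto_scaledDefect p hd hb hσ).sub (tendsto_scaledDefect p hd hb' hσ)).abs
  have h2 : Tendsto (fun k : ℕ => p * (|b - b'| + ((k : ℝ) ^ d)⁻¹)) atTop
      (𝓝 (p * (|b - b'| + 0))) :=
    ((tendsto_natCast_pow_atTop hd).inv_tendsto_atTop.const_add _).const_mul _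
  rw [add_zero] at h2
  refine le_of_tendsto_of_tendsto h1 h2 ?_
  filter_upwards [eventually_ge_atTop 1] with k hk
  have hkp : (0 : ℝ) < (k : ℝ) ^ d := pow_pos (by exact_mod_cast hk) d
  rw [scaledDefect, scaledDefect, ← sub_div, abs_div, abs_of_pos hkp, div_le_iff₀ hkp, mul_assoc]
  refine (abs_uniformDefect_sub_le_card p d k (by positivity) _ _).trans
    (mul_le_mul_of_nonneg_left ?_ (Nat.cast_nonneg p))
  have a1 : (⌊b' * (k : ℝ) ^ d⌋₊ : ℝ) ≤ b' * (k : ℝ) ^ d := Nat.floor_le (by positivity)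
  have a2 : b' * (k : ℝ) ^ d < (⌊b' * (k : ℝ) ^ d⌋₊ : ℝ) + 1 := Nat.lt_floor_add_one _
  have a3 : (⌊b * (k : ℝ) ^ d⌋₊ : ℝ) ≤ b * (k : ℝ) ^ d := Nat.floor_le (by positivity)
  have a4 : b * (k : ℝ) ^ d < (⌊b * (k : ℝ) ^ d⌋₊ : ℝ) + 1 := Nat.lt_floor_add_one _
  rw [add_mul, inv_mul_cancel₀ hkp.ne', ← abs_of_pos hkp, ← abs_mul, abs_of_pos hkp, sub_mul]
  have a5 := le_abs_self (b * (k : ℝ) ^ d - b' * (k : ℝ) ^ d)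
  have a6 := neg_abs_le (b * (k : ℝ) ^ d - b' * (k : ℝ) ^ d)
  rw [abs_le]
  constructor <;> linarith

end UniformLimit

end

noncomputable section

open scoped ComplexOrder

/-! ### Approximation of a density by its cell averages. -/

section CellAverage

variable {d L : ℕ}

/-- The mean of `f` over the cell with index `i`. -/
def cellAverage (f : (Fin d → ℝ) → ℝ) (L : ℕ) (i : Fin d → Fin L) : ℝ :=
  ∫ u, f (cellMap L i u) ∂cubeLaw d

/-- The `L¹` distance on the hypercube of `f` to its cell averages. -/
def cellDeviation (f : (Fin d → ℝ) → ℝ) (L : ℕ) : ℝ :=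
  ((L : ℝ) ^ d)⁻¹ *
    ∑ i : Fin d → Fin L, ∫ u, |f (cellMap L i u) - cellAverage f L i| ∂cubeLaw d

/-- Averaging over cells contracts the `L¹` distance, so `f - g` is paid for once directly and once
through the averages. -/
theorem cellDeviation_le_add (hL : 0 < L) {f g : (Fin d → ℝ) → ℝ} (hf : Integrable f (cubeLaw d))
    (hg : Integrable g (cubeLaw d)) :
    cellDeviation f L ≤ cellDeviation g L + 2 * ∫ x, |f x - g x| ∂cubeLaw d := by
  have hfc := fun i => integrable_comp_cellMap hL hf (L := L) i
  have hgc := fun i => integrable_comp_cellMap hL hg (L := L) i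
  rw [integral_cubeLaw_eq_sum hL (φ := fun x => |f x - g x|) (hf.sub hg).abs, cellDeviation,
    cellDeviation, mul_left_comm, ← mul_add]
  refine mul_le_mul_of_nonneg_left ?_ (by positivity)
  rw [Finset.mul_sum, ← Finset.sum_add_distrib]
  refine Finset.sum_le_sum fun i _ => ?_
  have h1 : |cellAverage g L i - cellAverage f L i|
      ≤ ∫ u, |f (cellMap L i u) - g (cellMap L i u)| ∂cubeLaw d := by
    rw [abs_sub_comm, cellAverage, cellAverage, ← integral_sub (hfc i) (hgc i)]
    exact abs_integral_le_integral_abs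
  have i1 : Integrable (fun u => |f (cellMap L i u) - g (cellMap L i u)|) (cubeLaw d) :=
    ((hfc i).sub (hgc i)).abs
  have i2 : Integrable (fun u => |g (cellMap L i u) - cellAverage g L i|) (cubeLaw d) :=
    ((hgc i).sub (integrable_const _)).abs
  have h2 : ∫ u, |f (cellMap L i u) - cellAverage f L i| ∂cubeLaw d
      ≤ ∫ u, (|f (cellMap L i u) - g (cellMap L i u)| + |g (cellMap L i u) - cellAverage g L i|
          + |cellAverage g L i - cellAverage f L i|) ∂cubeLaw d := by
    refine integral_mono ((hfc i).sub (integrable_const _)).abs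
      ((i1.add i2).add (integrable_const _)) fun u => ?_
    refine (abs_sub_le _ (g (cellMap L i u)) _).trans ?_
    rw [add_assoc]
    exact add_le_add le_rfl (abs_sub_le _ _ _)
  have h3 := integral_add (i1.add i2)
    (integrable_const (μ := cubeLaw d) |cellAverage g L i - cellAverage f L i|)
  have h4 := integral_add i1 i2
  simp only [Pi.add_apply] at h3
  rw [h3, h4, integral_const, probReal_univ, one_smul] at h2
  linarith

theorem ae_cubeLaw_mem_hypercube (d : ℕ) : ∀ᵐ u ∂cubeLaw d, u ∈ hypercube d :=
  ae_restrict_mem (measurableSet_hypercube d)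

theorem dist_cellMap_le (i : Fin d → Fin L) {u v : Fin d → ℝ} (hu : u ∈ hypercube d)
    (hv : v ∈ hypercube d) : dist (cellMap L i u) (cellMap L i v) ≤ (L : ℝ)⁻¹ := by
  rw [dist_eq_norm, cellMap_sub_cellMap, norm_smul, norm_inv, Real.norm_natCast]
  refine mul_le_of_le_one_right (by positivity) ?_
  rw [pi_norm_le_iff_of_nonneg zero_le_one]
  intro j
  have h1 := hu j trivial
  have h2 := hv j trivial
  rw [Set.mem_Ico] at h1 h2
  rw [Pi.sub_apply, Real.norm_eq_abs, abs_le]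
  constructor <;> linarith [h1.1, h1.2, h2.1, h2.2]

theorem exists_cellDeviation_le_of_uniformContinuous {g : (Fin d → ℝ) → ℝ}
    (hg : UniformContinuous g) {ε : ℝ} (hε : 0 < ε) : ∃ L : ℕ, 0 < L ∧ cellDeviation g L ≤ ε := by
  obtain ⟨δ, hδ, h⟩ := Metric.uniformContinuous_iff.1 hg ε hε
  obtain ⟨K, hK⟩ := exists_nat_one_div_lt hδ
  refine ⟨K + 1, K.succ_pos, ?_⟩
  have hInt : Integrable g (cubeLaw d) := integrable_cubeLaw_of_continuous hg.continuous
  have hc := fun i => integrable_comp_cellMap K.succ_pos hInt i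
  have hclose : ∀ i : Fin d → Fin (K + 1), ∀ u ∈ hypercube d, ∀ v ∈ hypercube d,
      |g (cellMap (K + 1) i u) - g (cellMap (K + 1) i v)| ≤ ε := fun i u hu v hv => by
    rw [← Real.dist_eq]
    refine (h ((dist_cellMap_le i hu hv).trans_lt ?_)).le
    rw [← one_div]
    exact_mod_cast hK
  have hL' : (((K + 1 : ℕ) : ℝ) ^ d) ≠ 0 := by positivity
  have h1 : ∀ i : Fin d → Fin (K + 1),
      ∫ u, |g (cellMap (K + 1) i u) - cellAverage g (K + 1) i| ∂cubeLaw d ≤ ε := fun i => by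
    have hb : ∀ᵐ u ∂cubeLaw d,
        |g (cellMap (K + 1) i u) - cellAverage g (K + 1) i| ≤ ε := by
      filter_upwards [ae_cubeLaw_mem_hypercube d] with u hu
      have e : g (cellMap (K + 1) i u) - cellAverage g (K + 1) i
          = ∫ v, (g (cellMap (K + 1) i u) - g (cellMap (K + 1) i v)) ∂cubeLaw d := by
        rw [integral_sub (integrable_const _) (hc i), integral_const, probReal_univ, one_smul,
          cellAverage]
      rw [e, ← Real.norm_eq_abs]
      refine (norm_integral_le_of_norm_le_const (C := ε) ?_).trans (by simp)
      filter_upwards [ae_cubeLaw_mem_hypercube d] with v hv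
      exact hclose i u hu v hv
    have := integral_mono_ae ((hc i).sub (integrable_const _)).abs (integrable_const ε) hb
    simpa using this
  rw [cellDeviation, inv_mul_le_iff₀ (by positivity)]
  refine (Finset.sum_le_sum fun i _ => h1 i).trans (le_of_eq ?_)
  simp

/-- Density of compactly supported continuous functions in `L¹` reduces this to uniform continuity,
so no regularity of the phase density is required. -/
theorem exists_cellDeviation_le {f : (Fin d → ℝ) → ℝ} (hf : Integrable f (cubeLaw d)) {ε : ℝ}
    (hε : 0 < ε) : ∃ L : ℕ, 0 < L ∧ cellDeviation f L ≤ ε := by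
  obtain ⟨g, hgs, hfg, hgc, hgi⟩ :=
    hf.exists_hasCompactSupport_integral_sub_le (ε := ε / 4) (by positivity)
  obtain ⟨L, hL, h⟩ := exists_cellDeviation_le_of_uniformContinuous
    (hgs.uniformContinuous_of_continuous hgc) (ε := ε / 2) (by positivity)
  refine ⟨L, hL, (cellDeviation_le_add hL hf hgi).trans ?_⟩
  simp only [Real.norm_eq_abs] at hfg
  linarith

theorem abs_integral_sub_cellAverage_le (hL : 0 < L) {f φ : (Fin d → ℝ) → ℝ}
    (hf : Integrable f (cubeLaw d)) (hφ : Measurable φ) (hφ1 : ∀ x, |φ x| ≤ 1) :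
    |∫ x, f x * φ x ∂cubeLaw d
        - ∑ i : Fin d → Fin L, cellAverage f L i / (L : ℝ) ^ d * ∫ u, φ (cellMap L i u) ∂cubeLaw d|
      ≤ cellDeviation f L := by
  have hfφ : Integrable (fun x => f x * φ x) (cubeLaw d) :=
    hf.mul_bdd (c := 1) hφ.aestronglyMeasurable (Eventually.of_forall hφ1)
  have hfc := fun i => integrable_comp_cellMap hL hf (L := L) i
  have hfφc := fun i => integrable_comp_cellMap hL hfφ (L := L) i
  have hφc : ∀ i : Fin d → Fin L, Integrable (fun u => φ (cellMap L i u)) (cubeLaw d) := fun i =>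
    Integrable.of_bound (hφ.comp (continuous_cellMap i).measurable).aestronglyMeasurable 1
      (Eventually.of_forall fun u => hφ1 _)
  have e : ∑ i : Fin d → Fin L, cellAverage f L i / (L : ℝ) ^ d * ∫ u, φ (cellMap L i u) ∂cubeLaw d
      = ((L : ℝ) ^ d)⁻¹ *
        ∑ i : Fin d → Fin L, cellAverage f L i * ∫ u, φ (cellMap L i u) ∂cubeLaw d := by
    rw [Finset.mul_sum]
    exact Finset.sum_congr rfl fun i _ => by ring
  rw [integral_cubeLaw_eq_sum hL hfφ, e, ← mul_sub, ← Finset.sum_sub_distrib, cellDeviation, abs_mul,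
    abs_of_nonneg (by positivity : (0 : ℝ) ≤ ((L : ℝ) ^ d)⁻¹)]
  refine mul_le_mul_of_nonneg_left ((Finset.abs_sum_le_sum_abs _ _).trans
    (Finset.sum_le_sum fun i _ => ?_)) (by positivity)
  rw [← integral_const_mul, ← integral_sub (hfφc i) ((hφc i).const_mul _)]
  refine abs_integral_le_integral_abs.trans ?_
  refine integral_mono ((hfφc i).sub ((hφc i).const_mul _)).abs
    ((hfc i).sub (integrable_const _)).abs fun u => ?_
  change |f _ * φ _ - _ * φ _| ≤ _
  rw [← sub_mul, abs_mul]
  exact mul_le_of_le_one_right (abs_nonneg _) (hφ1 _)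

/-- Used to turn the sum of the cell contributions into an integral over the cube. The Lipschitz
bound is asked on the half-line only, where the limit defect is defined as a limit. -/
theorem abs_sum_cellAverage_sub_integral_le (hL : 0 < L) {f : (Fin d → ℝ) → ℝ}
    (hf : Integrable f (cubeLaw d)) (hf0 : ∀ x, 0 ≤ f x) {H : ℝ → ℝ} {C : ℝ}
    (hH : ∀ a b, 0 ≤ a → 0 ≤ b → |H a - H b| ≤ C * |a - b|)
    (hHf : Integrable (fun x => H (f x)) (cubeLaw d)) :
    |((L : ℝ) ^ d)⁻¹ * ∑ i : Fin d → Fin L, H (cellAverage f L i) - ∫ x, H (f x) ∂cubeLaw d|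
      ≤ C * cellDeviation f L := by
  have hfc := fun i => integrable_comp_cellMap hL hf (L := L) i
  have hHc := fun i => integrable_comp_cellMap hL hHf (L := L) i
  rw [integral_cubeLaw_eq_sum hL hHf, ← mul_sub, ← Finset.sum_sub_distrib, cellDeviation, abs_mul,
    abs_of_nonneg (by positivity : (0 : ℝ) ≤ ((L : ℝ) ^ d)⁻¹), mul_left_comm]
  refine mul_le_mul_of_nonneg_left ((Finset.abs_sum_le_sum_abs _ _).trans ?_) (by positivity)
  rw [Finset.mul_sum]
  refine Finset.sum_le_sum fun i _ => ?_
  have e : H (cellAverage f L i) = ∫ _u : Fin d → ℝ, H (cellAverage f L i) ∂cubeLaw d := by simp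
  rw [e, ← integral_sub (integrable_const _) (hHc i), ← integral_const_mul]
  refine abs_integral_le_integral_abs.trans ?_
  refine integral_mono ((integrable_const _).sub (hHc i)).abs
    (((hfc i).sub (integrable_const _)).abs.const_mul C) fun u => ?_
  change |H _ - H _| ≤ C * |_ - _|
  rw [abs_sub_comm (f _)]
  exact hH _ _ (integral_nonneg fun u => hf0 _) (hf0 _)

theorem sum_cellAverage (hL : 0 < L) {f : (Fin d → ℝ) → ℝ} (hf : Integrable f (cubeLaw d)) :
    ∑ i : Fin d → Fin L, cellAverage f L i / (L : ℝ) ^ d = ∫ x, f x ∂cubeLaw d := by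
  rw [integral_cubeLaw_eq_sum hL hf, Finset.mul_sum]
  exact Finset.sum_congr rfl fun i _ => by rw [cellAverage]; ring

end CellAverage

end

noncomputable section

open scoped ComplexOrder

/-! ### The limit of the normalized defect for an arbitrary density. -/

section PhaseLaw

variable {d : ℕ} {f : (Fin d → ℝ) → ℝ}

theorem integral_phaseLaw (hf : Measurable f) (hf0 : ∀ x, 0 ≤ f x) (φ : (Fin d → ℝ) → ℝ) :
    ∫ x, φ x ∂phaseLaw d f = ∫ x, f x * φ x ∂cubeLaw d := by
  rw [phaseLaw, integral_withDensity_eq_integral_toReal_smul hf.ennreal_ofReal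
    (Eventually.of_forall fun x => ENNReal.ofReal_lt_top), cubeLaw]
  simp only [ENNReal.toReal_ofReal (hf0 _), smul_eq_mul]

theorem isProbabilityMeasure_phaseLaw (hf : Integrable f (cubeLaw d)) (hf0 : ∀ x, 0 ≤ f x)
    (hf1 : ∫ x, f x ∂cubeLaw d = 1) : IsProbabilityMeasure (phaseLaw d f) := by
  have h := ofReal_integral_eq_lintegral_ofReal hf (Eventually.of_forall hf0)
  rw [hf1, ENNReal.ofReal_one] at h
  exact ⟨by rw [phaseLaw, withDensity_apply _ MeasurableSet.univ, Measure.restrict_univ]; exact h.symm⟩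

variable {L : ℕ}

theorem abs_integral_map_weightedVec_sub_le (hL : 0 < L) (hfm : Measurable f)
    (hf : Integrable f (cubeLaw d)) (hf0 : ∀ x, 0 ≤ f x) (n : ℕ) (s : ℝ)
    {φ : ((Fin d → Fin n) → ℂ) → ℝ} (hφ : Measurable φ) (hφ1 : ∀ w, |φ w| ≤ 1) :
    |∫ w, φ w ∂(phaseLaw d f).map (weightedVec d n s)
        - ∫ w, φ w ∂((cellLaw fun i : Fin d → Fin L =>
            cellAverage f L i / (L : ℝ) ^ d).map cellPoint).map (weightedVec d n s)|
      ≤ cellDeviation f L := by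
  have hw := measurable_weightedVec d n s
  have hq : ∀ i : Fin d → Fin L, 0 ≤ cellAverage f L i / (L : ℝ) ^ d := fun i =>
    div_nonneg (integral_nonneg fun u => hf0 _) (by positivity)
  rw [integral_map hw.aemeasurable hφ.aestronglyMeasurable,
    integral_map hw.aemeasurable hφ.aestronglyMeasurable,
    integral_map (f := fun x => φ (weightedVec d n s x)) measurable_cellPoint.aemeasurable
      (hφ.comp hw).aestronglyMeasurable,
    integral_phaseLaw hfm hf0, integral_cellLaw
      (φ := fun z => φ (weightedVec d n s (cellPoint z))) hq
      (hφ.comp (hw.comp measurable_cellPoint)) (fun z => hφ1 _)]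
  exact abs_integral_sub_cellAverage_le hL hf (hφ.comp hw) fun x => hφ1 _

/-- Replacing a density by its cell averages, and `n` rows by `n' ≤ n` rows. -/
theorem abs_integral_phaseDefect_sub_cells_le (hL : 0 < L) (hfm : Measurable f)
    (hf : Integrable f (cubeLaw d)) (hf0 : ∀ x, 0 ≤ f x) (hf1 : ∫ x, f x ∂cubeLaw d = 1)
    (p m : ℕ) {n n' : ℕ} (hn : n' ≤ n) {s : ℝ} (hs : 0 ≤ s) :
    |∫ x, phaseDefect p d n s x ∂(Measure.pi fun _ : Fin m => phaseLaw d f)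
        - ∫ ω, phaseDefect p d n' s (fun r => cellPoint (ω r))
          ∂(Measure.pi fun _ : Fin m => cellLaw fun i : Fin d → Fin L =>
            cellAverage f L i / (L : ℝ) ^ d)|
      ≤ p * ((n : ℝ) ^ d - (n' : ℝ) ^ d) + m * (p * cellDeviation f L) := by
  have hμ := isProbabilityMeasure_phaseLaw hf hf0 hf1
  have hq : ∀ i : Fin d → Fin L, 0 ≤ cellAverage f L i / (L : ℝ) ^ d := fun i =>
    div_nonneg (integral_nonneg fun u => hf0 _) (by positivity)
  have hq1 := (sum_cellAverage hL hf).trans hf1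
  have h1 := isProbabilityMeasure_cellLaw hq hq1
  have h2 : IsProbabilityMeasure ((cellLaw fun i : Fin d → Fin L =>
      cellAverage f L i / (L : ℝ) ^ d).map cellPoint) :=
    Measure.isProbabilityMeasure_map measurable_cellPoint.aemeasurable
  refine (abs_sub_le _ (∫ x, phaseDefect p d n' s x ∂(Measure.pi fun _ : Fin m => phaseLaw d f))
    _).trans (add_le_add ?_ ?_)
  · rw [← integral_sub (integrable_phaseDefect p d n hs m _) (integrable_phaseDefect p d n' hs m _)]
    exact abs_integral_le_of_forall_abs_le fun x => abs_phaseDefect_sub_le_rows p d hn hs x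
  · rw [integral_phaseDefect_cellPoint hq hq1 p n' m hs, integral_phaseDefect_eq_meanDefect p d n' hs,
      integral_phaseDefect_eq_meanDefect p d n' hs]
    exact abs_meanDefect_sub_le_of_law PosSemidef.zero p m fun φ hφ hφ1 =>
      abs_integral_map_weightedVec_sub_le hL hfm hf hf0 n' s hφ hφ1

theorem tendsto_floor_div_mul_div (hL : 0 < L) {N : ℕ → ℕ} (hN : Tendsto N atTop atTop) :
    Tendsto (fun j => ((N j / L * L : ℕ) : ℝ) / N j) atTop (𝓝 1) := by
  have hN' : Tendsto (fun j => (N j : ℝ)) atTop atTop := tendsto_natCast_atTop_atTop.comp hN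
  have h1 : Tendsto (fun j => 1 - (L : ℝ) / N j) atTop (𝓝 1) := by
    simpa using (hN'.const_div_atTop (L : ℝ)).const_sub 1
  refine tendsto_of_tendsto_of_tendsto_of_le_of_le' h1 tendsto_const_nhds ?_ ?_
  · filter_upwards [hN.eventually_ge_atTop 1] with j hj
    have hj' : (0 : ℝ) < N j := by exact_mod_cast hj
    rw [le_div_iff₀ hj', sub_mul, div_mul_cancel₀ _ hj'.ne', one_mul, sub_le_iff_le_add]
    have h := Nat.div_add_mod (N j) L
    have h' := Nat.mod_lt (N j) hL
    have : N j ≤ N j / L * L + L := by rw [mul_comm]; omega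
    exact_mod_cast this
  · filter_upwards with j
    exact div_le_one_of_le₀ (by exact_mod_cast Nat.div_mul_le_self _ _) (Nat.cast_nonneg _)

theorem abs_limitDefect_div_sub_le (p : ℕ) (hd : 1 ≤ d) {β : ℝ} (hβ : 0 < β) {a b : ℝ}
    (ha : 0 ≤ a) (hb : 0 ≤ b) :
    |limitDefect p d (a / β) β - limitDefect p d (b / β) β| ≤ p / β * |a - b| := by
  refine (abs_limitDefect_sub_le p hd (by positivity) (by positivity) hβ.le).trans (le_of_eq ?_)
  rw [← sub_div, abs_div, abs_of_pos hβ]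
  ring

theorem measurable_limitDefect_comp (p : ℕ) (hd : 1 ≤ d) {β : ℝ} (hβ : 0 < β)
    {X : Type*} [MeasurableSpace X] {g : X → ℝ} (hg : Measurable g) (hg0 : ∀ x, 0 ≤ g x) :
    Measurable fun x => limitDefect p d (g x / β) β := by
  -- The Lipschitz estimate is known for nonnegative arguments only; precomposing with `max · 0`
  -- gives a continuous function on the line with the same values at `g x`.
  have hK : LipschitzWith (Real.toNNReal (p / β))
      fun b : ℝ => limitDefect p d (max b 0 / β) β := by
    refine LipschitzWith.of_dist_le_mul fun a b => ?_
    rw [Real.dist_eq, Real.dist_eq, Real.coe_toNNReal _ (by positivity)]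
    exact (abs_limitDefect_div_sub_le p hd hβ (le_max_right _ _) (le_max_right _ _)).trans
      (mul_le_mul_of_nonneg_left (abs_max_sub_max_le_abs a b 0) (by positivity))
  have h := hK.continuous.measurable.comp hg
  have e : (fun x => limitDefect p d (g x / β) β)
      = (fun b : ℝ => limitDefect p d (max b 0 / β) β) ∘ g :=
    funext fun x => by rw [Function.comp_apply, max_eq_left (hg0 x)]
  rw [e]
  exact h

theorem integrable_limitDefect_comp (p : ℕ) (hd : 1 ≤ d) {β : ℝ} (hβ : 0 < β)
    (hfm : Measurable f) (hf : Integrable f (cubeLaw d)) (hf0 : ∀ x, 0 ≤ f x) :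
    Integrable (fun x => limitDefect p d (f x / β) β) (cubeLaw d) := by
  refine (hf.const_mul (p / β)).mono'
    (measurable_limitDefect_comp p hd hβ hfm hf0).aestronglyMeasurable
    (Eventually.of_forall fun x => ?_)
  have h := abs_limitDefect_div_sub_le p hd hβ (hf0 x) le_rfl
  rw [zero_div, limitDefect_zero_left p hd hβ.le, sub_zero, sub_zero, abs_of_nonneg (hf0 x)] at h
  exact h

/-- The number `L` of cells per side is fixed first, making the `L¹` error small; then `N → ∞` with
the scale `k = ⌊N / L⌋` inside the cells. In the cell `c` there are about `cellAverage f L c / β`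
points per dimension, and the weight times the dimension still tends to `β`. -/
theorem tendsto_integral_phaseDefect_div_of_nonneg (p : ℕ) (hd : 1 ≤ d) {β : ℝ} (hβ : 0 < β)
    (hfm : Measurable f) (hf : Integrable f (cubeLaw d)) (hf0 : ∀ x, 0 ≤ f x)
    (hf1 : ∫ x, f x ∂cubeLaw d = 1) {N M : ℕ → ℕ} (hN : Tendsto N atTop atTop)
    (hM : Tendsto M atTop atTop)
    (hNM : Tendsto (fun j => (N j : ℝ) ^ d / (M j : ℝ)) atTop (𝓝 β)) :
    Tendsto (fun j => (∫ x, phaseDefect p d (N j) (1 / M j) x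
      ∂(Measure.pi fun _ : Fin (M j) => phaseLaw d f)) / (N j : ℝ) ^ d) atTop
      (𝓝 (∫ x, limitDefect p d (f x / β) β ∂cubeLaw d)) := by
  rw [Metric.tendsto_nhds]
  intro ε hε
  obtain ⟨L, hL, hδ⟩ := exists_cellDeviation_le hf
    (by positivity : 0 < ε / (4 * (p / β + 1)))
  set δ := cellDeviation f L with hδdef
  -- The quantity `p / β * δ` is paid twice: once for replacing the law of the sample, in the limit
  -- of `M / N ^ d`, and once for replacing the Riemann sum by the integral.
  have hδε : p / β * δ < ε / 2 := by
    have hpos : 0 < p / β + 1 := by positivity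
    calc p / β * δ ≤ p / β * (ε / (4 * (p / β + 1))) := by gcongr
      _ ≤ (p / β + 1) * (ε / (4 * (p / β + 1))) := by gcongr; linarith
      _ = ε / 4 := by field_simp
      _ < ε / 2 := by linarith
  have hLp : (0 : ℝ) < (L : ℝ) ^ d := pow_pos (by exact_mod_cast hL) d
  set q : (Fin d → Fin L) → ℝ := fun i => cellAverage f L i / (L : ℝ) ^ d with hqdef
  have havg : ∀ i : Fin d → Fin L, 0 ≤ cellAverage f L i := fun i => integral_nonneg fun u => hf0 _
  have hq : ∀ i, 0 ≤ q i := fun i => div_nonneg (havg i) hLp.le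
  have hq1 : ∑ i, q i = 1 := (sum_cellAverage hL hf).trans hf1
  have hqle : ∀ i, q i ≤ 1 := fun i => hq1 ▸ Finset.single_le_sum (fun j _ => hq j)
    (Finset.mem_univ i)
  set k : ℕ → ℕ := fun j => N j / L with hkdef
  set r : ℕ → ℝ := fun j => (((k j * L : ℕ) : ℝ) / N j) ^ d with hrdef
  have hk : Tendsto k atTop atTop := (Nat.tendsto_div_const_atTop hL.ne').comp hN
  have hr : Tendsto r atTop (𝓝 1) := by
    have h := (tendsto_floor_div_mul_div hL hN).pow d
    rw [one_pow] at h
    exact h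
  have hMN : Tendsto (fun j => (M j : ℝ) / (N j : ℝ) ^ d) atTop (𝓝 β⁻¹) :=
    (hNM.inv₀ hβ.ne').congr fun j => inv_div _ _
  have hpos : ∀ᶠ j in atTop, 0 < N j ∧ 0 < M j ∧ 0 < k j :=
    (hN.eventually_gt_atTop 0).and ((hM.eventually_gt_atTop 0).and (hk.eventually_gt_atTop 0))
  have hkL : ∀ j, ((k j * L : ℕ) : ℝ) ^ d = (k j : ℝ) ^ d * (L : ℝ) ^ d := fun j => by
    rw [Nat.cast_mul, mul_pow]
  have hMk : Tendsto (fun j => (M j : ℝ) / ((k j * L : ℕ) : ℝ) ^ d) atTop (𝓝 β⁻¹) := by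
    have h := hMN.div hr one_ne_zero
    rw [div_one] at h
    refine h.congr' ?_
    filter_upwards [hpos] with j hj
    have hNp : (N j : ℝ) ≠ 0 := by exact_mod_cast hj.1.ne'
    have hkLp : ((k j * L : ℕ) : ℝ) ≠ 0 := by exact_mod_cast (Nat.mul_pos hj.2.2 hL).ne'
    simp only [hrdef, Pi.div_apply, div_pow]
    field_simp
  have hkM : Tendsto (fun j => 1 / (M j : ℝ) * ((k j * L : ℕ) : ℝ) ^ d) atTop (𝓝 β) := by
    have h := hMk.inv₀ (inv_ne_zero hβ.ne')
    rw [inv_inv] at h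
    exact h.congr fun j => by rw [inv_div, one_div_mul_eq_div]
  set Z : ℕ → ℝ := fun j => ((L : ℝ) ^ d)⁻¹ *
    ∑ c, uniformDefect p d (k j) ⌊M j * q c⌋₊ (1 / M j * (L : ℝ) ^ d) / (k j : ℝ) ^ d with hZdef
  have hZ : Tendsto Z atTop (𝓝 (((L : ℝ) ^ d)⁻¹ *
      ∑ c, limitDefect p d (cellAverage f L c / β) β)) := by
    refine (tendsto_finsetSum _ fun c _ => ?_).const_mul _
    refine tendsto_uniformDefect_div p hd (div_nonneg (havg c) hβ.le) hβ.le
      (fun j => by positivity) hk ?_ ?_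
    · have h1 : Tendsto (fun j => (⌊q c * M j⌋₊ : ℝ) / M j) atTop (𝓝 (q c)) :=
        (tendsto_nat_floor_mul_div_atTop (hq c)).comp (tendsto_natCast_atTop_atTop.comp hM)
      have h2 := (h1.mul hMk).mul_const ((L : ℝ) ^ d)
      have e : q c * β⁻¹ * (L : ℝ) ^ d = cellAverage f L c / β := by
        simp only [hqdef]
        field_simp
      rw [e] at h2
      refine h2.congr' ?_
      filter_upwards [hpos] with j hj
      have hMp : (M j : ℝ) ≠ 0 := by exact_mod_cast hj.2.1.ne'
      have hkp : (k j : ℝ) ^ d ≠ 0 := pow_ne_zero _ (by exact_mod_cast hj.2.2.ne')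
      rw [hkL, mul_comm (q c)]
      field_simp
    · refine hkM.congr fun j => ?_
      rw [hkL]
      ring
  -- One constant for three requirements: the three summands bound the density on the cells (as `q i
  -- ≤ 1`), the points per dimension and the normalized weight.
  set R : ℝ := (L : ℝ) ^ d + (β⁻¹ + 1) + (β + 1) with hRdef
  have hβi : 0 < β⁻¹ := inv_pos.2 hβ
  have hbound : Tendsto (fun j => p * (1 - r j) + (M j : ℝ) / (N j : ℝ) ^ d * (p * δ)
      + r j * cellError p d R (k j) + |r j * Z j - ((L : ℝ) ^ d)⁻¹ *
      ∑ c, limitDefect p d (cellAverage f L c / β) β|) atTop (𝓝 (p / β * δ)) := by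
    have h1 := (hr.const_sub 1).const_mul (p : ℝ)
    have h2 := hMN.mul_const (p * δ)
    have h3 := hr.mul ((tendsto_cellError p hd R).comp hk)
    have h4 := ((hr.mul hZ).sub_const (((L : ℝ) ^ d)⁻¹ *
      ∑ c, limitDefect p d (cellAverage f L c / β) β)).abs
    have h5 := ((h1.add h2).add h3).add h4
    simp only [sub_self, mul_zero, one_mul, abs_zero, add_zero, zero_add] at h5
    have e : β⁻¹ * (p * δ) = p / β * δ := by ring
    rw [e] at h5
    exact h5
  filter_upwards [hpos, (tendsto_order.1 hbound).2 _ hδε,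
    (tendsto_order.1 hMk).2 (β⁻¹ + 1) (by linarith),
    (tendsto_order.1 hkM).2 (β + 1) (by linarith)] with j hj hj1 hj2 hj3
  have hNp : (0 : ℝ) < (N j : ℝ) ^ d := pow_pos (by exact_mod_cast hj.1) d
  have hkLp : (0 : ℝ) < ((k j * L : ℕ) : ℝ) ^ d :=
    pow_pos (by exact_mod_cast Nat.mul_pos hj.2.2 hL) d
  have hcell := abs_normalized_phaseDefect_cells_sub_le hL hq hq1 (R := R) (by positivity)
    (fun i => (hqle i).trans (by rw [le_div_iff₀ hLp, one_mul]; linarith)) p hj.2.2 (m := M j)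
    (s := 1 / M j) (by positivity) (by
      rw [div_lt_iff₀ hkLp] at hj2
      refine hj2.le.trans (mul_le_mul_of_nonneg_right ?_ hkLp.le)
      linarith) (hj3.le.trans (by linarith))
  have hrow := abs_integral_phaseDefect_sub_cells_le hL hfm hf hf0 hf1 p (M j)
    (Nat.div_mul_le_self (N j) L) (s := 1 / M j) (by positivity)
  have hfin := abs_sum_cellAverage_sub_integral_le hL hf hf0
    (H := fun b => limitDefect p d (b / β) β)
    (fun a b ha hb => abs_limitDefect_div_sub_le p hd hβ ha hb)
    (integrable_limitDefect_comp p hd hβ hfm hf hf0)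
  set I := ∫ x, phaseDefect p d (N j) (1 / M j) x
      ∂(Measure.pi fun _ : Fin (M j) => phaseLaw d f) with hI
  change |I - ∫ ω, phaseDefect p d (k j * L) (1 / M j) (fun r => cellPoint (ω r))
    ∂(Measure.pi fun _ : Fin (M j) => cellLaw q)| ≤ p * ((N j : ℝ) ^ d - ((k j * L : ℕ) : ℝ) ^ d)
      + M j * (p * δ) at hrow
  set J := ∫ ω, phaseDefect p d (k j * L) (1 / M j) (fun r => cellPoint (ω r))
    ∂(Measure.pi fun _ : Fin (M j) => cellLaw q) with hJ
  change |J / ((k j * L : ℕ) : ℝ) ^ d - Z j| ≤ _ at hcell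
  have hrj : r j = ((k j * L : ℕ) : ℝ) ^ d / (N j : ℝ) ^ d := div_pow _ _ _
  have hr0 : 0 ≤ r j := by rw [hrj]; positivity
  have e1 : |I / (N j : ℝ) ^ d - J / (N j : ℝ) ^ d|
      ≤ p * (1 - r j) + (M j : ℝ) / (N j : ℝ) ^ d * (p * δ) := by
    rw [← sub_div, abs_div, abs_of_pos hNp, div_le_iff₀ hNp]
    refine hrow.trans (le_of_eq ?_)
    rw [hrj]
    field_simp
  have e2 : |J / (N j : ℝ) ^ d - r j * Z j| ≤ r j * cellError p d R (k j) := by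
    have : J / (N j : ℝ) ^ d - r j * Z j = r j * (J / ((k j * L : ℕ) : ℝ) ^ d - Z j) := by
      rw [mul_sub, hrj]
      congr 1
      field_simp
    rw [this, abs_mul, abs_of_nonneg hr0]
    exact mul_le_mul_of_nonneg_left hcell hr0
  rw [Real.dist_eq]
  have t1 := abs_sub_le (I / (N j : ℝ) ^ d) (J / (N j : ℝ) ^ d)
    (∫ x, limitDefect p d (f x / β) β ∂cubeLaw d)
  have t2 := abs_sub_le (J / (N j : ℝ) ^ d) (r j * Z j)
    (∫ x, limitDefect p d (f x / β) β ∂cubeLaw d)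
  have t3 := abs_sub_le (r j * Z j) (((L : ℝ) ^ d)⁻¹ *
    ∑ c, limitDefect p d (cellAverage f L c / β) β) (∫ x, limitDefect p d (f x / β) β ∂cubeLaw d)
  linarith

theorem IsPhaseDensity.integrable_max (hf : IsPhaseDensity d f) :
    Integrable (fun x => max (f x) 0) (cubeLaw d) := by
  have h := integrable_toReal_of_lintegral_ne_top (μ := cubeLaw d)
    hf.measurable.ennreal_ofReal.aemeasurable (by
      rw [cubeLaw, hf.lintegral_eq_one]; exact ENNReal.one_ne_top)
  simpa only [ENNReal.toReal_ofReal'] using h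

theorem IsPhaseDensity.integral_max (hf : IsPhaseDensity d f) :
    ∫ x, max (f x) 0 ∂cubeLaw d = 1 := by
  have h := integral_toReal (μ := cubeLaw d) hf.measurable.ennreal_ofReal.aemeasurable
    (Eventually.of_forall fun x => ENNReal.ofReal_lt_top)
  simp only [ENNReal.toReal_ofReal'] at h
  rw [h, cubeLaw, hf.lintegral_eq_one, ENNReal.toReal_one]

/-- A phase density may be negative outside the cube; truncating it gives a function nonnegative
everywhere with the same law. -/
theorem phaseLaw_max (f : (Fin d → ℝ) → ℝ) : phaseLaw d (fun x => max (f x) 0) = phaseLaw d f := by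
  simp only [phaseLaw, ENNReal.ofReal_max, ENNReal.ofReal_zero, max_eq_left zero_le]

theorem IsPhaseDensity.isProbabilityMeasure (hf : IsPhaseDensity d f) :
    IsProbabilityMeasure (phaseLaw d f) := by
  rw [← phaseLaw_max]
  exact isProbabilityMeasure_phaseLaw hf.integrable_max (fun x => le_max_right _ _) hf.integral_max

theorem IsPhaseDensity.integral_limitDefect_max (hf : IsPhaseDensity d f) (p : ℕ) (β : ℝ) :
    ∫ x, limitDefect p d (max (f x) 0 / β) β ∂cubeLaw d
      = ∫ x, limitDefect p d (f x / β) β ∂cubeLaw d := by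
  refine integral_congr_ae ?_
  filter_upwards [ae_cubeLaw_mem_hypercube d] with x hx
  rw [max_eq_left (hf.nonneg x hx)]

theorem tendsto_integral_phaseDefect_div (p : ℕ) (hd : 1 ≤ d) {β : ℝ} (hβ : 0 < β)
    (hf : IsPhaseDensity d f) {N M : ℕ → ℕ} (hN : Tendsto N atTop atTop)
    (hM : Tendsto M atTop atTop)
    (hNM : Tendsto (fun j => (N j : ℝ) ^ d / (M j : ℝ)) atTop (𝓝 β)) :
    Tendsto (fun j => (∫ x, phaseDefect p d (N j) (1 / M j) x
      ∂(Measure.pi fun _ : Fin (M j) => phaseLaw d f)) / (N j : ℝ) ^ d) atTop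
      (𝓝 (∫ x, limitDefect p d (f x / β) β ∂cubeLaw d)) := by
  rw [← phaseLaw_max, ← hf.integral_limitDefect_max]
  exact tendsto_integral_phaseDefect_div_of_nonneg p hd hβ (hf.measurable.max measurable_const)
    hf.integrable_max (fun x => le_max_right _ _) hf.integral_max hN hM hNM

end PhaseLaw

end

noncomputable section

/-! ### From resolvent moments to distribution functions. -/

section ResolventWeight

/-- The weight `1 / (1 + t)`, extended by `1` to the negative half-line. -/
def resolventWeight (t : ℝ) : ℝ := (1 + max t 0)⁻¹

theorem continuous_resolventWeight : Continuous resolventWeight :=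
  (by fun_prop : Continuous fun t : ℝ => 1 + max t 0).inv₀ fun t => by positivity

theorem resolventWeight_mem_Icc (t : ℝ) : resolventWeight t ∈ Set.Icc (0 : ℝ) 1 :=
  ⟨by unfold resolventWeight; positivity,
    inv_le_one_of_one_le₀ (le_add_of_nonneg_right (le_max_right _ _))⟩

theorem resolventWeight_max (t : ℝ) : resolventWeight (max t 0) = resolventWeight t := by
  simp [resolventWeight]

theorem resolventWeight_le_iff {s t : ℝ} (ht : 0 ≤ t) :
    resolventWeight t ≤ resolventWeight s ↔ s ≤ t := by
  rw [resolventWeight, resolventWeight, inv_le_inv₀ (by positivity) (by positivity),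
    add_le_add_iff_left, max_eq_left ht, max_le_iff]
  exact and_iff_left ht

variable {H : ℝ → ℝ}

theorem continuous_comp_resolventWeight (hH : ContinuousOn H (Set.Icc 0 1)) :
    Continuous fun t => H (resolventWeight t) :=
  hH.comp_continuous continuous_resolventWeight resolventWeight_mem_Icc

theorem integrable_comp_resolventWeight (hH : ContinuousOn H (Set.Icc 0 1)) (μ : Measure ℝ)
    [IsFiniteMeasure μ] : Integrable (fun t => H (resolventWeight t)) μ := by
  obtain ⟨C, hC⟩ := isCompact_Icc.exists_bound_of_continuousOn hH
  exact Integrable.of_bound (continuous_comp_resolventWeight hH).aestronglyMeasurable C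
    (Eventually.of_forall fun t => hC _ (resolventWeight_mem_Icc t))

theorem integrable_resolventWeight_pow (p : ℕ) (μ : Measure ℝ) [IsFiniteMeasure μ] :
    Integrable (fun t => resolventWeight t ^ p) μ :=
  integrable_comp_resolventWeight (H := fun w => w ^ p) (by fun_prop) μ

theorem integral_eval_resolventWeight (P : Polynomial ℝ) (μ : Measure ℝ) [IsFiniteMeasure μ] :
    ∫ t, P.eval (resolventWeight t) ∂μ
      = ∑ i ∈ Finset.range (P.natDegree + 1), P.coeff i * ∫ t, resolventWeight t ^ i ∂μ := by
  simp only [Polynomial.eval_eq_sum_range]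
  rw [integral_finsetSum _ fun i _ => (integrable_resolventWeight_pow i μ).const_mul _]
  simp only [integral_const_mul]

theorem abs_integral_eval_resolventWeight_sub_le (hH : ContinuousOn H (Set.Icc 0 1))
    {P : Polynomial ℝ} {ε : ℝ} (hP : ∀ w ∈ Set.Icc (0 : ℝ) 1, |P.eval w - H w| < ε)
    (μ : Measure ℝ) [IsProbabilityMeasure μ] :
    |∫ t, P.eval (resolventWeight t) ∂μ - ∫ t, H (resolventWeight t) ∂μ| ≤ ε := by
  rw [← integral_sub (integrable_comp_resolventWeight P.continuous.continuousOn μ)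
    (integrable_comp_resolventWeight hH μ)]
  exact abs_integral_le_of_forall_abs_le fun t => (hP _ (resolventWeight_mem_Icc t)).le

/-- Weierstrass approximation on `[0, 1]`: the error is uniform over all probability measures, so
convergence passes from powers to continuous functions of the weight. -/
theorem tendsto_integral_comp_resolventWeight {ι : Type*} {l : Filter ι} {μ : ι → Measure ℝ}
    [∀ i, IsProbabilityMeasure (μ i)] {ν : Measure ℝ} [IsProbabilityMeasure ν]
    (h : ∀ p : ℕ, Tendsto (fun i => ∫ t, resolventWeight t ^ p ∂μ i) l
      (𝓝 (∫ t, resolventWeight t ^ p ∂ν))) (hH : ContinuousOn H (Set.Icc 0 1)) :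
    Tendsto (fun i => ∫ t, H (resolventWeight t) ∂μ i) l (𝓝 (∫ t, H (resolventWeight t) ∂ν)) := by
  rw [Metric.tendsto_nhds]
  intro ε hε
  obtain ⟨P, hP⟩ := exists_polynomial_near_of_continuousOn 0 1 H hH (ε / 3) (by positivity)
  have h1 : Tendsto (fun i => ∫ t, P.eval (resolventWeight t) ∂μ i) l
      (𝓝 (∫ t, P.eval (resolventWeight t) ∂ν)) := by
    simp only [integral_eval_resolventWeight]
    exact tendsto_finsetSum _ fun i _ => (h i).const_mul _
  filter_upwards [Metric.tendsto_nhds.1 h1 (ε / 3) (by positivity)] with i hi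
  have h2 := abs_integral_eval_resolventWeight_sub_le hH hP (μ i)
  have h3 := abs_integral_eval_resolventWeight_sub_le hH hP ν
  rw [Real.dist_eq, abs_lt] at hi ⊢
  rw [abs_le] at h2 h3
  constructor <;> linarith [hi.1, hi.2, h2.1, h2.2, h3.1, h3.2]

theorem measurable_integral_comp_resolventWeight {X : Type*} [MeasurableSpace X]
    {κ : X → Measure ℝ} [∀ x, IsProbabilityMeasure (κ x)]
    (h : ∀ p : ℕ, Measurable fun x => ∫ t, resolventWeight t ^ p ∂κ x)
    (hH : ContinuousOn H (Set.Icc 0 1)) :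
    Measurable fun x => ∫ t, H (resolventWeight t) ∂κ x := by
  choose P hP using fun n : ℕ => exists_polynomial_near_of_continuousOn 0 1 H hH (1 / ((n : ℝ) + 1))
    (by positivity)
  refine measurable_of_tendsto_metrizable
    (f := fun n x => ∫ t, (P n).eval (resolventWeight t) ∂κ x) (fun n => ?_) ?_
  · simp only [integral_eval_resolventWeight]
    exact Finset.measurable_sum _ fun i _ => (h i).const_mul _
  · rw [tendsto_pi_nhds]
    intro x
    rw [tendsto_iff_dist_tendsto_zero]
    exact squeeze_zero (fun n => dist_nonneg)
      (fun n => abs_integral_eval_resolventWeight_sub_le hH (hP n) (κ x))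
      tendsto_one_div_add_atTop_nhds_zero_nat

/-- The continuous function equal to `0` on `(-∞, a]`, to `1` on `[b, ∞)` and affine between. -/
def ramp (a b w : ℝ) : ℝ := max 0 (min 1 ((w - a) / (b - a)))

theorem continuous_ramp (a b : ℝ) : Continuous (ramp a b) := by
  unfold ramp
  fun_prop

/-- As the weight decreases on the half-line, the ramp of the weight is `1` up to `z` and `0` beyond
`z + δ`; it lies between the two indicator functions. -/
theorem measureReal_Iic_le_integral_ramp {z δ : ℝ} (hz : 0 ≤ z) (hδ : 0 < δ) (μ : Measure ℝ)
    [IsProbabilityMeasure μ] :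
    μ.real (Set.Iic z)
      ≤ ∫ t, ramp (resolventWeight (z + δ)) (resolventWeight z) (resolventWeight t) ∂μ := by
  rw [← integral_indicator_one measurableSet_Iic]
  refine integral_mono ((integrable_const 1).indicator measurableSet_Iic)
    (integrable_comp_resolventWeight (continuous_ramp _ _).continuousOn μ) fun t => ?_
  have hab : resolventWeight (z + δ) < resolventWeight z := by
    rw [← not_le, resolventWeight_le_iff hz]
    linarith
  by_cases ht : t ∈ Set.Iic z
  · rw [Set.indicator_of_mem ht, Pi.one_apply, ramp, min_eq_left]
    · exact le_max_right _ _
    · rw [le_div_iff₀ (sub_pos.2 hab), one_mul]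
      have := (resolventWeight_le_iff hz).2 ht
      linarith
  · rw [Set.indicator_of_notMem ht]
    exact le_max_left _ _

theorem integral_ramp_le_measureReal_Iic {z δ : ℝ} (hz : 0 ≤ z) (hδ : 0 < δ) (μ : Measure ℝ)
    [IsProbabilityMeasure μ] :
    ∫ t, ramp (resolventWeight (z + δ)) (resolventWeight z) (resolventWeight t) ∂μ
      ≤ μ.real (Set.Iic (z + δ)) := by
  rw [← integral_indicator_one measurableSet_Iic]
  refine integral_mono (integrable_comp_resolventWeight (continuous_ramp _ _).continuousOn μ)
    ((integrable_const 1).indicator measurableSet_Iic) fun t => ?_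
  have hab : resolventWeight (z + δ) < resolventWeight z := by
    rw [← not_le, resolventWeight_le_iff hz]
    linarith
  by_cases ht : t ∈ Set.Iic (z + δ)
  · rw [Set.indicator_of_mem ht, Pi.one_apply]
    exact max_le zero_le_one (min_le_left _ _)
  · rw [Set.indicator_of_notMem ht]
    refine max_le le_rfl (min_le_of_right_le (div_nonpos_of_nonpos_of_nonneg ?_ (by linarith)))
    have : ¬ resolventWeight (z + δ) ≤ resolventWeight t := by
      rwa [resolventWeight_le_iff (by linarith)]
    linarith

theorem measureReal_Iic_of_neg {μ : Measure ℝ} (h0 : μ (Set.Iio 0) = 0) {z : ℝ} (hz : z < 0) :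
    μ.real (Set.Iic z) = 0 := by
  rw [measureReal_def, measure_mono_null (Set.Iic_subset_Iio.2 hz) h0, ENNReal.toReal_zero]

/-- Convergence of the resolvent moments implies convergence of the distribution functions. -/
theorem tendsto_measureReal_Iic {ι : Type*} {l : Filter ι} {μ : ι → Measure ℝ}
    [∀ i, IsProbabilityMeasure (μ i)] {ν : Measure ℝ} [IsProbabilityMeasure ν]
    (hμ : ∀ i, μ i (Set.Iio 0) = 0) (hν : ν (Set.Iio 0) = 0)
    (h : ∀ p : ℕ, Tendsto (fun i => ∫ t, resolventWeight t ^ p ∂μ i) l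
      (𝓝 (∫ t, resolventWeight t ^ p ∂ν))) {z : ℝ} (hz : ContinuousAt (fun t => cdf ν t) z) :
    Tendsto (fun i => (μ i).real (Set.Iic z)) l (𝓝 (cdf ν z)) := by
  rcases lt_or_ge z 0 with hz0 | hz0
  · simp only [measureReal_Iic_of_neg (hμ _) hz0, cdf_eq_real, measureReal_Iic_of_neg hν hz0]
    exact tendsto_const_nhds
  have hramp := fun a b =>
    tendsto_integral_comp_resolventWeight h (continuous_ramp a b).continuousOn
  rw [tendsto_order]
  constructor
  -- For the lower bound the ramp is placed just to the left of `z`, where continuity keeps the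
  -- distribution function of `ν` above `a`; a negative left end is trivial.
  · intro a ha
    obtain ⟨δ, hδ, hball⟩ := Metric.eventually_nhds_iff.1 (hz.eventually (lt_mem_nhds ha))
    have h1 : a < cdf ν (z - δ / 2) := hball (by
      rw [Real.dist_eq, abs_lt]; constructor <;> linarith)
    rcases lt_or_ge (z - δ / 2) 0 with hneg | hpos
    · rw [cdf_eq_real, measureReal_Iic_of_neg hν hneg] at h1
      exact Eventually.of_forall fun i => h1.trans_le measureReal_nonneg
    · have h2 := measureReal_Iic_le_integral_ramp hpos (half_pos hδ) ν
      rw [cdf_eq_real] at h1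
      filter_upwards [(tendsto_order.1 (hramp _ _)).1 a (h1.trans_le h2)] with i hi
      refine hi.trans_le ((integral_ramp_le_measureReal_Iic hpos (half_pos hδ) (μ i)).trans ?_)
      rw [sub_add_cancel]
  · intro a ha
    obtain ⟨δ, hδ, hball⟩ := Metric.eventually_nhds_iff.1 (hz.eventually (gt_mem_nhds ha))
    have h1 : cdf ν (z + δ / 2) < a := hball (by
      rw [Real.dist_eq, abs_lt]; constructor <;> linarith)
    have h2 := integral_ramp_le_measureReal_Iic hz0 (half_pos hδ) ν
    rw [cdf_eq_real] at h1
    filter_upwards [(tendsto_order.1 (hramp _ _)).2 a (h2.trans_lt h1)] with i hi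
    exact (measureReal_Iic_le_integral_ramp hz0 (half_pos hδ) (μ i)).trans_lt hi

/-- A family of laws on the half-line is measurable if its resolvent moments are. -/
theorem measurable_of_measurable_integral_resolventWeight {X : Type*} [MeasurableSpace X]
    {κ : X → Measure ℝ} [∀ x, IsProbabilityMeasure (κ x)] (h0 : ∀ x, κ x (Set.Iio 0) = 0)
    (h : ∀ p : ℕ, Measurable fun x => ∫ t, resolventWeight t ^ p ∂κ x) : Measurable κ := by
  refine Measurable.measure_of_isPiSystem_of_isProbabilityMeasure (borel_eq_generateFrom_Iic ℝ)
    isPiSystem_Iic ?_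
  rintro _ ⟨z, rfl⟩
  rcases lt_or_ge z 0 with hz | hz
  · have : ∀ x, κ x (Set.Iic z) = 0 := fun x => measure_mono_null (Set.Iic_subset_Iio.2 hz) (h0 x)
    simp only [this]
    exact measurable_const
  have hm : Measurable fun x => (κ x).real (Set.Iic z) := by
    refine measurable_of_tendsto_metrizable (f := fun (n : ℕ) x =>
      ∫ t, ramp (resolventWeight (z + 1 / ((n : ℝ) + 1))) (resolventWeight z)
        (resolventWeight t) ∂κ x)
      (fun n => measurable_integral_comp_resolventWeight h (continuous_ramp _ _).continuousOn) ?_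
    rw [tendsto_pi_nhds]
    intro x
    have hδ : ∀ n : ℕ, (0 : ℝ) < 1 / ((n : ℝ) + 1) := fun n => by positivity
    refine tendsto_of_tendsto_of_tendsto_of_le_of_le tendsto_const_nhds ?_
      (fun n => measureReal_Iic_le_integral_ramp hz (hδ n) (κ x))
      (fun n => integral_ramp_le_measureReal_Iic hz (hδ n) (κ x))
    have h1 := (cdf (κ x)).right_continuous z
    have h2 : Tendsto (fun n : ℕ => z + 1 / ((n : ℝ) + 1)) atTop (𝓝[≥] z) := by
      refine tendsto_nhdsWithin_iff.2 ⟨?_, Eventually.of_forall fun n => ?_⟩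
      · simpa using tendsto_one_div_add_atTop_nhds_zero_nat.const_add z
      · exact le_add_of_nonneg_right (hδ n).le
    have h3 := h1.tendsto.comp h2
    simp only [Function.comp_def, cdf_eq_real] at h3
    exact h3
  simp only [measureReal_def] at hm
  have := hm.ennreal_ofReal
  simpa only [ENNReal.ofReal_toReal (measure_ne_top _ _)] using this

/-- Limits of the resolvent moments of a tight sequence are resolvent moments. -/
theorem exists_measure_integral_resolventWeight_eq {μ : ℕ → Measure ℝ}
    [∀ j, IsProbabilityMeasure (μ j)]
    (htight : ∀ j (r : ℝ), 0 < r → μ j {t | r < ‖t‖} ≤ ENNReal.ofReal (1 / r)) {c : ℕ → ℝ}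
    (hc : ∀ p : ℕ, Tendsto (fun j => ∫ t, resolventWeight t ^ p ∂μ j) atTop (𝓝 (c p))) :
    ∃ ν : Measure ℝ, IsProbabilityMeasure ν ∧ ν (Set.Iio 0) = 0 ∧
      ∀ p : ℕ, ∫ t, resolventWeight t ^ p ∂ν = c p := by
  set P : ℕ → ProbabilityMeasure ℝ := fun j => ⟨μ j, inferInstance⟩ with hP
  have hS : IsTightMeasureSet {((ρ : ProbabilityMeasure ℝ) : Measure ℝ) | ρ ∈ Set.range P} := by
    refine isTightMeasureSet_of_tendsto_measure_norm_gt ?_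
    have h1 : Tendsto (fun r : ℝ => ENNReal.ofReal (1 / r)) atTop (𝓝 0) := by
      have := (ENNReal.continuous_ofReal.tendsto 0).comp
        (tendsto_const_nhds.div_atTop tendsto_id : Tendsto (fun r : ℝ => 1 / r) atTop (𝓝 0))
      rwa [ENNReal.ofReal_zero] at this
    refine tendsto_of_tendsto_of_tendsto_of_le_of_le' tendsto_const_nhds h1
      (Eventually.of_forall fun r => zero_le) ?_
    filter_upwards [eventually_gt_atTop 0] with r hr
    refine iSup₂_le ?_
    rintro _ ⟨_, ⟨j, rfl⟩, rfl⟩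
    exact htight j r hr
  have hK := isCompact_closure_of_isTightMeasureSet hS
  -- A limit along a nonprincipal ultrafilter replaces the extraction of a subsequence; the moments
  -- converge along the whole sequence, so their limits are the `c p`.
  obtain ⟨ν, -, hν⟩ := hK.ultrafilter_le_nhds ((hyperfilter ℕ).map P) (by
    rw [le_principal_iff]
    exact mem_of_superset (Filter.range_mem_map) subset_closure)
  have hν' : Tendsto P (hyperfilter ℕ : Filter ℕ) (𝓝 ν) := hν
  rw [ProbabilityMeasure.tendsto_iff_forall_integral_tendsto] at hν'
  -- Pushing forward by `max · 0` leaves the resolvent moments unchanged and places the law on the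
  -- half-line, so its support need not be followed through the limit.
  refine ⟨(ν : Measure ℝ).map fun t => max t 0, Measure.isProbabilityMeasure_map (by fun_prop),
    ?_, fun p => ?_⟩
  · rw [Measure.map_apply (by fun_prop) measurableSet_Iio]
    convert! measure_empty (μ := (ν : Measure ℝ))
    ext t
    simp
  · rw [integral_map (f := fun t => resolventWeight t ^ p)
      (by fun_prop : AEMeasurable (fun t : ℝ => max t 0) _)
      (continuous_resolventWeight.pow p).aestronglyMeasurable]
    simp only [resolventWeight_max]
    have h1 := hν' (BoundedContinuousFunction.ofNormedAddCommGroup (fun t => resolventWeight t ^ p)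
      (continuous_resolventWeight.pow p) 1 fun t => by
        have := resolventWeight_mem_Icc t
        rw [norm_pow, Real.norm_eq_abs, abs_of_nonneg this.1]
        exact pow_le_one₀ this.1 this.2)
    refine tendsto_nhds_unique h1 ((hc p).mono_left ?_)
    rw [← Nat.cofinite_eq_atTop]
    exact hyperfilter_le_cofinite

end ResolventWeight

end

noncomputable section

open scoped ComplexOrder

/-! ### Averages of families of laws. -/

section Bind

variable {X : Type*} [MeasurableSpace X] {μ : Measure X}
  {κ : X → Measure ℝ} [∀ x, IsProbabilityMeasure (κ x)]

theorem isProbabilityMeasure_bind [IsProbabilityMeasure μ] (hκ : Measurable κ) : IsProbabilityMeasure (μ.bind κ) :=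
  ⟨by rw [Measure.bind_apply MeasurableSet.univ hκ.aemeasurable]; simp⟩

theorem integral_bind_of_mem_Icc (hκ : Measurable κ) {φ : ℝ → ℝ} (hφ : Measurable φ)
    (h01 : ∀ t, φ t ∈ Set.Icc (0 : ℝ) 1) :
    ∫ t, φ t ∂(μ.bind κ) = ∫ x, ∫ t, φ t ∂κ x ∂μ := by
  have h1 : ∀ x, ENNReal.ofReal (∫ t, φ t ∂κ x) = ∫⁻ t, ENNReal.ofReal (φ t) ∂κ x := fun x =>
    ofReal_integral_eq_lintegral_ofReal
      (Integrable.of_bound hφ.aestronglyMeasurable 1 (Eventually.of_forall fun t => by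
        rw [Real.norm_eq_abs, abs_of_nonneg (h01 t).1]; exact (h01 t).2))
      (Eventually.of_forall fun t => (h01 t).1)
  have h2 : Measurable fun x => ∫ t, φ t ∂κ x := by
    have h := ((Measure.measurable_lintegral hφ.ennreal_ofReal).comp hκ).ennreal_toReal
    simpa only [Function.comp_apply, ← h1,
      ENNReal.toReal_ofReal (integral_nonneg fun t => (h01 t).1)] using h
  rw [integral_eq_lintegral_of_nonneg_ae (Eventually.of_forall fun t => (h01 t).1)
      hφ.aestronglyMeasurable,
    integral_eq_lintegral_of_nonneg_ae
      (Eventually.of_forall fun x => integral_nonneg fun t => (h01 t).1) h2.aestronglyMeasurable,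
    Measure.lintegral_bind hκ.aemeasurable hφ.ennreal_ofReal.aemeasurable]
  simp only [h1]

end Bind

/-! ### The empirical law of the eigenvalues. -/

section EmpiricalLaw

variable {d n m : ℕ}

theorem foldVandermonde_eq_smul (x : Fin m → Fin d → ℝ) :
    foldVandermonde d n m x = (((√(m : ℝ))⁻¹ : ℝ) : ℂ) • sampleMatrix d n x := by
  ext l q
  rw [foldVandermonde, sampleMatrix, Matrix.smul_apply, of_apply, of_apply, phaseVec, unitExp,
    smul_eq_mul]
  congr 2
  push_cast
  ring

theorem foldVandermonde_mul_conjTranspose (x : Fin m → Fin d → ℝ) :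
    foldVandermonde d n m x * (foldVandermonde d n m x)ᴴ
      = ((1 / m : ℝ) : ℂ) • (sampleMatrix d n x * (sampleMatrix d n x)ᴴ) := by
  rw [foldVandermonde_eq_smul, conjTranspose_smul, Matrix.smul_mul, Matrix.mul_smul, smul_smul,
    Complex.star_def, Complex.conj_ofReal, ← Complex.ofReal_mul, ← mul_inv,
    Real.mul_self_sqrt (Nat.cast_nonneg m), one_div]

/-- The eigenvalues of `V Vᴴ`. -/
def gramEigenvalues (d n m : ℕ) (x : Fin m → Fin d → ℝ) : (Fin d → Fin n) → ℝ :=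
  (isHermitian_mul_conjTranspose_self (foldVandermonde d n m x)).eigenvalues

theorem gramEigenvalues_nonneg (x : Fin m → Fin d → ℝ) (i : Fin d → Fin n) :
    0 ≤ gramEigenvalues d n m x i :=
  (posSemidef_self_mul_conjTranspose (foldVandermonde d n m x)).eigenvalues_nonneg i

/-- Every diagonal entry of `V Vᴴ` equals `1`. The mean eigenvalue is therefore `1` for every
sample, and Markov's inequality yields tightness. -/
theorem sum_gramEigenvalues (hm : 0 < m) (x : Fin m → Fin d → ℝ) :
    ∑ i, gramEigenvalues d n m x i = (n : ℝ) ^ d := by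
  have h := (isHermitian_mul_conjTranspose_self (foldVandermonde d n m x)).trace_eq_sum_eigenvalues
  have hm' : (m : ℝ) ≠ 0 := by exact_mod_cast hm.ne'
  have h2 : trace (foldVandermonde d n m x * (foldVandermonde d n m x)ᴴ)
      = (((n : ℝ) ^ d : ℝ) : ℂ) := by
    rw [foldVandermonde_mul_conjTranspose, trace_smul, trace]
    have h3 : ∀ i : Fin d → Fin n,
        (sampleMatrix d n x * (sampleMatrix d n x)ᴴ).diag i = ((m : ℝ) : ℂ) := fun i => by
      rw [diag_apply, mul_apply]
      have h4 : ∀ q, sampleMatrix d n x i q * (sampleMatrix d n x)ᴴ q i = 1 := fun q => by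
        rw [conjTranspose_apply, Complex.star_def, Complex.mul_conj, Complex.normSq_eq_norm_sq,
          sampleMatrix, of_apply, norm_phaseVec]
        simp
      rw [Finset.sum_congr rfl fun q _ => h4 q]
      simp
    rw [Finset.sum_congr rfl fun i _ => h3 i]
    simp only [Finset.sum_const, Finset.card_univ, Fintype.card_pi, Fintype.card_fin,
      Finset.prod_const, nsmul_eq_mul, smul_eq_mul]
    rw [mul_left_comm, ← Complex.ofReal_mul, one_div, inv_mul_cancel₀ hm']
    push_cast
    ring
  rw [h2] at h
  have h5 : ((∑ i, gramEigenvalues d n m x i : ℝ) : ℂ) = (((n : ℝ) ^ d : ℝ) : ℂ) := by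
    rw [h]
    push_cast
    rfl
  exact_mod_cast h5

/-- The empirical law of the eigenvalues of `V Vᴴ`. -/
def empiricalLaw (d n m : ℕ) (x : Fin m → Fin d → ℝ) : Measure ℝ :=
  ((n : ENNReal) ^ d)⁻¹ • ∑ i, Measure.dirac (gramEigenvalues d n m x i)

theorem natCast_pow_ne_zero (hn : 0 < n) : (n : ENNReal) ^ d ≠ 0 :=
  pow_ne_zero _ (by exact_mod_cast hn.ne')

theorem isProbabilityMeasure_empiricalLaw (hn : 0 < n) (x : Fin m → Fin d → ℝ) :
    IsProbabilityMeasure (empiricalLaw d n m x) := by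
  constructor
  rw [empiricalLaw, Measure.smul_apply, Measure.finsetSum_apply]
  simp only [measure_univ, Finset.sum_const, Finset.card_univ, Fintype.card_pi, Fintype.card_fin,
    Finset.prod_const, nsmul_eq_mul, smul_eq_mul, mul_one]
  push_cast
  exact ENNReal.inv_mul_cancel (natCast_pow_ne_zero hn) (by finiteness)

theorem empiricalLaw_Iio_zero (x : Fin m → Fin d → ℝ) : empiricalLaw d n m x (Set.Iio 0) = 0 := by
  rw [empiricalLaw, Measure.smul_apply, Measure.finsetSum_apply]
  have h : ∀ i, Measure.dirac (gramEigenvalues d n m x i) (Set.Iio 0) = 0 := fun i => by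
    rw [Measure.dirac_apply' _ measurableSet_Iio, Set.indicator_of_notMem]
    rw [Set.mem_Iio, not_lt]
    exact gramEigenvalues_nonneg x i
  simp [h]

theorem integral_empiricalLaw (x : Fin m → Fin d → ℝ) (φ : ℝ → ℝ) :
    ∫ t, φ t ∂empiricalLaw d n m x
      = (∑ i, φ (gramEigenvalues d n m x i)) / (n : ℝ) ^ d := by
  rw [empiricalLaw, integral_smul_measure, integral_finsetSum_measure fun i _ =>
    integrable_dirac (by simp)]
  simp only [integral_dirac, ENNReal.toReal_inv, ENNReal.toReal_pow, ENNReal.toReal_natCast,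
    smul_eq_mul]
  rw [inv_mul_eq_div]

theorem measureReal_empiricalLaw_Iic (x : Fin m → Fin d → ℝ) (z : ℝ) :
    (empiricalLaw d n m x).real (Set.Iic z) = empiricalSpectralCDF d n m x z := by
  classical
  rw [← integral_indicator_one measurableSet_Iic, integral_empiricalLaw, empiricalSpectralCDF]
  congr 1
  simp only [Set.indicator_apply, Set.mem_Iic, Pi.one_apply, Finset.sum_boole]
  rw [Nat.card_eq_fintype_card, Fintype.card_subtype]
  rfl

theorem integral_one_sub_resolventWeight_empiricalLaw (p : ℕ) {y : ℝ} (hy : 0 ≤ y)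
    (x : Fin m → Fin d → ℝ) :
    ∫ t, (1 - resolventWeight (y * t) ^ p) ∂empiricalLaw d n m x
      = phaseDefect p d n (y / m) x / (n : ℝ) ^ d := by
  rw [integral_empiricalLaw]
  have h := resolventDefect_smul_eq_sum_eigenvalues
    (posSemidef_self_mul_conjTranspose (foldVandermonde d n m x)) p hy
  have e : ((y / m : ℝ) : ℂ) • (sampleMatrix d n x * (sampleMatrix d n x)ᴴ)
      = (y : ℂ) • (foldVandermonde d n m x * (foldVandermonde d n m x)ᴴ) := by
    rw [foldVandermonde_mul_conjTranspose, smul_smul, ← Complex.ofReal_mul, mul_one_div]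
  rw [phaseDefect, e, h]
  congr 1
  refine Finset.sum_congr rfl fun i _ => ?_
  rw [resolventWeight, max_eq_left (mul_nonneg hy (gramEigenvalues_nonneg x i))]
  rfl

theorem empiricalLaw_norm_gt_le (hn : 0 < n) (hm : 0 < m) (x : Fin m → Fin d → ℝ) {r : ℝ}
    (hr : 0 < r) : empiricalLaw d n m x {t | r < ‖t‖} ≤ ENNReal.ofReal (1 / r) := by
  have := isProbabilityMeasure_empiricalLaw hn x
  have hnp : (0 : ℝ) < (n : ℝ) ^ d := pow_pos (by exact_mod_cast hn) d
  have hms : MeasurableSet {t : ℝ | r < ‖t‖} := measurableSet_lt measurable_const measurable_norm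
  rw [← ofReal_measureReal, ← integral_indicator_one hms, integral_empiricalLaw]
  refine ENNReal.ofReal_le_ofReal ?_
  rw [div_le_iff₀ hnp, ← sum_gramEigenvalues hm x, Finset.mul_sum]
  refine Finset.sum_le_sum fun i _ => ?_
  have h0 := gramEigenvalues_nonneg x i
  by_cases hi : gramEigenvalues d n m x i ∈ {t : ℝ | r < ‖t‖}
  · rw [Set.indicator_of_mem hi, Pi.one_apply, one_div_mul_eq_div, le_div_iff₀ hr, one_mul]
    rw [Set.mem_ofPred_eq, Real.norm_eq_abs, abs_of_nonneg h0] at hi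
    exact hi.le
  · rw [Set.indicator_of_notMem hi]
    positivity

/-- Measurability of individual eigenvalues is not needed: the resolvent moments are continuous in
the sample, and they determine measurability of the law. -/
theorem measurable_empiricalLaw (hn : 0 < n) : Measurable (empiricalLaw d n m) := by
  have := isProbabilityMeasure_empiricalLaw (d := d) (n := n) (m := m) hn
  refine measurable_of_measurable_integral_resolventWeight empiricalLaw_Iio_zero fun p => ?_
  have h : ∀ x : Fin m → Fin d → ℝ, ∫ t, resolventWeight t ^ p ∂empiricalLaw d n m x
      = 1 - phaseDefect p d n (1 / m) x / (n : ℝ) ^ d := fun x => by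
    have h1 := integral_one_sub_resolventWeight_empiricalLaw (n := n) p zero_le_one x
    simp only [one_mul] at h1
    rw [integral_sub (integrable_const _) (integrable_resolventWeight_pow p _), integral_const,
      probReal_univ, one_smul] at h1
    linarith
  simp only [h]
  exact ((measurable_phaseDefect p d n (by positivity) m).div_const _).const_sub 1

end EmpiricalLaw

/-! ### The mean spectral law. -/

section MeanLaw

variable {d : ℕ} {f : (Fin d → ℝ) → ℝ}

/-- The mean of the empirical law of the eigenvalues of `V Vᴴ`. -/
def meanLaw (d n m : ℕ) (f : (Fin d → ℝ) → ℝ) : Measure ℝ :=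
  (Measure.pi fun _ : Fin m => phaseLaw d f).bind (empiricalLaw d n m)

variable {n m : ℕ}

theorem isProbabilityMeasure_meanLaw (hf : IsPhaseDensity d f) (hn : 0 < n) :
    IsProbabilityMeasure (meanLaw d n m f) := by
  have := hf.isProbabilityMeasure
  have := isProbabilityMeasure_empiricalLaw (d := d) (n := n) (m := m) hn
  exact isProbabilityMeasure_bind (measurable_empiricalLaw hn)

theorem meanLaw_Iio_zero (hn : 0 < n) : meanLaw d n m f (Set.Iio 0) = 0 := by
  rw [meanLaw, Measure.bind_apply measurableSet_Iio (measurable_empiricalLaw hn).aemeasurable]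
  simp [empiricalLaw_Iio_zero]

theorem measureReal_meanLaw_Iic (hn : 0 < n) (z : ℝ) :
    (meanLaw d n m f).real (Set.Iic z) = meanSpectralCDF d n m f z := by
  have := isProbabilityMeasure_empiricalLaw (d := d) (n := n) (m := m) hn
  rw [meanSpectralCDF, measureReal_def, meanLaw,
    Measure.bind_apply measurableSet_Iic (measurable_empiricalLaw hn).aemeasurable]
  simp only [← measureReal_empiricalLaw_Iic, measureReal_def]
  rw [integral_toReal]
  · exact ((Measure.measurable_coe measurableSet_Iic).comp
      (measurable_empiricalLaw hn)).aemeasurable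
  · exact Eventually.of_forall fun x => measure_lt_top _ _

theorem meanLaw_norm_gt_le (hf : IsPhaseDensity d f) (hn : 0 < n) (hm : 0 < m) {r : ℝ}
    (hr : 0 < r) : meanLaw d n m f {t | r < ‖t‖} ≤ ENNReal.ofReal (1 / r) := by
  have := hf.isProbabilityMeasure
  rw [meanLaw, Measure.bind_apply (measurableSet_lt measurable_const measurable_norm)
    (measurable_empiricalLaw hn).aemeasurable]
  refine (lintegral_mono fun x => empiricalLaw_norm_gt_le hn hm x hr).trans ?_
  simp

theorem continuous_one_sub_resolventWeight_pow (p : ℕ) (y : ℝ) :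
    Continuous fun t => 1 - resolventWeight (y * t) ^ p :=
  continuous_const.sub ((continuous_resolventWeight.comp (continuous_const_mul y)).pow p)

theorem one_sub_resolventWeight_pow_mem_Icc (p : ℕ) (t : ℝ) :
    1 - resolventWeight t ^ p ∈ Set.Icc (0 : ℝ) 1 := by
  have h := resolventWeight_mem_Icc t
  have h1 := pow_nonneg h.1 p
  have h2 := pow_le_one₀ (n := p) h.1 h.2
  constructor <;> linarith

theorem integral_one_sub_resolventWeight_meanLaw (hf : IsPhaseDensity d f) (hn : 0 < n) (p : ℕ)
    {y : ℝ} (hy : 0 ≤ y) :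
    ∫ t, (1 - resolventWeight (y * t) ^ p) ∂meanLaw d n m f
      = (∫ x, phaseDefect p d n (y / m) x ∂(Measure.pi fun _ : Fin m => phaseLaw d f))
        / (n : ℝ) ^ d := by
  have := hf.isProbabilityMeasure
  have := isProbabilityMeasure_empiricalLaw (d := d) (n := n) (m := m) hn
  rw [meanLaw, integral_bind_of_mem_Icc (φ := fun t => 1 - resolventWeight (y * t) ^ p)
    (measurable_empiricalLaw hn) (continuous_one_sub_resolventWeight_pow p y).measurable
    fun t => one_sub_resolventWeight_pow_mem_Icc p _]
  simp only [integral_one_sub_resolventWeight_empiricalLaw p hy]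
  rw [integral_div]

theorem integral_one_sub_resolventWeight_pow (p : ℕ) (μ : Measure ℝ) [IsProbabilityMeasure μ] :
    ∫ t, (1 - resolventWeight t ^ p) ∂μ = 1 - ∫ t, resolventWeight t ^ p ∂μ := by
  rw [integral_sub (integrable_const _) (integrable_resolventWeight_pow p _), integral_const,
    probReal_univ, one_smul]

end MeanLaw

end

noncomputable section

/-! ### The limit laws for uniform phases and their dilations. -/

section LimitLaw

variable {d : ℕ}

theorem abs_limitDefect_sub_le_weight (p : ℕ) (hd : 1 ≤ d) {b σ σ' : ℝ} (hb : 0 ≤ b)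
    (hσ : 0 ≤ σ) (hσ' : 0 ≤ σ') :
    |limitDefect p d b σ - limitDefect p d b σ'| ≤ p * (b * |σ - σ'|) := by
  have h1 := ((tendsto_scaledDefect p hd hb hσ).sub (tendsto_scaledDefect p hd hb hσ')).abs
  refine le_of_tendsto h1 ?_
  filter_upwards [eventually_ge_atTop 1] with k hk
  have hkp : (0 : ℝ) < (k : ℝ) ^ d := pow_pos (by exact_mod_cast hk) d
  rw [scaledDefect, scaledDefect, ← sub_div, abs_div, abs_of_pos hkp, div_le_iff₀ hkp]
  refine (abs_uniformDefect_sub_le_weight p d k _ (div_nonneg hσ hkp.le)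
    (div_nonneg hσ' hkp.le)).trans ?_
  have hfl : (⌊b * (k : ℝ) ^ d⌋₊ : ℝ) ≤ b * (k : ℝ) ^ d := Nat.floor_le (by positivity)
  rw [← sub_div, abs_div, abs_of_pos hkp]
  have e : |σ - σ'| / (k : ℝ) ^ d * ((k : ℝ) ^ d * ⌊b * (k : ℝ) ^ d⌋₊)
      = |σ - σ'| * ⌊b * (k : ℝ) ^ d⌋₊ := by field_simp
  rw [mul_assoc, e]
  calc p * (|σ - σ'| * ⌊b * (k : ℝ) ^ d⌋₊) ≤ p * (|σ - σ'| * (b * (k : ℝ) ^ d)) := by gcongr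
    _ = _ := by ring

/-- Needed for the measurable dependence of the limit law on the ratio; it follows from the
Lipschitz bounds in each argument. -/
theorem continuousOn_limitDefect (p : ℕ) (hd : 1 ≤ d) :
    ContinuousOn (fun β : ℝ => limitDefect p d (1 / β) β) (Set.Ioi 0) := by
  intro β hβ
  rw [Set.mem_Ioi] at hβ
  refine ContinuousAt.continuousWithinAt ?_
  have h1 : ContinuousAt (fun t : ℝ => 1 / t) β := continuousAt_const.div continuousAt_id hβ.ne'
  have h2 : Tendsto (fun t : ℝ => p * |1 / t - 1 / β| + p * (1 / β * |t - β|)) (𝓝 β) (𝓝 0) := by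
    have a1 : Tendsto (fun t : ℝ => |1 / t - 1 / β|) (𝓝 β) (𝓝 0) := by
      simpa using (h1.tendsto.sub_const (1 / β)).abs
    have a2 : Tendsto (fun t : ℝ => |t - β|) (𝓝 β) (𝓝 0) := by
      simpa using ((tendsto_id (x := 𝓝 β)).sub_const β).abs
    simpa using (a1.const_mul (p : ℝ)).add ((a2.const_mul (1 / β)).const_mul (p : ℝ))
  refine tendsto_iff_dist_tendsto_zero.2
    (squeeze_zero' (Eventually.of_forall fun t => dist_nonneg) ?_ h2)
  filter_upwards [lt_mem_nhds hβ] with t ht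
  rw [Real.dist_eq]
  exact (abs_sub_le _ (limitDefect p d (1 / β) t) _).trans (add_le_add
    (abs_limitDefect_sub_le p hd (by positivity) (by positivity) ht.le)
    (abs_limitDefect_sub_le_weight p hd (by positivity) ht.le hβ.le))

theorem exists_sequences_tendsto_ratio (hd : 1 ≤ d) {β : ℝ} (hβ : 0 < β) :
    ∃ N M : ℕ → ℕ, (∀ j, 0 < N j) ∧ (∀ j, 0 < M j) ∧ Tendsto N atTop atTop ∧
      Tendsto M atTop atTop ∧ Tendsto (fun j => (N j : ℝ) ^ d / (M j : ℝ)) atTop (𝓝 β) := by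
  have hx : Tendsto (fun j : ℕ => ((j + 1 : ℕ) : ℝ) ^ d) atTop atTop :=
    (tendsto_natCast_pow_atTop hd).comp (tendsto_add_atTop_nat 1)
  refine ⟨fun j => j + 1, fun j => ⌈β⁻¹ * ((j + 1 : ℕ) : ℝ) ^ d⌉₊, fun j => j.succ_pos,
    fun j => Nat.ceil_pos.2 (by positivity), tendsto_add_atTop_nat 1,
    tendsto_nat_ceil_atTop.comp (hx.const_mul_atTop (inv_pos.2 hβ)), ?_⟩
  have h := ((tendsto_nat_ceil_mul_div_atTop (inv_nonneg.2 hβ.le)).comp hx).inv₀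
    (inv_ne_zero hβ.ne')
  rw [inv_inv] at h
  exact h.congr fun j => inv_div _ _

theorem isPhaseDensity_uniformDensity (d : ℕ) : IsPhaseDensity d (uniformDensity d) where
  measurable := measurable_const
  nonneg := fun _ _ => zero_le_one
  lintegral_eq_one := by
    have h := measure_univ (μ := cubeLaw d)
    simp only [uniformDensity, ENNReal.ofReal_one, lintegral_const, one_mul]
    exact h

theorem phaseLaw_uniformDensity (d : ℕ) : phaseLaw d (uniformDensity d) = cubeLaw d := by
  simp only [phaseLaw, uniformDensity, ENNReal.ofReal_one, cubeLaw]
  exact withDensity_one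

theorem integral_limitDefect_uniformDensity (p d : ℕ) (β : ℝ) :
    ∫ x, limitDefect p d (uniformDensity d x / β) β ∂cubeLaw d = limitDefect p d (1 / β) β := by
  simp [uniformDensity]

theorem exists_limitLaw (hd : 1 ≤ d) {β : ℝ} (hβ : 0 < β) :
    ∃ ν : Measure ℝ, IsProbabilityMeasure ν ∧ ν (Set.Iio 0) = 0 ∧
      ∀ p : ℕ, ∫ t, resolventWeight t ^ p ∂ν = 1 - limitDefect p d (1 / β) β := by
  obtain ⟨N, M, hN0, hM0, hN, hM, hNM⟩ := exists_sequences_tendsto_ratio hd hβ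
  have hu := isPhaseDensity_uniformDensity d
  have hprob : ∀ j, IsProbabilityMeasure (meanLaw d (N j) (M j) (uniformDensity d)) := fun j =>
    isProbabilityMeasure_meanLaw hu (hN0 j)
  refine exists_measure_integral_resolventWeight_eq
    (μ := fun j => meanLaw d (N j) (M j) (uniformDensity d))
    (fun j r hr => meanLaw_norm_gt_le hu (hN0 j) (hM0 j) hr) fun p => ?_
  have h := (tendsto_integral_phaseDefect_div p hd hβ hu hN hM hNM).const_sub 1
  rw [integral_limitDefect_uniformDensity] at h
  refine h.congr fun j => ?_
  rw [← integral_one_sub_resolventWeight_meanLaw hu (hN0 j) p zero_le_one]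
  simp only [one_mul]
  rw [integral_one_sub_resolventWeight_pow, sub_sub_cancel]

open Classical in
/-- The limit law of the eigenvalues for uniform phases and ratio `β > 0`. -/
def limitLaw (d : ℕ) (β : ℝ) : Measure ℝ :=
  -- The default value makes the family Markov on the whole line; at zeros of `f` the law at ratio
  -- `β / 0 = 0` occurs, but it is then dilated by zero.
  if h : 1 ≤ d ∧ 0 < β then (exists_limitLaw h.1 h.2).choose else Measure.dirac 0

instance isProbabilityMeasure_limitLaw (d : ℕ) (β : ℝ) : IsProbabilityMeasure (limitLaw d β) := by
  rw [limitLaw]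
  split_ifs with h
  · exact (exists_limitLaw h.1 h.2).choose_spec.1
  · infer_instance

theorem limitLaw_Iio_zero (d : ℕ) (β : ℝ) : limitLaw d β (Set.Iio 0) = 0 := by
  rw [limitLaw]
  split_ifs with h
  · exact (exists_limitLaw h.1 h.2).choose_spec.2.1
  · simp

theorem integral_resolventWeight_pow_limitLaw (p : ℕ) (hd : 1 ≤ d) {β : ℝ} (hβ : 0 < β) :
    ∫ t, resolventWeight t ^ p ∂limitLaw d β = 1 - limitDefect p d (1 / β) β := by
  rw [limitLaw, dif_pos ⟨hd, hβ⟩]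
  exact (exists_limitLaw hd hβ).choose_spec.2.2 p

theorem measurable_limitLaw (hd : 1 ≤ d) : Measurable (limitLaw d) := by
  classical
  refine measurable_of_measurable_integral_resolventWeight (limitLaw_Iio_zero d) fun p => ?_
  have h : (fun β => ∫ t, resolventWeight t ^ p ∂limitLaw d β)
      = (Set.Ioi (0 : ℝ)).piecewise (fun β => 1 - limitDefect p d (1 / β) β) fun _ => 1 := by
    funext β
    by_cases hβ : β ∈ Set.Ioi (0 : ℝ)
    · rw [Set.piecewise_eq_of_mem _ _ _ hβ, integral_resolventWeight_pow_limitLaw p hd hβ]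
    · rw [Set.piecewise_eq_of_notMem _ _ _ hβ, limitLaw, dif_neg fun h => hβ h.2]
      simp [resolventWeight]
  rw [h]
  exact (continuousOn_const.sub (continuousOn_limitDefect p hd)).measurable_piecewise
    continuousOn_const measurableSet_Ioi

theorem tendsto_integral_resolventWeight_pow_meanLaw {f : (Fin d → ℝ) → ℝ}
    (hf : IsPhaseDensity d f) (hd : 1 ≤ d) {β : ℝ} (hβ : 0 < β) {N M : ℕ → ℕ}
    (hN0 : ∀ j, 0 < N j) (hN : Tendsto N atTop atTop) (hM : Tendsto M atTop atTop)
    (hNM : Tendsto (fun j => (N j : ℝ) ^ d / (M j : ℝ)) atTop (𝓝 β)) (p : ℕ) :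
    Tendsto (fun j => ∫ t, resolventWeight t ^ p ∂meanLaw d (N j) (M j) f) atTop
      (𝓝 (1 - ∫ x, limitDefect p d (f x / β) β ∂cubeLaw d)) := by
  have hprob : ∀ j, IsProbabilityMeasure (meanLaw d (N j) (M j) f) := fun j =>
    isProbabilityMeasure_meanLaw hf (hN0 j)
  refine ((tendsto_integral_phaseDefect_div p hd hβ hf hN hM hNM).const_sub 1).congr fun j => ?_
  rw [← integral_one_sub_resolventWeight_meanLaw hf (hN0 j) p zero_le_one]
  simp only [one_mul]
  rw [integral_one_sub_resolventWeight_pow, sub_sub_cancel]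

/-- The resolvent moments of the limit law, dilated by `y`. -/
theorem integral_one_sub_resolventWeight_mul_limitLaw (p : ℕ) (hd : 1 ≤ d) {β y : ℝ} (hβ : 0 < β)
    (hy : 0 < y) :
    ∫ t, (1 - resolventWeight (y * t) ^ p) ∂limitLaw d (β / y) = limitDefect p d (y / β) β := by
  obtain ⟨N, M, hN0, hM0, hN, hM, hNM⟩ := exists_sequences_tendsto_ratio hd (div_pos hβ hy)
  have hu := isPhaseDensity_uniformDensity d
  have hprob : ∀ j, IsProbabilityMeasure (meanLaw d (N j) (M j) (uniformDensity d)) := fun j =>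
    isProbabilityMeasure_meanLaw hu (hN0 j)
  have hpos : ∀ w ∈ Set.Icc (0 : ℝ) 1, 0 < w + y * (1 - w) := fun w hw => by
    rcases hw.1.eq_or_lt with h | h
    · rw [← h]; simpa using hy
    · exact add_pos_of_pos_of_nonneg h (mul_nonneg hy.le (sub_nonneg.2 hw.2))
  -- The dilated weight at `y * t` is `w / (w + y (1 - w))` with `w` the weight at `t`. As `y > 0`,
  -- this is continuous up to `w = 0`, so the dilated test function is covered by the convergence
  -- theorem.
  have hcont : ContinuousOn (fun w : ℝ => 1 - (w / (w + y * (1 - w))) ^ p) (Set.Icc 0 1) :=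
    continuousOn_const.sub ((continuousOn_id.div (by fun_prop) fun w hw => (hpos w hw).ne').pow p)
  have hw : ∀ t, 1 - (resolventWeight t / (resolventWeight t + y * (1 - resolventWeight t))) ^ p
      = 1 - resolventWeight (y * t) ^ p := fun t => by
    have e : max (y * t) 0 = y * max t 0 := by
      rw [mul_max_of_nonneg _ _ hy.le, mul_zero]
    have h0 : 0 < 1 + max t 0 := by positivity
    have h1 : 0 < 1 + y * max t 0 := by positivity
    congr 2
    rw [resolventWeight, resolventWeight, e]
    have h2 : (1 + max t 0)⁻¹ + y * (1 - (1 + max t 0)⁻¹)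
        = (1 + max t 0)⁻¹ * (1 + y * max t 0) := by
      field_simp
      ring
    rw [h2, div_mul_cancel_left₀ (inv_ne_zero h0.ne')]
  have h1 := tendsto_integral_comp_resolventWeight (l := atTop)
    (μ := fun j => meanLaw d (N j) (M j) (uniformDensity d)) (ν := limitLaw d (β / y))
    (fun q => by
      have h := tendsto_integral_resolventWeight_pow_meanLaw hu hd (div_pos hβ hy) hN0 hN hM hNM q
      rw [integral_limitDefect_uniformDensity] at h
      rw [integral_resolventWeight_pow_limitLaw q hd (div_pos hβ hy)]
      exact h) hcont
  simp only [hw] at h1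
  refine tendsto_nhds_unique h1 ?_
  have hMN : Tendsto (fun j => (M j : ℝ) / (N j : ℝ) ^ d) atTop (𝓝 (y / β)) := by
    have h := hNM.inv₀ (div_pos hβ hy).ne'
    rw [inv_div] at h
    exact h.congr fun j => inv_div _ _
  -- The second evaluation of the same limit: with ratio `β / y` there are `y / β` points per
  -- dimension, and the weight `y / M` times `N ^ d` tends to `β`.
  have h2 := tendsto_uniformDefect_div p hd (div_nonneg hy.le hβ.le) hβ.le
    (s := fun j => y / M j) (fun j => by positivity) hN hMN (by
      have h := hNM.const_mul y
      rw [mul_div_cancel₀ _ hy.ne'] at h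
      exact h.congr fun j => by ring)
  refine h2.congr fun j => ?_
  rw [integral_one_sub_resolventWeight_meanLaw hu (hN0 j) p hy.le, phaseLaw_uniformDensity,
    uniformDefect]

theorem isLSD_of_integral_eq {f : (Fin d → ℝ) → ℝ} (hf : IsPhaseDensity d f) (hd : 1 ≤ d) {β : ℝ}
    (hβ : 0 < β) {ν : Measure ℝ} [IsProbabilityMeasure ν] (hν : ν (Set.Iio 0) = 0)
    (h : ∀ p : ℕ, ∫ t, (1 - resolventWeight t ^ p) ∂ν
      = ∫ x, limitDefect p d (f x / β) β ∂cubeLaw d) : IsLSD d f β ν where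
  isProbabilityMeasure := inferInstance
  tendsto_cdf := by
    intro N M hN hM hNM z hz
    -- Finitely many `N j` may be zero, where the empirical law is not a probability measure;
    -- changing them does not affect the limit.
    set N' : ℕ → ℕ := fun j => max (N j) 1 with hN'
    have heq : ∀ᶠ j in atTop, N' j = N j := by
      filter_upwards [hN.eventually_ge_atTop 1] with j hj
      exact max_eq_left hj
    have hN0 : ∀ j, 0 < N' j := fun j => lt_max_of_lt_right zero_lt_one
    have hprob : ∀ j, IsProbabilityMeasure (meanLaw d (N' j) (M j) f) := fun j =>
      isProbabilityMeasure_meanLaw hf (hN0 j)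
    have hlim := fun p => tendsto_integral_resolventWeight_pow_meanLaw hf hd hβ hN0
      (hN.congr' (heq.mono fun j hj => hj.symm)) hM
      (hNM.congr' (heq.mono fun j hj => by simp only [hj])) p
    have key := tendsto_measureReal_Iic (fun j => meanLaw_Iio_zero (hN0 j)) hν (fun p => by
      have e := h p
      rw [integral_one_sub_resolventWeight_pow] at e
      have := hlim p
      rw [← e, sub_sub_cancel] at this
      exact this) hz
    refine key.congr' ?_
    filter_upwards [heq] with j hj
    rw [measureReal_meanLaw_Iic (hN0 j), hj]

end LimitLaw

/-! ### The mixture as an average over the cube. -/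

section Mixture

variable {d : ℕ} {f : (Fin d → ℝ) → ℝ}

theorem measurable_map_mul (Λ : Kernel ℝ ℝ) [IsSFiniteKernel Λ] (β : ℝ) :
    Measurable fun y : ℝ => (Λ (β / y)).map fun t => y * t := by
  refine Measure.measurable_of_measurable_coe _ fun u hu => ?_
  have h1 : ∀ y : ℝ, ((Λ (β / y)).map fun t => y * t) u
      = (Λ.comap (fun y => β / y) (by fun_prop)) y
          (Prod.mk y ⁻¹' ((fun p : ℝ × ℝ => p.1 * p.2) ⁻¹' u)) := fun y => by
    rw [Measure.map_apply (by fun_prop) hu, Kernel.comap_apply]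
    rfl
  simp_rw [h1]
  exact Kernel.measurable_kernel_prodMk_left ((by fun_prop : Measurable _) hu)

theorem measurableSet_positivitySet (hf : Measurable f) : MeasurableSet (positivitySet d f) :=
  (measurableSet_hypercube d).inter (measurableSet_lt measurable_const hf)

theorem volume_positivitySet_ne_zero (hf : IsPhaseDensity d f) :
    volume (positivitySet d f) ≠ 0 := fun h0 => by
  have h1 : ∫⁻ z in hypercube d, ENNReal.ofReal (f z) = 0 := by
    rw [lintegral_eq_zero_iff hf.measurable.ennreal_ofReal]
    have h2 : ∀ᵐ z ∂volume.restrict (hypercube d), z ∉ positivitySet d f :=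
      ae_restrict_of_ae (measure_eq_zero_iff_ae_notMem.1 h0)
    filter_upwards [h2, ae_restrict_mem (measurableSet_hypercube d)] with z hz hzH
    rw [Pi.zero_apply, ENNReal.ofReal_eq_zero]
    exact not_lt.1 fun h => hz ⟨hzH, h⟩
  rw [hf.lintegral_eq_one] at h1
  exact one_ne_zero h1

theorem restrict_cubeLaw_positivitySet (hf : Measurable f) :
    (cubeLaw d).restrict (positivitySet d f) = volume.restrict (positivitySet d f) := by
  rw [cubeLaw, Measure.restrict_restrict (measurableSet_positivitySet hf),
    Set.inter_eq_left.2 fun z hz => hz.1]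

theorem cubeLaw_positivitySet (f : (Fin d → ℝ) → ℝ) :
    cubeLaw d (positivitySet d f) = volume (positivitySet d f) :=
  Measure.restrict_eq_self _ fun _ hz => hz.1

/-- The mixture is the average over the hypercube of the limit law with ratio `β / f z`, dilated
by `f z`. -/
theorem mixtureLSD_eq_bind (hf : IsPhaseDensity d f) (Λ : Kernel ℝ ℝ) [IsMarkovKernel Λ] (β : ℝ) :
    mixtureLSD d Λ f β
      = (cubeLaw d).bind fun z => (Λ (β / f z)).map fun t => f z * t := by
  have hκ := measurable_map_mul Λ β
  have hκf : Measurable fun z => (Λ (β / f z)).map fun t => f z * t := hκ.comp hf.measurable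
  have hA := measurableSet_positivitySet hf.measurable
  ext s hs
  have hκs : Measurable fun y : ℝ => Λ (β / y) {t | y * t ∈ s} := by
    have h := (Measure.measurable_coe hs).comp hκ
    refine (funext fun y => ?_ : (fun y : ℝ => Λ (β / y) {t | y * t ∈ s}) = _) ▸ h
    rw [Function.comp_apply, Measure.map_apply (by fun_prop) hs]
    rfl
  have hκz : ∀ z, ((Λ (β / f z)).map fun t => f z * t) s = Λ (β / f z) {t | f z * t ∈ s} :=
    fun z => Measure.map_apply (by fun_prop) hs
  rw [mixtureLSD_apply Λ f β hs, Measure.bind_apply hs hκf.aemeasurable]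
  simp only [hκz]
  rw [← lintegral_add_compl _ hA, restrict_cubeLaw_positivitySet hf.measurable, add_comm]
  congr 1
  · rw [phaseValueLaw, lintegral_smul_measure, lintegral_map hκs hf.measurable, smul_eq_mul,
      ← mul_assoc, ENNReal.mul_inv_cancel (volume_positivitySet_ne_zero hf), one_mul]
    rw [← cubeLaw_positivitySet]
    exact measure_ne_top _ _
  -- Where `f z = 0` the dilation sends every probability law to the point mass at zero; these
  -- points produce the atom of mass `1 - |A|`.
  · have h1 : ∀ᵐ z ∂(cubeLaw d).restrict (positivitySet d f)ᶜ,
        Λ (β / f z) {t | f z * t ∈ s} = s.indicator 1 0 := by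
      filter_upwards [ae_restrict_mem hA.compl, ae_restrict_of_ae (ae_cubeLaw_mem_hypercube d)]
        with z hz hzH
      have h0 : f z = 0 := le_antisymm (not_lt.1 fun h => hz ⟨hzH, h⟩) (hf.nonneg z hzH)
      simp only [h0, zero_mul]
      by_cases hs0 : (0 : ℝ) ∈ s <;> simp [hs0]
    rw [lintegral_congr_ae h1, lintegral_const, Measure.restrict_apply_univ,
      prob_compl_eq_one_sub hA, cubeLaw_positivitySet, mul_comm]

end Mixture

theorem theorem2 (d : ℕ) (hd : 1 ≤ d) :
    ∃ Λ : Kernel ℝ ℝ, IsMarkovKernel Λ ∧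
      (∀ β : ℝ, 0 < β → IsLSD d (uniformDensity d) β (Λ β)) ∧
      ∀ f : (Fin d → ℝ) → ℝ, IsPhaseDensity d f →
        ∀ β : ℝ, 0 < β → IsLSD d f β (mixtureLSD d Λ f β) := by
  set Λ : Kernel ℝ ℝ := ⟨limitLaw d, measurable_limitLaw hd⟩ with hΛdef
  have hΛ : IsMarkovKernel Λ := ⟨fun β => isProbabilityMeasure_limitLaw d β⟩
  refine ⟨Λ, hΛ, fun β hβ => ?_, fun f hf β hβ => ?_⟩
  · refine isLSD_of_integral_eq (isPhaseDensity_uniformDensity d) hd hβ (limitLaw_Iio_zero d β)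
      fun p => ?_
    rw [integral_limitDefect_uniformDensity]
    change ∫ t, (1 - resolventWeight t ^ p) ∂limitLaw d β = _
    rw [integral_one_sub_resolventWeight_pow, integral_resolventWeight_pow_limitLaw p hd hβ,
      sub_sub_cancel]
  · have hκ : Measurable fun z => (Λ (β / f z)).map fun t => f z * t :=
      (measurable_map_mul Λ β).comp hf.measurable
    have hprob : ∀ z, IsProbabilityMeasure ((Λ (β / f z)).map fun t => f z * t) := fun z =>
      Measure.isProbabilityMeasure_map (by fun_prop)
    rw [mixtureLSD_eq_bind hf]
    have hb : IsProbabilityMeasure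
        ((cubeLaw d).bind fun z => (Λ (β / f z)).map fun t => f z * t) :=
      isProbabilityMeasure_bind hκ
    refine isLSD_of_integral_eq hf hd hβ ?_ fun p => ?_
    · rw [Measure.bind_apply measurableSet_Iio hκ.aemeasurable]
      refine (lintegral_congr_ae ?_).trans lintegral_zero
      filter_upwards [ae_cubeLaw_mem_hypercube d] with z hz
      rw [Measure.map_apply (by fun_prop) measurableSet_Iio]
      refine measure_mono_null (fun t ht => ?_) (limitLaw_Iio_zero d (β / f z))
      exact neg_of_mul_neg_right ht (hf.nonneg z hz)
    · rw [integral_bind_of_mem_Icc (φ := fun t => 1 - resolventWeight t ^ p) hκ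
        (by simpa using (continuous_one_sub_resolventWeight_pow p 1).measurable)
        (one_sub_resolventWeight_pow_mem_Icc p)]
      refine integral_congr_ae ?_
      filter_upwards [ae_cubeLaw_mem_hypercube d] with z hz
      rw [integral_map (f := fun t => 1 - resolventWeight t ^ p)
        (by fun_prop : AEMeasurable (fun t : ℝ => f z * t) _)
        (by simpa using (continuous_one_sub_resolventWeight_pow p 1).aestronglyMeasurable)]
      rcases (hf.nonneg z hz).eq_or_lt with h0 | h0
      -- A region without sampling points has zero defect, in agreement with the point mass at zero.
      · simp [← h0, limitDefect_zero_left p hd hβ.le, resolventWeight]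
      · exact integral_one_sub_resolventWeight_mul_limitLaw p hd hβ h0

end
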